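/- \textbf{Model.} A consumer lives for $T<\infty$ periods. In period $t$ she privately observes her type $\theta_t\in\{l,h\}$. Types follow a Markov chain with initial probabilities $\pi_l,\pi_h>0$ and transition probabilities $\pi_{ij}=\mathbb P(\theta_{t+1}=j\mid\theta_t=i)$, with $\pi_{ll}>\pi_{hl}$, $\pi_{hh}>\pi_{lh}$ (persistence) and $\pi_{hl}>0$. Given $\theta_t=i$, income $y_t$ has distribution $p_i$ on a finite set $Y\subset\mathbb R_+$, where $p_h(y)>0$ for all $y$ and $\sum_y p_l(y)y<\sum_y p_h(y)y$. The Bernoulli utility $u:\mathbb R_+\to\mathbb R$ is continuous, strictly increasing, strictly concave, and twice continuously differentiable on $(0,\infty)$; the discount factor is $\delta\in(0,1)$. A flow contract is a map $z:Y\to\mathbb R_+$ (consumption as a function of income); it gives type $\theta$ the flow utility $v(z,\theta)=\sum_y p_\theta(y)u(z(y))$ and the firm the flow profit $\xi(z,\theta)=\sum_y p_\theta(y)(y-z(y))$. A realization-independent direct mechanism $M=\{z_t\}_{t=1}^T$ assigns to each history of type reports $(\hat\theta_1,\dots,\hat\theta_t)$ a flow contract $z_t(\hat\theta_1,\dots,\hat\theta_t)$.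 A reporting strategy chooses each report as a function of the current type and of all past incomes, reports and types. $M$ is incentive compatible if truth-telling maximizes the consumer's ex-ante expected discounted utility among all reporting strategies. For $V=(V_l,V_h)$, an optimal mechanism is an incentive compatible $M$ that gives the truthful consumer with initial type $\theta_1=\theta$ expected discounted utility $V_\theta$, for $\theta=l,h$, and that maximizes expected discounted profit $\mathbb E\sum_{t=1}^T\delta^{t-1}\xi(z_t(\theta_1,\dots,\theta_t),\theta_t)$ among all such mechanisms. Write $h^t$ for $t$ consecutive reports of $h$. $M$ is interior if $z_t(h^{t-1},\theta)(y)>0$ for all $t=1,\dots,T$, $\theta\in\{l,h\}$ and $y\in Y$. Along the path of consecutive high-type reports let \[ \nu_t=v(z_t(h^t),h),\qquad \Delta_t=\nu_t-v(z_t(h^t),l),\qquad t=1,\dots,T. \] For $(\nu,\Delta)\in\mathbb R^2$ let $\chi(\nu,\Delta)$ be the infimum of $\sum_y p_h(y)z(y)$ over flow contracts $z$ with $v(z,h)=\nu$ and $v(z,l)=\nu-\Delta$. Cost supermodularity means that $\partial^2\chi(\nu,\Delta)/\partial\nu\,\partial\Delta\ge 0$ at every $(\nu,\Delta)$ with $\Delta\ge0$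 at which this problem has a minimizer $z$ with $z(y)>0$ for all $y\in Y$. \textbf{Proposition.} Assume cost supermodularity and $V_h>V_l$, and let $M$ be an interior optimal mechanism. Then (i) $\{\nu_t\}_{t=1}^T$ is strictly increasing; (ii) $\{\Delta_t\}_{t=1}^T$ is strictly decreasing. -/

import Mathlib

open scoped NNReal

noncomputable section

namespace DynamicInsurance

/-- The two risk types: low `l` and high `h`. -/
inductive RiskType where
  | l
  | h
  deriving DecidableEq

open RiskType

instance : Fintype RiskType where
  elems := {l, h}
  complete := by rintro (_ | _) <;> simp

/-- The primitives of the finite-horizon insurance model. Incomes are the elements of the finite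
set `Y` of non-negative reals; `p θ` is the income distribution of type `θ`; `trans i j` is the
probability that type `i` is followed by type `j`; `init` is the law of the first type. -/
structure Model where
  /-- number of periods -/
  T : ℕ
  /-- set of income levels -/
  Y : Finset ℝ≥0
  /-- income distributions -/
  p : RiskType → Y → ℝ
  p_nonneg : ∀ θ y, 0 ≤ p θ y
  p_sum : ∀ θ, ∑ y, p θ y = 1
  /-- the likelihood ratios `p l y / p h y` are well defined -/
  p_high_pos : ∀ y, 0 < p h y
  mean_lt : ∑ y, p l y * ((y : ℝ≥0) : ℝ) < ∑ y, p h y * ((y : ℝ≥0) : ℝ)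
  /-- transition probabilities -/
  trans : RiskType → RiskType → ℝ
  trans_nonneg : ∀ i j, 0 ≤ trans i j
  trans_sum : ∀ i, ∑ j, trans i j = 1
  /-- types are persistent -/
  persistent : ∀ i j, i ≠ j → trans j i < trans i i
  /-- law of the initial type; both types are possible -/
  init : RiskType → ℝ
  init_pos : ∀ i, 0 < init i
  init_sum : ∑ i, init i = 1
  /-- Bernoulli utility; only its values on `[0, ∞)` matter -/
  u : ℝ → ℝ
  u_cont : ContinuousOn u (Set.Ici 0)
  u_smooth : ContDiffOn ℝ 2 u (Set.Ioi 0)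
  u_strictMono : StrictMonoOn u (Set.Ici 0)
  u_strictConcave : StrictConcaveOn ℝ (Set.Ici 0) u
  /-- discount factor -/
  δ : ℝ
  δ_pos : 0 < δ
  δ_lt_one : δ < 1

namespace Model

variable (E : Model)

/-- A flow contract assigns a non-negative consumption level to every income level. -/
abbrev Contract : Type := E.Y → ℝ≥0

/-- Flow utility `v(z, θ)`. -/
def flowUtility (z : E.Contract) (θ : RiskType) : ℝ :=
  ∑ y, E.p θ y * E.u (z y)

/-- Flow profit `ξ(z, θ)`. -/
def flowProfit (z : E.Contract) (θ : RiskType) : ℝ :=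
  ∑ y, E.p θ y * (((y : ℝ≥0) : ℝ) - (z y : ℝ))

/-- A realization-independent direct mechanism: the flow contract of a period as a function of the
list of past reports and of the current report. All histories are lists with the most recent entry
first; a history of length `t - 1` belongs to period `t`. -/
abbrev Mechanism : Type := List RiskType → RiskType → E.Contract

/-- A private history lists, for each past period, the realized income, the reported type and the
true type. -/
abbrev PrivateHistory : Type := List (E.Y × RiskType × RiskType)

/-- A reporting strategy: a report for every private history and current type. -/
abbrev Strategy : Type := E.PrivateHistory → RiskType → RiskType

/-- The truth-telling strategy. -/
def truthful : E.Strategy := fun _ θ => θ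

/-- The private history generated by the strategy `r` from a history of realized types and
incomes. -/
def privateHistory (r : E.Strategy) : List (RiskType × E.Y) → E.PrivateHistory
  | [] => []
  | (θ, y) :: s => (y, r (privateHistory r s) θ, θ) :: privateHistory r s

/-- The reports in a private history. -/
def reports (η : E.PrivateHistory) : List RiskType := η.map fun e => e.2.1

/-- Expected discounted sum of the payoffs `f` over `n` periods, from a period with past types and
incomes `s` and current type `θ` on: income is drawn from `p θ`, the next type from `trans θ`. -/
def expectedSum (f : List (RiskType × E.Y) → RiskType → ℝ) :
    ℕ → List (RiskType × E.Y) → RiskType → ℝ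
  | 0, _, _ => 0
  | n + 1, s, θ =>
      f s θ + E.δ * ∑ y, E.p θ y * ∑ θ', E.trans θ θ' * expectedSum f n ((θ, y) :: s) θ'

/-- Payoff of the consumer with initial type `θ` who follows the strategy `r`. -/
def typeValue (M : E.Mechanism) (r : E.Strategy) (θ : RiskType) : ℝ :=
  E.expectedSum
    (fun s θ => E.flowUtility
      (M (E.reports (E.privateHistory r s)) (r (E.privateHistory r s) θ)) θ)
    E.T [] θ

/-- Ex-ante payoff `V₀ʳ(M)` of the strategy `r`. -/
def strategyValue (M : E.Mechanism) (r : E.Strategy) : ℝ :=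
  ∑ θ, E.init θ * E.typeValue M r θ

/-- Incentive compatibility: no reporting strategy beats truth-telling. -/
def IncentiveCompatible (M : E.Mechanism) : Prop :=
  ∀ r : E.Strategy, E.strategyValue M r ≤ E.strategyValue M E.truthful

/-- Expected discounted profit of the mechanism under truth-telling. -/
def profit (M : E.Mechanism) : ℝ :=
  ∑ θ, E.init θ *
    E.expectedSum (fun s θ => E.flowProfit (M (s.map Prod.fst) θ) θ) E.T [] θ

/-- `M` is incentive compatible and gives utility `V θ` to each initial type `θ`. -/
def Feasible (V : RiskType → ℝ) (M : E.Mechanism) : Prop :=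
  E.IncentiveCompatible M ∧ ∀ θ, E.typeValue M E.truthful θ = V θ

/-- `M` maximizes profit among the incentive compatible mechanisms with utilities `V`. -/
def IsOptimal (V : RiskType → ℝ) (M : E.Mechanism) : Prop :=
  E.Feasible V M ∧ ∀ M' : E.Mechanism, E.Feasible V M' → E.profit M' ≤ E.profit M

/-- Consumption is strictly positive after every report in every period that follows only
high-type reports. -/
def Interior (M : E.Mechanism) : Prop :=
  ∀ t ∈ Set.Icc 1 E.T, ∀ θ y, 0 < M (List.replicate (t - 1) h) θ y

/-- Flow utility `ν_t` of the high type in period `t` after `t` high-type reports. -/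
def highUtility (M : E.Mechanism) (t : ℕ) : ℝ :=
  E.flowUtility (M (List.replicate (t - 1) h) h) h

/-- Distortion `Δ_t` in period `t` after `t` high-type reports. -/
def distortion (M : E.Mechanism) (t : ℕ) : ℝ :=
  E.highUtility M t - E.flowUtility (M (List.replicate (t - 1) h) h) l

/-- The contracts with high-type utility `ν` and low-type utility `ν - Δ`. -/
def auxFeasible (ν Δ : ℝ) : Set E.Contract :=
  {z | E.flowUtility z h = ν ∧ E.flowUtility z l = ν - Δ}

/-- Expected consumption of the high type. -/
def auxCost (z : E.Contract) : ℝ := ∑ y, E.p h y * (z y : ℝ)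

/-- The auxiliary cost function `χ`. -/
def chi (ν Δ : ℝ) : ℝ := sInf (E.auxCost '' E.auxFeasible ν Δ)

/-- The auxiliary problem at `(ν, Δ)` has a solution with strictly positive consumption. -/
def HasInteriorSolution (ν Δ : ℝ) : Prop :=
  ∃ z ∈ E.auxFeasible ν Δ, (∀ y, 0 < z y) ∧ ∀ z' ∈ E.auxFeasible ν Δ, E.auxCost z ≤ E.auxCost z'

/-- Cost supermodularity: `∂²χ/∂ν∂Δ ≥ 0` at every `(ν, Δ)` with `Δ ≥ 0` at which the auxiliary
problem has an interior solution. -/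
def CostSupermodular : Prop :=
  ∀ ν Δ : ℝ, 0 ≤ Δ → E.HasInteriorSolution ν Δ →
    0 ≤ deriv (fun n => deriv (fun d => E.chi n d) Δ) ν

end Model

end DynamicInsurance

end

open scoped NNReal

noncomputable section

namespace DynamicInsurance

open RiskType Set Filter Topology

/-! Contracts are measured in utility. `marginalCost` is `1 / u'`, and `kappa s` is the utility
level whose marginal cost is `s`.

Relaxation. Of all incentive constraints only those of a low type who imitates the high type after
high reports are kept, and by Jensen everything after a first low report becomes constant
consumption (`exists_reduction`). The relaxed problem over `Admissible` plans is no cheaper than the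
original. A plan that always promises the high type at least as much as the low type is incentive
compatible (`Admissible.feasible`). Otherwise, from the first date where this fails, everybody can
be insured at one common level: the cost does not rise and imitation becomes no more attractive
(`Admissible.pool`, `Admissible.exists_feasible_le`). So the high path of an optimal mechanism
belongs to a cost-minimizing plan.

First-order conditions. On the high path the marginal cost of utility is `λ_t + μ_t (1 - p_l / p_h)`
with `μ_t ≥ 0`. If `m_t` is the marginal cost at the constant utility that follows a first low
report in period `t`, then `λ_t = π_hh λ_{t+1} + π_hl m_{t+1}` and `(π_hh - π_lh) μ_t = π_hh μ_{t+1}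
+ π_hl (λ_t - m_{t+1})`. Hence `m_{t+1} < λ_{t+1}` is enough for `λ` to rise and `μ` to fall
strictly.

Concavity. Cost supermodularity makes `kappa` concave (`kappa_concaveOn`), which serves twice. By
Jensen along the martingale `λ`, the high type's promise is at most that of the constant utility
`kappa λ_t` (`Admissible.highValue_le`); as it strictly exceeds the low type's promise
(`Admissible.annuity_mul_lt_highValue`), `m_{t+1} < λ_{t+1}` follows. Concavity also makes the
utility `ν` fall in `μ` and the distortion `Δ` fall in `λ`, so that the motion of the multipliers
gives both claims (`dualUtility_lt_and_dualDistortion_lt`). -/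

theorem image_Ioi_mem_nhds {f : ℝ → ℝ} (hf : StrictMonoOn f (Ioi 0))
    (hc : ContinuousOn f (Ioi 0)) {x : ℝ} (hx : 0 < x) : f '' Ioi 0 ∈ 𝓝 (f x) := by
  have h1 : f (x / 2) < f x := hf (half_pos hx) hx (by linarith)
  have h2 : f x < f (2 * x) := hf hx (show 0 < 2 * x by linarith) (by linarith)
  have h3 : Icc (x / 2) (2 * x) ⊆ Ioi 0 := fun y hy => lt_of_lt_of_le (half_pos hx) hy.1
  have h4 := intermediate_value_Icc (show x / 2 ≤ 2 * x by linarith) (hc.mono h3)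
  exact Filter.mem_of_superset (Icc_mem_nhds h1 h2) (h4.trans (image_mono h3))

theorem continuousAt_of_leftInverse_Ioi {f G : ℝ → ℝ} (hf : StrictMonoOn f (Ioi 0))
    (hc : ContinuousOn f (Ioi 0)) (hG : ∀ z, 0 < z → G (f z) = z) {x : ℝ} (hx : 0 < x) :
    ContinuousAt G (f x) := by
  have hmono : StrictMonoOn G (f '' Ioi 0) := by
    rintro _ ⟨a, ha, rfl⟩ _ ⟨b, hb, rfl⟩ hab
    rw [hG a ha, hG b hb]
    exact (hf.lt_iff_lt ha hb).1 hab
  refine hmono.continuousAt_of_image_mem_nhds (image_Ioi_mem_nhds hf hc hx) ?_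
  rw [hG x hx]
  refine Filter.mem_of_superset (Ioi_mem_nhds hx) ?_
  intro z hz
  exact ⟨f z, ⟨z, hz, rfl⟩, hG z hz⟩

/-! ### Utility, its marginal cost, and their inverses -/

namespace Model

variable (E : Model)

theorem hasDerivAt_u {c : ℝ} (hc : 0 < c) : HasDerivAt E.u (deriv E.u c) c :=
  (((E.u_smooth.contDiffAt (Ioi_mem_nhds hc)).differentiableAt (by norm_num))).hasDerivAt

theorem u_lt_tangent {c z : ℝ} (hc : 0 < c) (hz : 0 ≤ z) (hne : z ≠ c) :
    E.u z < E.u c + deriv E.u c * (z - c) := by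
  rcases lt_or_gt_of_ne hne with h | h
  · have := E.u_strictConcave.lt_slope_of_hasDerivAt (mem_Ici.2 hz) (mem_Ici.2 hc.le) h
      (E.hasDerivAt_u hc)
    rw [slope_def_field, lt_div_iff₀ (by linarith)] at this
    linarith
  · have := E.u_strictConcave.slope_lt_of_hasDerivAt (mem_Ici.2 hc.le) (mem_Ici.2 hz) h
      (E.hasDerivAt_u hc)
    rw [slope_def_field, div_lt_iff₀ (by linarith)] at this
    linarith

theorem u_le_tangent {c z : ℝ} (hc : 0 < c) (hz : 0 ≤ z) :
    E.u z ≤ E.u c + deriv E.u c * (z - c) := by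
  rcases eq_or_ne z c with rfl | h
  · simp
  · exact (E.u_lt_tangent hc hz h).le

theorem deriv_u_pos {c : ℝ} (hc : 0 < c) : 0 < deriv E.u c := by
  have h1 := E.u_lt_tangent hc (show (0 : ℝ) ≤ c + 1 by linarith) (by linarith)
  have h2 : E.u c < E.u (c + 1) :=
    E.u_strictMono (mem_Ici.2 hc.le) (mem_Ici.2 (by linarith)) (by linarith)
  have : (c + 1 - c) = 1 := by ring
  rw [this] at h1
  linarith

theorem deriv_u_strictAntiOn : StrictAntiOn (deriv E.u) (Ioi 0) := by
  intro a ha b hb hab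
  have h1 := E.u_lt_tangent ha (le_of_lt hb) hab.ne'
  have h2 := E.u_lt_tangent hb (le_of_lt ha) hab.ne
  nlinarith

/-- The marginal cost `1 / u'(c)` of utility at the consumption level `c`. -/
def marginalCost (c : ℝ) : ℝ := (deriv E.u c)⁻¹

theorem marginalCost_pos {c : ℝ} (hc : 0 < c) : 0 < E.marginalCost c :=
  inv_pos.2 (E.deriv_u_pos hc)

theorem marginalCost_strictMonoOn : StrictMonoOn E.marginalCost (Ioi 0) := by
  intro a ha b hb hab
  exact (inv_lt_inv₀ (E.deriv_u_pos ha) (E.deriv_u_pos hb)).2 (E.deriv_u_strictAntiOn ha hb hab)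

theorem marginalCost_contDiffOn : ContDiffOn ℝ 1 E.marginalCost (Ioi 0) := by
  have h : ContDiffOn ℝ 1 (deriv E.u) (Ioi 0) :=
    E.u_smooth.deriv_of_isOpen isOpen_Ioi (by norm_num)
  exact h.inv fun x hx => (E.deriv_u_pos hx).ne'

theorem marginalCost_continuousOn : ContinuousOn E.marginalCost (Ioi 0) :=
  E.marginalCost_contDiffOn.continuousOn

/-- The tangent inequality of the concave `u`, multiplied by `1 / u'`: the cost of utility is
strictly convex. Only the point of tangency must be positive; `z = 0` is allowed. -/
theorem cost_tangent_lt {c z : ℝ} (hc : 0 < c) (hz : 0 ≤ z) (hne : z ≠ c) :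
    c + E.marginalCost c * (E.u z - E.u c) < z := by
  have h := E.u_lt_tangent hc hz hne
  have h1 := E.marginalCost_pos hc
  have h2 : E.marginalCost c * deriv E.u c = 1 := inv_mul_cancel₀ (E.deriv_u_pos hc).ne'
  have h3 := mul_lt_mul_of_pos_left h h1
  nlinarith

theorem cost_tangent_le {c z : ℝ} (hc : 0 < c) (hz : 0 ≤ z) :
    c + E.marginalCost c * (E.u z - E.u c) ≤ z := by
  rcases eq_or_ne z c with rfl | h
  · simp
  · exact (E.cost_tangent_lt hc hz h).le

/-- The range of flow utilities. -/
def utilityRange : Set ℝ := E.u '' Ici 0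

/-- The consumption level that gives a flow utility. -/
def cons (v : ℝ) : ℝ := Function.invFunOn E.u (Ici 0) v

theorem utilityRange_convex : Convex ℝ E.utilityRange :=
  ((isPreconnected_Ici.image _ E.u_cont).ordConnected).convex

theorem u_mem_utilityRange {c : ℝ} (hc : 0 ≤ c) : E.u c ∈ E.utilityRange := ⟨c, hc, rfl⟩

theorem cons_u {c : ℝ} (hc : 0 ≤ c) : E.cons (E.u c) = c :=
  E.u_strictMono.injOn.leftInvOn_invFunOn (mem_Ici.2 hc)

theorem cons_nonneg {v : ℝ} (hv : v ∈ E.utilityRange) : 0 ≤ E.cons v := by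
  obtain ⟨c, hc, rfl⟩ := hv
  rwa [E.cons_u hc]

theorem u_cons {v : ℝ} (hv : v ∈ E.utilityRange) : E.u (E.cons v) = v := by
  obtain ⟨c, hc, rfl⟩ := hv
  rw [E.cons_u hc]

theorem cons_pos_iff {v : ℝ} (hv : v ∈ E.utilityRange) : 0 < E.cons v ↔ E.u 0 < v := by
  obtain ⟨c, hc, rfl⟩ := hv
  rw [E.cons_u hc]
  exact (E.u_strictMono.lt_iff_lt (mem_Ici.2 le_rfl) hc).symm

theorem u_strictMonoOn_Ioi : StrictMonoOn E.u (Ioi 0) := E.u_strictMono.mono Ioi_subset_Ici_self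

theorem u_continuousOn_Ioi : ContinuousOn E.u (Ioi 0) := E.u_cont.mono Ioi_subset_Ici_self

theorem utilityRange_mem_nhds {v : ℝ} (hv : v ∈ E.utilityRange) (hpos : 0 < E.cons v) :
    E.utilityRange ∈ 𝓝 v := by
  have := image_Ioi_mem_nhds E.u_strictMonoOn_Ioi E.u_continuousOn_Ioi hpos
  rw [E.u_cons hv] at this
  exact Filter.mem_of_superset this (image_mono Ioi_subset_Ici_self)

theorem hasDerivAt_cons {v : ℝ} (hv : v ∈ E.utilityRange) (hpos : 0 < E.cons v) :
    HasDerivAt E.cons (E.marginalCost (E.cons v)) v := by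
  have hcont : ContinuousAt E.cons (E.u (E.cons v)) :=
    continuousAt_of_leftInverse_Ioi E.u_strictMonoOn_Ioi E.u_continuousOn_Ioi
      (fun z hz => E.cons_u hz.le) hpos
  rw [E.u_cons hv] at hcont
  refine HasDerivAt.of_local_left_inverse hcont (E.hasDerivAt_u hpos) (E.deriv_u_pos hpos).ne' ?_
  filter_upwards [E.utilityRange_mem_nhds hv hpos] with y hy using E.u_cons hy

theorem cons_tangent_le {v w : ℝ} (hv : v ∈ E.utilityRange) (hpos : 0 < E.cons v)
    (hw : w ∈ E.utilityRange) :
    E.cons v + E.marginalCost (E.cons v) * (w - v) ≤ E.cons w := by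
  have := E.cost_tangent_le hpos (E.cons_nonneg hw)
  rwa [E.u_cons hv, E.u_cons hw] at this

theorem cons_tangent_lt {v w : ℝ} (hv : v ∈ E.utilityRange) (hpos : 0 < E.cons v)
    (hw : w ∈ E.utilityRange) (hne : w ≠ v) :
    E.cons v + E.marginalCost (E.cons v) * (w - v) < E.cons w := by
  have hne' : E.cons w ≠ E.cons v := fun h => hne (by rw [← E.u_cons hw, h, E.u_cons hv])
  have := E.cost_tangent_lt hpos (E.cons_nonneg hw) hne'
  rwa [E.u_cons hv, E.u_cons hw] at this

/-- The range of marginal costs at positive consumption levels. -/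
def costRange : Set ℝ := E.marginalCost '' Ioi 0

/-- The consumption level with a given marginal cost. -/
def demand (s : ℝ) : ℝ := Function.invFunOn E.marginalCost (Ioi 0) s

/-- The flow utility at which the marginal cost has a given value. -/
def kappa (s : ℝ) : ℝ := E.u (E.demand s)

variable {E}

theorem marginalCost_mem {c : ℝ} (hc : 0 < c) : E.marginalCost c ∈ E.costRange := ⟨c, hc, rfl⟩

theorem demand_marginalCost {c : ℝ} (hc : 0 < c) : E.demand (E.marginalCost c) = c :=
  E.marginalCost_strictMonoOn.injOn.leftInvOn_invFunOn (mem_Ioi.2 hc)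

theorem demand_pos {s : ℝ} (hs : s ∈ E.costRange) : 0 < E.demand s := by
  obtain ⟨c, hc, rfl⟩ := hs
  rwa [demand_marginalCost hc]

theorem marginalCost_demand {s : ℝ} (hs : s ∈ E.costRange) : E.marginalCost (E.demand s) = s := by
  obtain ⟨c, hc, rfl⟩ := hs
  rw [demand_marginalCost hc]

theorem kappa_marginalCost {c : ℝ} (hc : 0 < c) : E.kappa (E.marginalCost c) = E.u c := by
  rw [kappa, demand_marginalCost hc]

theorem costRange_isOpen : IsOpen E.costRange := by
  rw [isOpen_iff_mem_nhds]
  rintro _ ⟨c, hc, rfl⟩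
  exact image_Ioi_mem_nhds E.marginalCost_strictMonoOn E.marginalCost_continuousOn hc

theorem costRange_convex : Convex ℝ E.costRange :=
  ((isPreconnected_Ioi.image _ E.marginalCost_continuousOn).ordConnected).convex

theorem demand_strictMonoOn : StrictMonoOn E.demand E.costRange := by
  rintro _ ⟨a, ha, rfl⟩ _ ⟨b, hb, rfl⟩ hab
  rw [demand_marginalCost ha, demand_marginalCost hb]
  exact (E.marginalCost_strictMonoOn.lt_iff_lt ha hb).1 hab

theorem kappa_strictMonoOn : StrictMonoOn E.kappa E.costRange := fun _ ha _ hb hab =>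
  E.u_strictMono (mem_Ici.2 (demand_pos ha).le) (mem_Ici.2 (demand_pos hb).le)
    (demand_strictMonoOn ha hb hab)

theorem demand_continuousOn : ContinuousOn E.demand E.costRange := by
  rintro _ ⟨c, hc, rfl⟩
  exact (continuousAt_of_leftInverse_Ioi E.marginalCost_strictMonoOn E.marginalCost_continuousOn
    (fun z hz => demand_marginalCost hz) hc).continuousWithinAt

theorem kappa_continuousOn : ContinuousOn E.kappa E.costRange :=
  E.u_cont.comp demand_continuousOn fun _ hs => mem_Ici.2 (demand_pos hs).le

/-- The function `z - s * u z` is convex and stationary where `1 / u' = s`. This is the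
income-by-income minimization behind the duality for `chi`. -/
theorem demand_sub_le {s z : ℝ} (hs : s ∈ E.costRange) (hz : 0 ≤ z) :
    E.demand s - s * E.kappa s ≤ z - s * E.u z := by
  have := E.cost_tangent_le (demand_pos hs) hz
  rw [marginalCost_demand hs] at this
  simp only [kappa]
  linarith

/-- Where `u''` vanishes `kappa` need not be differentiable, but its inverse is Lipschitz on compact
sets because `1 / u'` is continuously differentiable. -/
theorem exists_abs_sub_le_kappa {a b : ℝ} (h : Icc a b ⊆ E.costRange) :
    ∃ L : ℝ, 0 < L ∧ ∀ s ∈ Icc a b, ∀ t ∈ Icc a b,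
      |t - s| ≤ L * |E.kappa t - E.kappa s| := by
  rcases lt_or_ge b a with hab | hab
  · exact ⟨1, one_pos, fun s hs => absurd (hs.1.trans hs.2) (not_le.2 hab)⟩
  have ha := h (left_mem_Icc.2 hab)
  have hb := h (right_mem_Icc.2 hab)
  have hsub : Icc (E.demand a) (E.demand b) ⊆ Ioi 0 := fun c hc => (demand_pos ha).trans_le hc.1
  obtain ⟨K, hK⟩ := (E.marginalCost_contDiffOn.mono hsub).exists_lipschitzOnWith one_ne_zero
    (convex_Icc _ _) isCompact_Icc
  have hd := E.deriv_u_pos (demand_pos hb)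
  -- `K` bounds the slope of `marginalCost`, and `u'` is smallest at the right end; the `+ 1` keeps
  -- the constant positive.
  refine ⟨(K + 1) / deriv E.u (E.demand b), by positivity, fun s hs t ht => ?_⟩
  have key : ∀ s ∈ Icc a b, E.demand s ∈ Icc (E.demand a) (E.demand b) := fun s hs =>
    ⟨demand_strictMonoOn.monotoneOn ha (h hs) hs.1, demand_strictMonoOn.monotoneOn (h hs) hb hs.2⟩
  have h1 := hK.dist_le_mul _ (key t ht) _ (key s hs)
  rw [marginalCost_demand (h ht), marginalCost_demand (h hs), Real.dist_eq, Real.dist_eq] at h1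
  have h2 : ∀ s ∈ Icc a b, ∀ t ∈ Icc a b, s ≤ t →
      deriv E.u (E.demand b) * |E.demand t - E.demand s| ≤ |E.kappa t - E.kappa s| := by
    intro s hs t ht hst
    have h3 : E.demand s ≤ E.demand t := demand_strictMonoOn.monotoneOn (h hs) (h ht) hst
    have h4 : E.kappa s ≤ E.kappa t := kappa_strictMonoOn.monotoneOn (h hs) (h ht) hst
    rw [abs_of_nonneg (sub_nonneg.2 h3), abs_of_nonneg (sub_nonneg.2 h4)]
    have h5 := E.u_le_tangent (demand_pos (h ht)) (demand_pos (h hs)).le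
    have h6 : deriv E.u (E.demand b) ≤ deriv E.u (E.demand t) :=
      E.deriv_u_strictAntiOn.antitoneOn (demand_pos (h ht)) (demand_pos hb) (key t ht).2
    simp only [kappa]
    nlinarith
  have h3 : deriv E.u (E.demand b) * |E.demand t - E.demand s| ≤ |E.kappa t - E.kappa s| := by
    rcases le_total s t with hst | hst
    · exact h2 s hs t ht hst
    · rw [abs_sub_comm (E.demand t), abs_sub_comm (E.kappa t)]
      exact h2 t ht s hs hst
  rw [div_mul_eq_mul_div, le_div_iff₀ hd]
  have hK0 : (0 : ℝ) ≤ K := K.2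
  nlinarith [abs_nonneg (E.demand t - E.demand s), abs_nonneg (E.kappa t - E.kappa s)]

end Model

/-- A continuous function on an open convex set that weakly dislikes arbitrarily small multiples
of a fixed zero-mean gamble is concave. -/
theorem concaveOn_of_small_gambles {ι : Type*} [Fintype ι] {p x : ι → ℝ} {J : Set ℝ} {f : ℝ → ℝ}
    (hp : ∀ i, 0 < p i) (hp1 : ∑ i, p i = 1) (hx : ∑ i, p i * x i = 0) (hneg : ∃ i, x i < 0)
    (hJ : Convex ℝ J) (hf : ContinuousOn f J)
    (h : ∀ a ∈ J, ∀ᶠ μ in 𝓝[>] (0 : ℝ), ∑ i, p i * f (a + μ * x i) ≤ f a) :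
    ConcaveOn ℝ J f := by
  refine LinearOrder.concaveOn_of_lt hJ fun s hs t ht hst α β hα hβ hαβ => ?_
  by_contra hcon
  rw [not_le] at hcon
  simp only [smul_eq_mul] at hcon
  have hsub : Icc s t ⊆ J := hJ.ordConnected.out hs ht
  obtain ⟨k, hk⟩ : ∃ k : ℝ, k = (f t - f s) / (t - s) := ⟨_, rfl⟩
  have hts : t - s ≠ 0 := (sub_pos.2 hst).ne'
  have hkt : k * (t - s) = f t - f s := by rw [hk]; field_simp
  -- The gap between `f` and its chord: zero at both ends and negative somewhere by `hcon`.
  set φ : ℝ → ℝ := fun r => f r - (f s + k * (r - s)) with hφ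
  have hφc : ContinuousOn φ (Icc s t) := (hf.mono hsub).sub (by fun_prop)
  have hφs : φ s = 0 := by simp [hφ]
  have hφt : φ t = 0 := by simp [hφ, hkt]
  obtain ⟨c, hc, hcmin⟩ := isCompact_Icc.exists_isMinOn (nonempty_Icc.2 hst.le) hφc
  have hcmin' : ∀ r ∈ Icc s t, φ c ≤ φ r := fun r hr => hcmin hr
  have hβe : α = 1 - β := by linarith
  have hmem : α * s + β * t ∈ Icc s t := by
    rw [hβe]
    constructor <;> nlinarith
  have hm : φ c < 0 := by
    refine lt_of_le_of_lt (hcmin' _ hmem) ?_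
    have : α * s + β * t - s = β * (t - s) := by rw [hβe]; ring
    simp only [hφ, this]
    subst hβe
    nlinarith
  have hK : IsCompact (Icc s t ∩ φ ⁻¹' {φ c}) :=
    isCompact_Icc.of_isClosed_subset
      (hφc.preimage_isClosed_of_isClosed isClosed_Icc isClosed_singleton) inter_subset_left
  -- At the leftmost minimizer a small gamble never lowers `φ`, and strictly raises it in an outcome
  -- with negative `x`, which lands to the left. This contradicts the weak dislike of the gamble.
  obtain ⟨r, ⟨hr, hrc⟩, hrleast⟩ := hK.exists_isLeast ⟨c, hc, rfl⟩
  have hrc' : φ r = φ c := hrc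
  have hrs : r ≠ s := fun e => by rw [e, hφs] at hrc'; linarith
  have hrt : r ≠ t := fun e => by rw [e, hφt] at hrc'; linarith
  have hrI : Ioo s t ∈ 𝓝 r :=
    Ioo_mem_nhds (lt_of_le_of_ne hr.1 hrs.symm) (lt_of_le_of_ne hr.2 hrt)
  have hev : ∀ i, ∀ᶠ μ in 𝓝[>] (0 : ℝ), r + μ * x i ∈ Ioo s t := by
    intro i
    have hcont : ContinuousAt (fun μ : ℝ => r + μ * x i) 0 := by fun_prop
    have : Ioo s t ∈ 𝓝 (r + 0 * x i) := by simpa using hrI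
    exact (hcont.eventually this).filter_mono nhdsWithin_le_nhds
  obtain ⟨μ, ⟨hμ1, hμ2⟩, hμ0⟩ :=
    (((h r (hsub hr)).and (eventually_all.2 hev)).and self_mem_nhdsWithin).exists
  have hμ : 0 < μ := hμ0
  obtain ⟨j, hj⟩ := hneg
  have hle : ∀ i, φ c ≤ φ (r + μ * x i) := fun i => hcmin' _ (Ioo_subset_Icc_self (hμ2 i))
  have hlt : φ c < φ (r + μ * x j) := by
    refine lt_of_le_of_ne (hle j) fun e => ?_
    have := hrleast ⟨Ioo_subset_Icc_self (hμ2 j), e.symm⟩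
    nlinarith
  have hsum : ∑ i, p i * φ c < ∑ i, p i * φ (r + μ * x i) :=
    Finset.sum_lt_sum (fun i _ => mul_le_mul_of_nonneg_left (hle i) (hp i).le)
      ⟨j, Finset.mem_univ _, mul_lt_mul_of_pos_left hlt (hp j)⟩
  rw [← Finset.sum_mul, hp1, one_mul] at hsum
  have heq : ∑ i, p i * φ (r + μ * x i) =
      ∑ i, p i * f (r + μ * x i) - (f s + k * (r - s)) := by
    have : ∀ i, p i * φ (r + μ * x i) = p i * f (r + μ * x i) - p i * (f s + k * (r - s))
        - k * μ * (p i * x i) := fun i => by simp only [hφ]; ring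
    simp only [this, Finset.sum_sub_distrib, ← Finset.sum_mul, ← Finset.mul_sum, hp1, hx]
    ring
  rw [heq] at hsum
  have : φ r = f r - (f s + k * (r - s)) := rfl
  linarith

/-- `deriv` is zero where no derivative exists, so its sign alone proves nothing. A Lipschitz
function is absolutely continuous and hence the integral of its `deriv`. -/
theorem le_of_lipschitz_of_deriv_nonneg {f : ℝ → ℝ} {a b L : ℝ} (hab : a ≤ b)
    (hL : ∀ s ∈ Icc a b, ∀ t ∈ Icc a b, |f t - f s| ≤ L * |t - s|)
    (hd : ∀ s ∈ Icc a b, 0 ≤ deriv f s) : f a ≤ f b := by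
  have hlip : LipschitzOnWith (Real.toNNReal L) f (uIcc a b) := by
    rw [uIcc_of_le hab]
    refine LipschitzOnWith.of_dist_le_mul fun s hs t ht => ?_
    rw [Real.dist_eq, Real.dist_eq]
    exact (hL t ht s hs).trans (mul_le_mul_of_nonneg_right (Real.le_coe_toNNReal L) (abs_nonneg _))
  have h := hlip.absolutelyContinuousOnInterval.integral_deriv_eq_sub
  have h2 := intervalIntegral.integral_nonneg (μ := MeasureTheory.volume) hab hd
  linarith

theorem sum_riskType (f : RiskType → ℝ) : ∑ θ, f θ = f l + f h := by
  have : (Finset.univ : Finset RiskType) = {l, h} := rfl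
  rw [this, Finset.sum_pair (by decide)]

/-! ### Contracts with marginal cost affine in the score, and duality for the auxiliary cost -/

namespace Model

variable {E : Model}

variable (E) in
/-- One minus the likelihood ratio of the low and the high type. -/
def score (y : E.Y) : ℝ := 1 - E.p l y / E.p h y

theorem p_mul_score (y : E.Y) : E.p h y * E.score y = E.p h y - E.p l y := by
  have := (E.p_high_pos y).ne'
  simp only [score]
  field_simp

theorem sum_p_score : ∑ y, E.p h y * E.score y = 0 := by
  simp only [p_mul_score, Finset.sum_sub_distrib, E.p_sum, sub_self]

/-- A nonnegative score with mean zero vanishes; the two income laws would then coincide, against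
`mean_lt`. -/
theorem exists_score_neg : ∃ y, E.score y < 0 := by
  by_contra! hcon
  have h0 : ∀ y ∈ Finset.univ, E.p h y * E.score y = 0 :=
    (Finset.sum_eq_zero_iff_of_nonneg
      fun y _ => mul_nonneg (E.p_high_pos y).le (hcon y)).1 sum_p_score
  have h1 : ∀ y, E.p h y = E.p l y := fun y => by
    have := h0 y (Finset.mem_univ y)
    rw [p_mul_score] at this
    linarith
  have := E.mean_lt
  simp only [h1, lt_self_iff_false] at this

variable (E) in
/-- The variance of the score under the high type. -/
def scoreVar : ℝ := ∑ y, E.p h y * E.score y ^ 2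

theorem scoreVar_pos : 0 < E.scoreVar := by
  obtain ⟨y, hy⟩ := exists_score_neg (E := E)
  exact Finset.sum_pos' (fun y _ => mul_nonneg (E.p_high_pos y).le (sq_nonneg _))
    ⟨y, Finset.mem_univ y, mul_pos (E.p_high_pos y) (sq_pos_iff.2 hy.ne)⟩

/-- The distortion is the covariance of utility and score, so both constraints of the auxiliary
problem are linear in utilities under `p h`. -/
theorem flowUtility_sub (z : E.Contract) :
    E.flowUtility z h - E.flowUtility z l = ∑ y, E.p h y * (E.score y * E.u (z y)) := by
  simp only [flowUtility, ← Finset.sum_sub_distrib, ← mul_assoc, p_mul_score, sub_mul]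

variable (E) in
/-- High-type utility when the marginal cost is affine in the score. -/
def dualUtility (a b : ℝ) : ℝ := ∑ y, E.p h y * E.kappa (a + b * E.score y)

variable (E) in
/-- Distortion when the marginal cost is affine in the score. -/
def dualDistortion (a b : ℝ) : ℝ := ∑ y, E.p h y * (E.score y * E.kappa (a + b * E.score y))

variable (E) in
/-- Cost when the marginal cost is affine in the score. -/
def dualCost (a b : ℝ) : ℝ := ∑ y, E.p h y * E.demand (a + b * E.score y)

variable (E) in
/-- The multipliers at which all marginal costs are attained. -/
def dualDomain : Set (ℝ × ℝ) := {q | ∀ y, q.1 + q.2 * E.score y ∈ E.costRange}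

theorem sum_p_affine (a b : ℝ) : ∑ y, E.p h y * (a + b * E.score y) = a := by
  have : ∀ y, E.p h y * (a + b * E.score y) = E.p h y * a + b * (E.p h y * E.score y) :=
    fun y => by ring
  simp only [this, Finset.sum_add_distrib, ← Finset.sum_mul, ← Finset.mul_sum, E.p_sum,
    sum_p_score]
  ring

theorem sum_p_score_affine (a b : ℝ) :
    ∑ y, E.p h y * (E.score y * (a + b * E.score y)) = b * E.scoreVar := by
  have : ∀ y, E.p h y * (E.score y * (a + b * E.score y)) =
      a * (E.p h y * E.score y) + b * (E.p h y * E.score y ^ 2) := fun y => by ring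
  simp only [this, Finset.sum_add_distrib, ← Finset.mul_sum, sum_p_score, scoreVar]
  ring

theorem dualUtility_zero (a : ℝ) : E.dualUtility a 0 = E.kappa a := by
  simp only [dualUtility, zero_mul, add_zero, ← Finset.sum_mul, E.p_sum, one_mul]

theorem dualDistortion_zero (a : ℝ) : E.dualDistortion a 0 = 0 := by
  have : ∀ y, E.p h y * (E.score y * E.kappa (a + 0 * E.score y)) =
      (E.p h y * E.score y) * E.kappa a := fun y => by rw [zero_mul, add_zero]; ring
  rw [dualDistortion, Finset.sum_congr rfl fun y _ => this y, ← Finset.sum_mul, sum_p_score,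
    zero_mul]

/-- The contract with marginal costs affine in the score. -/
def dualContract (a b : ℝ) : E.Contract := fun y => (E.demand (a + b * E.score y)).toNNReal

theorem coe_dualContract {a b : ℝ} (hab : (a, b) ∈ E.dualDomain) (y : E.Y) :
    ((dualContract a b : E.Contract) y : ℝ) = E.demand (a + b * E.score y) :=
  Real.coe_toNNReal _ (demand_pos (hab y)).le

theorem dualContract_mem {a b : ℝ} (hab : (a, b) ∈ E.dualDomain) :
    dualContract a b ∈ E.auxFeasible (E.dualUtility a b) (E.dualDistortion a b) := by
  have h1 : E.flowUtility (dualContract a b) h = E.dualUtility a b := by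
    simp only [flowUtility, coe_dualContract hab]
    rfl
  have h2 := flowUtility_sub (E := E) (dualContract a b)
  have h3 : ∑ y, E.p h y * (E.score y * E.u ((dualContract a b : E.Contract) y)) =
      E.dualDistortion a b := by
    simp only [coe_dualContract hab]
    rfl
  exact ⟨h1, by linarith⟩

theorem auxCost_dualContract {a b : ℝ} (hab : (a, b) ∈ E.dualDomain) :
    E.auxCost (dualContract a b) = E.dualCost a b := by
  simp only [auxCost, coe_dualContract hab]
  rfl

/-- Weak duality: with multipliers `a` and `b` the Lagrangian separates over incomes, and
`demand_sub_le` minimizes each term. It yields both the optimality of the dual contract and the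
subgradient `(a, b)` of `chi`. -/
theorem dual_le_auxCost {a b ν Δ : ℝ} (hab : (a, b) ∈ E.dualDomain) {z : E.Contract}
    (hz : z ∈ E.auxFeasible ν Δ) :
    E.dualCost a b + a * (ν - E.dualUtility a b) + b * (Δ - E.dualDistortion a b) ≤
      E.auxCost z := by
  have h1 : ∑ y, E.p h y * E.u (z y) = ν := hz.1
  have h2 : ∑ y, E.p h y * (E.score y * E.u (z y)) = Δ := by
    rw [← flowUtility_sub, hz.1, hz.2]; ring
  have h3 : ∑ y, E.p h y * (E.demand (a + b * E.score y) -
        (a + b * E.score y) * E.kappa (a + b * E.score y)) ≤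
      ∑ y, E.p h y * ((z y : ℝ) - (a + b * E.score y) * E.u (z y)) :=
    Finset.sum_le_sum fun y _ => mul_le_mul_of_nonneg_left
      (demand_sub_le (hab y) (z y).2) (E.p_high_pos y).le
  have h4 : ∑ y, E.p h y * (E.demand (a + b * E.score y) -
        (a + b * E.score y) * E.kappa (a + b * E.score y)) =
      E.dualCost a b - a * E.dualUtility a b - b * E.dualDistortion a b := by
    simp only [dualCost, dualUtility, dualDistortion, Finset.mul_sum, ← Finset.sum_sub_distrib]
    exact Finset.sum_congr rfl fun y _ => by ring
  have h5 : ∑ y, E.p h y * ((z y : ℝ) - (a + b * E.score y) * E.u (z y)) =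
      E.auxCost z - a * ν - b * Δ := by
    simp only [← h1, ← h2, auxCost, Finset.mul_sum, ← Finset.sum_sub_distrib]
    exact Finset.sum_congr rfl fun y _ => by ring
  linarith

theorem isLeast_dualCost {a b : ℝ} (hab : (a, b) ∈ E.dualDomain) :
    IsLeast (E.auxCost '' E.auxFeasible (E.dualUtility a b) (E.dualDistortion a b))
      (E.dualCost a b) := by
  refine ⟨⟨_, dualContract_mem hab, auxCost_dualContract hab⟩, ?_⟩
  rintro _ ⟨z, hz, rfl⟩
  have := dual_le_auxCost hab hz
  simpa using this

theorem chi_dual {a b : ℝ} (hab : (a, b) ∈ E.dualDomain) :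
    E.chi (E.dualUtility a b) (E.dualDistortion a b) = E.dualCost a b :=
  (isLeast_dualCost hab).csInf_eq

theorem hasInteriorSolution_dual {a b : ℝ} (hab : (a, b) ∈ E.dualDomain) :
    E.HasInteriorSolution (E.dualUtility a b) (E.dualDistortion a b) := by
  refine ⟨_, dualContract_mem hab, fun y => Real.toNNReal_pos.2 (demand_pos (hab y)),
    fun z hz => ?_⟩
  rw [auxCost_dualContract hab]
  exact (isLeast_dualCost hab).2 ⟨z, hz, rfl⟩

theorem dualCost_subgradient {a b a' b' : ℝ} (hab : (a, b) ∈ E.dualDomain)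
    (hab' : (a', b') ∈ E.dualDomain) :
    E.dualCost a b + a * (E.dualUtility a' b' - E.dualUtility a b) +
      b * (E.dualDistortion a' b' - E.dualDistortion a b) ≤ E.dualCost a' b' := by
  rw [← auxCost_dualContract hab']
  exact dual_le_auxCost hab (dualContract_mem hab')

theorem dual_inner_eq (a b a' b' : ℝ) :
    (a' - a) * (E.dualUtility a' b' - E.dualUtility a b) +
      (b' - b) * (E.dualDistortion a' b' - E.dualDistortion a b) =
    ∑ y, E.p h y * (((a' + b' * E.score y) - (a + b * E.score y)) *
      (E.kappa (a' + b' * E.score y) - E.kappa (a + b * E.score y))) := by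
  simp only [dualUtility, dualDistortion, ← Finset.sum_sub_distrib, Finset.mul_sum,
    ← Finset.sum_add_distrib]
  exact Finset.sum_congr rfl fun y _ => by ring

theorem sum_p_affine_sq (a b : ℝ) :
    ∑ y, E.p h y * (a + b * E.score y) ^ 2 = a ^ 2 + b ^ 2 * E.scoreVar := by
  have : ∀ y, E.p h y * (a + b * E.score y) ^ 2 =
      a * (E.p h y * (a + b * E.score y)) + b * (E.p h y * (E.score y * (a + b * E.score y))) :=
    fun y => by ring
  simp only [this, Finset.sum_add_distrib, ← Finset.mul_sum, sum_p_affine, sum_p_score_affine]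
  ring

theorem exists_affine_ne {a b a' b' : ℝ} (hne : (a, b) ≠ (a', b')) :
    ∃ y, a + b * E.score y ≠ a' + b' * E.score y := by
  by_contra! hcon
  have h1 := sum_p_affine (E := E) a b
  have h2 := sum_p_score_affine (E := E) a b
  simp only [hcon, sum_p_affine, sum_p_score_affine] at h1 h2
  have h3 := mul_right_cancel₀ scoreVar_pos.ne' h2
  exact hne (by rw [h1, h3])

/-- Strict monotonicity of the gradient map, inherited from `kappa` income by income. Distinct
multipliers give distinct marginal costs somewhere because the score has positive variance. -/
theorem dual_inner_pos {a b a' b' : ℝ} (hab : (a, b) ∈ E.dualDomain)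
    (hab' : (a', b') ∈ E.dualDomain) (hne : (a, b) ≠ (a', b')) :
    0 < (a' - a) * (E.dualUtility a' b' - E.dualUtility a b) +
      (b' - b) * (E.dualDistortion a' b' - E.dualDistortion a b) := by
  obtain ⟨y, hy⟩ := exists_affine_ne (E := E) hne
  rw [dual_inner_eq]
  have key : ∀ s ∈ E.costRange, ∀ t ∈ E.costRange, s ≠ t →
      0 < (t - s) * (E.kappa t - E.kappa s) := by
    intro s hs t ht hst
    rcases lt_or_gt_of_ne hst with hlt | hlt
    · exact mul_pos (sub_pos.2 hlt) (sub_pos.2 (kappa_strictMonoOn hs ht hlt))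
    · exact mul_pos_of_neg_of_neg (sub_neg.2 hlt) (sub_neg.2 (kappa_strictMonoOn ht hs hlt))
  refine Finset.sum_pos' (fun y _ => mul_nonneg (E.p_high_pos y).le ?_)
    ⟨y, Finset.mem_univ y, mul_pos (E.p_high_pos y) (key _ (hab y) _ (hab' y) hy)⟩
  rcases eq_or_ne (a + b * E.score y) (a' + b' * E.score y) with e | e
  · rw [e, sub_self, zero_mul]
  · exact (key _ (hab y) _ (hab' y) e).le

/-- The inverse of the gradient map is Lipschitz on boxes with marginal costs in a compact
interval. -/
theorem exists_dual_lipschitz {s t : ℝ} (hst : Icc s t ⊆ E.costRange) :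
    ∃ L : ℝ, 0 < L ∧ ∀ a b a' b' : ℝ, (∀ y, a + b * E.score y ∈ Icc s t) →
      (∀ y, a' + b' * E.score y ∈ Icc s t) →
      |b' - b| ≤ L * (|E.dualUtility a' b' - E.dualUtility a b| +
        |E.dualDistortion a' b' - E.dualDistortion a b|) := by
  obtain ⟨L, hL, hLk⟩ := exists_abs_sub_le_kappa hst
  have hσ := scoreVar_pos (E := E)
  obtain ⟨c, hc, hc1, hcσ⟩ : ∃ c : ℝ, 0 < c ∧ c ≤ 1 ∧ c ≤ E.scoreVar :=
    ⟨min 1 E.scoreVar, lt_min one_pos hσ, min_le_left _ _, min_le_right _ _⟩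
  refine ⟨2 * L / c, by positivity, fun a b a' b' hab hab' => ?_⟩
  set U := |E.dualUtility a' b' - E.dualUtility a b|
  set D := |E.dualDistortion a' b' - E.dualDistortion a b|
  -- Strong monotonicity: the lower bound on the slope of `kappa` turns the inner product into a
  -- squared distance, which in multipliers is `α ^ 2 + β ^ 2 * scoreVar`. The factor 2 in the
  -- constant comes from `(A + B) ^ 2 ≤ 2 * (A ^ 2 + B ^ 2)`.
  have h1 : ∑ y, E.p h y * ((a' - a) + (b' - b) * E.score y) ^ 2 ≤
      L * ((a' - a) * (E.dualUtility a' b' - E.dualUtility a b) +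
      (b' - b) * (E.dualDistortion a' b' - E.dualDistortion a b)) := by
    rw [dual_inner_eq, Finset.mul_sum]
    refine Finset.sum_le_sum fun y _ => ?_
    rw [mul_left_comm L]
    refine mul_le_mul_of_nonneg_left ?_ (E.p_high_pos y).le
    have h2 := hLk _ (hab y) _ (hab' y)
    have h3 : (a' - a) + (b' - b) * E.score y =
        (a' + b' * E.score y) - (a + b * E.score y) := by ring
    rw [h3]
    set S := a + b * E.score y
    set S' := a' + b' * E.score y
    have hS := hst (hab y)
    have hS' := hst (hab' y)
    rcases le_total S S' with hle | hle
    · have h4 := kappa_strictMonoOn.monotoneOn hS hS' hle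
      rw [abs_of_nonneg (sub_nonneg.2 hle), abs_of_nonneg (sub_nonneg.2 h4)] at h2
      nlinarith
    · have h4 := kappa_strictMonoOn.monotoneOn hS' hS hle
      rw [abs_of_nonpos (sub_nonpos.2 hle), abs_of_nonpos (sub_nonpos.2 h4)] at h2
      nlinarith
  rw [sum_p_affine_sq] at h1
  have h2 : (a' - a) * (E.dualUtility a' b' - E.dualUtility a b) ≤ |a' - a| * U := by
    rw [← abs_mul]; exact le_abs_self _
  have h3 : (b' - b) * (E.dualDistortion a' b' - E.dualDistortion a b) ≤ |b' - b| * D := by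
    rw [← abs_mul]; exact le_abs_self _
  have hU : 0 ≤ U := abs_nonneg _
  have hD : 0 ≤ D := abs_nonneg _
  rw [← sq_abs (a' - a), ← sq_abs (b' - b)] at h1
  have hA := abs_nonneg (a' - a)
  have hB := abs_nonneg (b' - b)
  set A := |a' - a|
  set B := |b' - b|
  have h4 : c * (A ^ 2 + B ^ 2) ≤ L * (A + B) * (U + D) := by
    have : c * A ^ 2 ≤ A ^ 2 := by nlinarith [sq_nonneg A]
    have : c * B ^ 2 ≤ B ^ 2 * E.scoreVar := by nlinarith [sq_nonneg B]
    have : L * ((a' - a) * (E.dualUtility a' b' - E.dualUtility a b) +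
      (b' - b) * (E.dualDistortion a' b' - E.dualDistortion a b)) ≤ L * (A * U + B * D) :=
      mul_le_mul_of_nonneg_left (by linarith) hL.le
    have : L * (A * U + B * D) ≤ L * (A + B) * (U + D) := by
      have : 0 ≤ L * (A * D + B * U) := by positivity
      nlinarith
    nlinarith
  rcases eq_or_lt_of_le (add_nonneg hA hB) with h0 | h0
  · have : B = 0 := by linarith
    rw [this]
    positivity
  · have h5 : (A + B) * (c * (A + B)) ≤ (A + B) * (2 * L * (U + D)) := by
      nlinarith [mul_nonneg hc.le (sq_nonneg (A - B))]
    have h6 := le_of_mul_le_mul_left h5 h0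
    rw [div_mul_eq_mul_div, le_div_iff₀ hc]
    nlinarith

end Model

/-! ### The potential of the gradient map and local surjectivity -/

namespace Model

variable {E : Model}

variable (E) in
/-- The convex conjugate of the cost of utility. -/
def potential (s : ℝ) : ℝ := s * E.kappa s - E.demand s

theorem potential_le {s t : ℝ} (hs : s ∈ E.costRange) (ht : t ∈ E.costRange) :
    E.potential s + E.kappa s * (t - s) ≤ E.potential t := by
  have := demand_sub_le ht (demand_pos hs).le
  simp only [potential]
  simp only [kappa] at this ⊢
  linarith

/-- Strictness comes from a detour through the midpoint, where `kappa` has already changed strictly.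
-/
theorem potential_lt {s t : ℝ} (hs : s ∈ E.costRange) (ht : t ∈ E.costRange) (hne : s ≠ t) :
    E.potential s + E.kappa s * (t - s) < E.potential t := by
  have hmid : (1 / 2 : ℝ) * s + (1 / 2) * t ∈ E.costRange :=
    costRange_convex hs ht (by norm_num) (by norm_num) (by norm_num)
  have h1 := potential_le hs hmid
  have h2 := potential_le hmid ht
  have h3 : 0 < (E.kappa ((1 / 2 : ℝ) * s + (1 / 2) * t) - E.kappa s) * (t - s) := by
    rcases lt_or_gt_of_ne hne with hlt | hlt
    · exact mul_pos (sub_pos.2 (kappa_strictMonoOn hs hmid (by linarith))) (sub_pos.2 hlt)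
    · exact mul_pos_of_neg_of_neg (sub_neg.2 (kappa_strictMonoOn hmid hs (by linarith)))
        (sub_neg.2 hlt)
  nlinarith

/-- Envelope theorem without differentiability of `demand`: two subgradient inequalities squeeze the
remainder between zero and `(kappa t - kappa s) * (t - s)`, so continuity of `kappa` suffices. -/
theorem hasDerivAt_potential {s : ℝ} (hs : s ∈ E.costRange) :
    HasDerivAt E.potential (E.kappa s) s := by
  have hnhds := costRange_isOpen.mem_nhds hs
  have hk : Tendsto (fun t => E.kappa t - E.kappa s) (𝓝 s) (𝓝 0) := by
    have : ContinuousAt E.kappa s := kappa_continuousOn.continuousAt hnhds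
    simpa using this.tendsto.sub_const (E.kappa s)
  rw [hasDerivAt_iff_isLittleO]
  have h1 : (fun t => E.potential t - E.potential s - (t - s) • E.kappa s) =O[𝓝 s]
      fun t => (E.kappa t - E.kappa s) * (t - s) := by
    refine Asymptotics.IsBigO.of_bound 1 ?_
    filter_upwards [hnhds] with t ht
    have h2 := potential_le hs ht
    have h3 := potential_le ht hs
    rw [one_mul, Real.norm_eq_abs, Real.norm_eq_abs, smul_eq_mul, abs_of_nonneg (by linarith)]
    refine le_trans ?_ (le_abs_self _)
    linarith
  have h2 : (fun t => (E.kappa t - E.kappa s) * (t - s)) =o[𝓝 s] fun t => (1 : ℝ) * (t - s) :=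
    ((Asymptotics.isLittleO_one_iff ℝ).2 hk).mul_isBigO (Asymptotics.isBigO_refl _ _)
  simpa using h1.trans_isLittleO h2

variable (E) in
/-- The potential of the gradient map `(dualUtility, dualDistortion)`. -/
def dualPotential (q : ℝ × ℝ) : ℝ := ∑ y, E.p h y * E.potential (q.1 + q.2 * E.score y)

theorem dualPotential_continuousOn : ContinuousOn E.dualPotential E.dualDomain := by
  refine continuousOn_finsetSum _ fun y _ => continuousOn_const.mul ?_
  have hp : ContinuousOn E.potential E.costRange :=
    fun s hs => (hasDerivAt_potential hs).continuousAt.continuousWithinAt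
  exact hp.comp (by fun_prop) fun q hq => hq y

theorem dualPotential_lt {a b a' b' : ℝ} (hab : (a, b) ∈ E.dualDomain)
    (hab' : (a', b') ∈ E.dualDomain) (hne : (a, b) ≠ (a', b')) :
    E.dualPotential (a, b) + E.dualUtility a b * (a' - a) + E.dualDistortion a b * (b' - b) <
      E.dualPotential (a', b') := by
  obtain ⟨y, hy⟩ := exists_affine_ne (E := E) hne
  have h1 : E.dualPotential (a, b) + E.dualUtility a b * (a' - a) +
      E.dualDistortion a b * (b' - b) = ∑ y, E.p h y * (E.potential (a + b * E.score y) +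
      E.kappa (a + b * E.score y) * ((a' + b' * E.score y) - (a + b * E.score y))) := by
    simp only [dualPotential, dualUtility, dualDistortion, Finset.sum_mul,
      ← Finset.sum_add_distrib]
    exact Finset.sum_congr rfl fun y _ => by ring
  rw [h1]
  exact Finset.sum_lt_sum
    (fun y _ => mul_le_mul_of_nonneg_left (potential_le (hab y) (hab' y)) (E.p_high_pos y).le)
    ⟨y, Finset.mem_univ y,
      mul_lt_mul_of_pos_left (potential_lt (hab y) (hab' y) hy) (E.p_high_pos y)⟩

theorem hasDerivAt_dualPotential_fst {a b : ℝ} (hab : (a, b) ∈ E.dualDomain) :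
    HasDerivAt (fun s => E.dualPotential (s, b)) (E.dualUtility a b) a := by
  refine HasDerivAt.fun_sum fun y _ => HasDerivAt.const_mul _ ?_
  have h1 : HasDerivAt (fun s : ℝ => s + b * E.score y) 1 a := (hasDerivAt_id a).add_const _
  have := (hasDerivAt_potential (hab y)).comp a h1
  rwa [mul_one] at this

theorem hasDerivAt_dualPotential_snd {a b : ℝ} (hab : (a, b) ∈ E.dualDomain) :
    HasDerivAt (fun s => E.dualPotential (a, s)) (E.dualDistortion a b) b := by
  refine HasDerivAt.fun_sum fun y _ => HasDerivAt.const_mul _ ?_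
  have h1 : HasDerivAt (fun s : ℝ => a + s * E.score y) (E.score y) b := by
    simpa using ((hasDerivAt_id b).mul_const (E.score y)).const_add a
  have := (hasDerivAt_potential (hab y)).comp b h1
  rwa [mul_comm] at this

/-- Near full insurance, every pair of high-type utility and distortion is attained by marginal
costs that are affine in the score. -/
theorem exists_dual_of_near {a₀ r : ℝ} (hr : 0 < r)
    (hbox : ∀ a b : ℝ, |a - a₀| ≤ r → |b| ≤ r → (a, b) ∈ E.dualDomain) :
    ∃ ε : ℝ, 0 < ε ∧ ∀ n d : ℝ, |n - E.kappa a₀| < ε → |d| < ε →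
      ∃ a b : ℝ, |a - a₀| ≤ r ∧ |b| ≤ r ∧ E.dualUtility a b = n ∧ E.dualDistortion a b = d := by
  have hmem : ∀ q : ℝ × ℝ, q ∈ Metric.closedBall (a₀, (0 : ℝ)) r ↔ |q.1 - a₀| ≤ r ∧ |q.2| ≤ r := by
    intro q
    rw [Metric.mem_closedBall, Prod.dist_eq, max_le_iff, Real.dist_eq, Real.dist_eq, sub_zero]
  have hdom : Metric.closedBall (a₀, (0 : ℝ)) r ⊆ E.dualDomain := fun q hq =>
    hbox q.1 q.2 ((hmem q).1 hq).1 ((hmem q).1 hq).2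
  have h0 : (a₀, (0 : ℝ)) ∈ E.dualDomain := hdom (Metric.mem_closedBall_self hr.le)
  -- Without its tangent plane at `(a₀, 0)` the potential has a strict minimum there, hence a
  -- positive margin on the sphere.
  set G : ℝ × ℝ → ℝ := fun q => E.dualPotential q - E.kappa a₀ * (q.1 - a₀) with hG
  have hGc : ContinuousOn G (Metric.closedBall (a₀, (0 : ℝ)) r) :=
    (dualPotential_continuousOn.mono hdom).sub (by fun_prop)
  have hGs : ∀ q ∈ Metric.closedBall (a₀, (0 : ℝ)) r, q ≠ (a₀, 0) → G (a₀, 0) < G q := by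
    rintro ⟨a, b⟩ hq hne
    have := dualPotential_lt h0 (hdom hq) hne.symm
    rw [dualUtility_zero, dualDistortion_zero] at this
    simp only [hG]
    linarith
  have hne : (Metric.sphere (a₀, (0 : ℝ)) r).Nonempty :=
    NormedSpace.sphere_nonempty.2 hr.le
  obtain ⟨q₁, hq₁, hmin₁⟩ := (isCompact_sphere (a₀, (0 : ℝ)) r).exists_isMinOn hne
    (hGc.mono Metric.sphere_subset_closedBall)
  have hq₁' : q₁ ≠ (a₀, 0) := fun e => by
    rw [e, Metric.mem_sphere, dist_self] at hq₁
    exact hr.ne hq₁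
  have hm : 0 < G q₁ - G (a₀, 0) :=
    sub_pos.2 (hGs q₁ (Metric.sphere_subset_closedBall hq₁) hq₁')
  -- Each of the two tilts in `H` changes `G` by less than half the margin on the sphere, so `H` has
  -- an interior minimum. Its vanishing gradient there is the pair of equations to be solved.
  refine ⟨(G q₁ - G (a₀, 0)) / (2 * r), by positivity, fun n d hn hd => ?_⟩
  rw [lt_div_iff₀ (by positivity)] at hn hd
  set H : ℝ × ℝ → ℝ := fun q => G q - (n - E.kappa a₀) * (q.1 - a₀) - d * q.2 with hH
  have hHc : ContinuousOn H (Metric.closedBall (a₀, (0 : ℝ)) r) :=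
    (hGc.sub (by fun_prop)).sub (by fun_prop)
  obtain ⟨⟨a, b⟩, hq, hmin⟩ := (isCompact_closedBall (a₀, (0 : ℝ)) r).exists_isMinOn
    ⟨_, Metric.mem_closedBall_self hr.le⟩ hHc
  obtain ⟨ha, hb⟩ := (hmem _).1 hq
  have hball : (a, b) ∈ Metric.ball (a₀, (0 : ℝ)) r := by
    rcases (Metric.mem_closedBall.1 hq).lt_or_eq with hlt | heq
    · exact hlt
    exfalso
    have h1 : G q₁ ≤ G (a, b) := hmin₁ (Metric.mem_sphere.2 heq)
    have h2 : H (a, b) ≤ H (a₀, 0) := hmin (Metric.mem_closedBall_self hr.le)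
    simp only [hH, sub_self, mul_zero, sub_zero] at h2
    have h3 : (n - E.kappa a₀) * (a - a₀) ≤ |n - E.kappa a₀| * r := by
      refine (le_abs_self _).trans ?_
      rw [abs_mul]
      exact mul_le_mul_of_nonneg_left ha (abs_nonneg _)
    have h4 : d * b ≤ |d| * r := by
      refine (le_abs_self _).trans ?_
      rw [abs_mul]
      exact mul_le_mul_of_nonneg_left hb (abs_nonneg _)
    linarith
  have hnhds : Metric.closedBall (a₀, (0 : ℝ)) r ∈ 𝓝 (a, b) :=
    Filter.mem_of_superset (Metric.isOpen_ball.mem_nhds hball) Metric.ball_subset_closedBall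
  have hloc : IsLocalMin H (a, b) := hmin.isLocalMin hnhds
  refine ⟨a, b, ha, hb, ?_, ?_⟩
  · have hc : Tendsto (fun s : ℝ => (s, b)) (𝓝 a) (𝓝 (a, b)) :=
      (Continuous.prodMk continuous_id continuous_const).tendsto a
    have h1 : IsLocalMin (fun s => H (s, b)) a := hc.eventually hloc
    have h2 : HasDerivAt (fun s => H (s, b))
        (E.dualUtility a b - E.kappa a₀ * 1 - (n - E.kappa a₀) * 1) a := by
      have h3 : HasDerivAt (fun s : ℝ => s - a₀) 1 a := (hasDerivAt_id a).sub_const _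
      exact (((hasDerivAt_dualPotential_fst (hdom hq)).fun_sub (h3.const_mul (E.kappa a₀))).fun_sub
        (h3.const_mul (n - E.kappa a₀))).sub_const (d * b)
    have := h1.hasDerivAt_eq_zero h2
    linarith
  · have hc : Tendsto (fun s : ℝ => (a, s)) (𝓝 b) (𝓝 (a, b)) :=
      (Continuous.prodMk continuous_const continuous_id).tendsto b
    have h1 : IsLocalMin (fun s => H (a, s)) b := hc.eventually hloc
    have h2 : HasDerivAt (fun s => H (a, s)) (E.dualDistortion a b - d * 1) b :=
      (((hasDerivAt_dualPotential_snd (hdom hq)).sub_const (E.kappa a₀ * (a - a₀))).sub_const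
        ((n - E.kappa a₀) * (a - a₀))).fun_sub ((hasDerivAt_id b).const_mul d)
    have := h1.hasDerivAt_eq_zero h2
    linarith

end Model

/-! ### From cost supermodularity to the concavity of `kappa` -/

namespace Model

variable {E : Model}

theorem exists_dual_box {a₀ : ℝ} (ha₀ : a₀ ∈ E.costRange) :
    ∃ s t r : ℝ, Icc s t ⊆ E.costRange ∧ 0 < r ∧
      ∀ a b : ℝ, |a - a₀| ≤ r → |b| ≤ r → ∀ y, a + b * E.score y ∈ Icc s t := by
  obtain ⟨ρ, hρ, hball⟩ := Metric.isOpen_iff.1 costRange_isOpen a₀ ha₀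
  set X : ℝ := ∑ y, |E.score y| with hX
  have hXy : ∀ y, |E.score y| ≤ X := fun y =>
    Finset.single_le_sum (f := fun y => |E.score y|) (fun _ _ => abs_nonneg _) (Finset.mem_univ y)
  have hX0 : 0 ≤ X := Finset.sum_nonneg fun _ _ => abs_nonneg _
  refine ⟨a₀ - ρ / 2, a₀ + ρ / 2, ρ / (2 * (1 + X)), ?_, by positivity, ?_⟩
  · refine Subset.trans ?_ hball
    rw [← Real.closedBall_eq_Icc]
    exact Metric.closedBall_subset_ball (by linarith)
  · intro a b ha hb y
    rw [le_div_iff₀ (by positivity)] at ha hb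
    have h1 : |b * E.score y| ≤ |b| * X := by
      rw [abs_mul]
      exact mul_le_mul_of_nonneg_left (hXy y) (abs_nonneg _)
    have h2 := abs_le.1 h1
    have h3 := abs_le.1 (le_refl |a - a₀|)
    have h4 : |a - a₀| + |b| * X ≤ ρ / 2 := by
      rcases le_total |a - a₀| |b| with h | h
      · nlinarith [abs_nonneg (a - a₀)]
      · nlinarith [abs_nonneg b, mul_le_mul_of_nonneg_right h hX0]
    constructor <;> linarith

theorem dualDistortion_nonneg {a b : ℝ} (ha : a ∈ E.costRange) (hab : (a, b) ∈ E.dualDomain)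
    (hb : 0 ≤ b) : 0 ≤ E.dualDistortion a b := by
  rcases hb.eq_or_lt with rfl | hb
  · rw [dualDistortion_zero]
  have h0 : (a, (0 : ℝ)) ∈ E.dualDomain := fun y => by simpa using ha
  have := dual_inner_pos h0 hab (by simp [hb.ne])
  rw [dualDistortion_zero] at this
  by_contra! hcon
  nlinarith

/-- Suppose that moving from multipliers `(a₀, 0)` to `(a₀, μ)` raised utility from `n₀` to `n₁` and
the distortion to `d₁`. By supermodularity the step from `n₀` to `n₁` costs at least as much at `d₁`
as at zero. But at `d₁` it costs at most `a₀ * (n₁ - n₀)`, as `a₀` is the marginal cost at its upper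
end, while at zero it costs strictly more, as `a₀` is the marginal cost at its lower end. -/
theorem dualUtility_le_of_supermodular (hχ : E.CostSupermodular) {a₀ : ℝ}
    (ha₀ : a₀ ∈ E.costRange) : ∀ᶠ μ in 𝓝[>] (0 : ℝ), E.dualUtility a₀ μ ≤ E.kappa a₀ := by
  obtain ⟨s, t, r, hst, hr, hbox⟩ := exists_dual_box ha₀
  obtain ⟨L, hL, hlip⟩ := exists_dual_lipschitz hst
  obtain ⟨ε, hε, hsurj⟩ := exists_dual_of_near hr fun a b ha hb y => hst (hbox a b ha hb y)
  -- `A` and `B` invert the gradient map locally and act as the partial derivatives of `chi`.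
  choose! A B hA hB hU hD using hsurj
  set n₀ := E.kappa a₀ with hn₀
  have hI : ∀ {n d : ℝ}, |n - n₀| < ε → |d| < ε → ∀ y, A n d + B n d * E.score y ∈ Icc s t :=
    fun hn hd => hbox _ _ (hA _ _ hn hd) (hB _ _ hn hd)
  have hdom : ∀ {n d : ℝ}, |n - n₀| < ε → |d| < ε → (A n d, B n d) ∈ E.dualDomain :=
    fun hn hd y => hst (hI hn hd y)
  have hsol : ∀ {n d : ℝ}, |n - n₀| < ε → |d| < ε → E.HasInteriorSolution n d := by
    intro n d hn hd
    have := hasInteriorSolution_dual (hdom hn hd)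
    rwa [hU n d hn hd, hD n d hn hd] at this
  have hchi : ∀ {n d : ℝ}, |n - n₀| < ε → |d| < ε → E.chi n d = E.dualCost (A n d) (B n d) := by
    intro n d hn hd
    have := chi_dual (hdom hn hd)
    rwa [hU n d hn hd, hD n d hn hd] at this
  have hsub : ∀ {n d n' d' : ℝ}, |n - n₀| < ε → |d| < ε → |n' - n₀| < ε → |d'| < ε →
      E.chi n d + A n d * (n' - n) + B n d * (d' - d) ≤ E.chi n' d' := by
    intro n d n' d' hn hd hn' hd'
    have := dualCost_subgradient (hdom hn hd) (hdom hn' hd')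
    rwa [hU n d hn hd, hD n d hn hd, hU n' d' hn' hd', hD n' d' hn' hd', ← hchi hn hd,
      ← hchi hn' hd'] at this
  have hBlip : ∀ {n d n' d' : ℝ}, |n - n₀| < ε → |d| < ε → |n' - n₀| < ε → |d'| < ε →
      |B n' d' - B n d| ≤ L * (|n' - n| + |d' - d|) := by
    intro n d n' d' hn hd hn' hd'
    have := hlip _ _ _ _ (hI hn hd) (hI hn' hd')
    rwa [hU n d hn hd, hD n d hn hd, hU n' d' hn' hd', hD n' d' hn' hd'] at this
  have hd_nhds : ∀ {d : ℝ}, |d| < ε → ∀ᶠ d' in 𝓝 d, |d'| < ε := fun hd =>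
    (continuous_abs.tendsto _).eventually (gt_mem_nhds hd)
  have hn_nhds : ∀ {n : ℝ}, |n - n₀| < ε → ∀ᶠ n' in 𝓝 n, |n' - n₀| < ε := fun hn =>
    ((continuous_abs.comp (continuous_sub_right n₀)).tendsto _).eventually (gt_mem_nhds hn)
  -- `B` is a subgradient and is Lipschitz in `d`, so it is a true derivative. Negative `d` is
  -- included, as needed for a two-sided derivative at zero distortion.
  have hder : ∀ {n d : ℝ}, |n - n₀| < ε → |d| < ε →
      HasDerivAt (fun d => E.chi n d) (B n d) d := by
    intro n d hn hd
    rw [hasDerivAt_iff_isLittleO]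
    have h1 : (fun d' => E.chi n d' - E.chi n d - (d' - d) • B n d) =O[𝓝 d]
        fun d' => (d' - d) * (d' - d) := by
      refine Asymptotics.IsBigO.of_bound L ?_
      filter_upwards [hd_nhds hd] with d' hd'
      have h2 := hsub hn hd hn hd'
      have h3 := hsub hn hd' hn hd
      have h4 := hBlip hn hd hn hd'
      rw [sub_self, abs_zero, zero_add] at h4
      have h5 : (B n d' - B n d) * (d' - d) ≤ L * |d' - d| * |d' - d| :=
        (le_abs_self _).trans (by
          rw [abs_mul]; exact mul_le_mul_of_nonneg_right h4 (abs_nonneg _))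
      rw [Real.norm_eq_abs, Real.norm_eq_abs, smul_eq_mul, abs_of_nonneg (by linarith), abs_mul]
      nlinarith
    have h2 : Tendsto (fun d' : ℝ => d' - d) (𝓝 d) (𝓝 0) := by
      simpa using (continuous_sub_right d).tendsto d
    have h3 : (fun d' : ℝ => (d' - d) * (d' - d)) =o[𝓝 d] fun d' => (1 : ℝ) * (d' - d) :=
      ((Asymptotics.isLittleO_one_iff ℝ).2 h2).mul_isBigO (Asymptotics.isBigO_refl _ _)
    simpa using h1.trans_isLittleO h3
  have hcross : ∀ {n d : ℝ}, |n - n₀| < ε → |d| < ε → 0 ≤ d →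
      0 ≤ deriv (fun n => B n d) n := by
    intro n d hn hd hd0
    have h1 := hχ n d hd0 (hsol hn hd)
    have h2 : (fun n => deriv (fun d => E.chi n d) d) =ᶠ[𝓝 n] fun n => B n d := by
      filter_upwards [hn_nhds hn] with n' hn' using (hder hn' hd).deriv
    rwa [h2.deriv_eq] at h1
  have hbetween : ∀ {n₁ n : ℝ}, |n₁ - n₀| < ε → n ∈ Icc n₀ n₁ → |n - n₀| < ε := by
    intro n₁ n hn₁ hn
    rw [abs_of_nonneg (sub_nonneg.2 hn.1)]
    exact lt_of_le_of_lt (sub_le_sub_right hn.2 _) ((le_abs_self _).trans_lt hn₁)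
  have hBmono : ∀ {n₁ d : ℝ}, n₀ ≤ n₁ → |n₁ - n₀| < ε → |d| < ε → 0 ≤ d →
      B n₀ d ≤ B n₁ d := by
    intro n₁ d hle hn₁ hd hd0
    -- The cross derivative may fail to exist at some points; the Lipschitz bound on `B` makes its
    -- nonnegative `deriv` sufficient.
    refine le_of_lipschitz_of_deriv_nonneg (f := fun n => B n d) (L := L) hle ?_ ?_
    · intro n hn n' hn'
      have := hBlip (hbetween hn₁ hn) hd (hbetween hn₁ hn') hd
      simpa using this
    · intro n hn
      exact hcross (hbetween hn₁ hn) hd hd0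
  have hcU : ContinuousAt (fun μ => E.dualUtility a₀ μ) 0 := by
    refine tendsto_finsetSum _ fun y _ => Tendsto.const_mul _ ?_
    have h1 : ContinuousAt E.kappa (a₀ + 0 * E.score y) := by
      rw [zero_mul, add_zero]
      exact kappa_continuousOn.continuousAt (costRange_isOpen.mem_nhds ha₀)
    exact h1.comp (f := fun μ : ℝ => a₀ + μ * E.score y) (by fun_prop)
  have hcD : ContinuousAt (fun μ => E.dualDistortion a₀ μ) 0 := by
    refine tendsto_finsetSum _ fun y _ => Tendsto.const_mul _ (Tendsto.const_mul _ ?_)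
    have h1 : ContinuousAt E.kappa (a₀ + 0 * E.score y) := by
      rw [zero_mul, add_zero]
      exact kappa_continuousOn.continuousAt (costRange_isOpen.mem_nhds ha₀)
    exact h1.comp (f := fun μ : ℝ => a₀ + μ * E.score y) (by fun_prop)
  have hevU : ∀ᶠ μ in 𝓝 (0 : ℝ), |E.dualUtility a₀ μ - n₀| < ε :=
    hcU.eventually (hn_nhds (by beta_reduce; rw [dualUtility_zero, sub_self, abs_zero]; exact hε))
  have hevD : ∀ᶠ μ in 𝓝 (0 : ℝ), |E.dualDistortion a₀ μ| < ε :=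
    hcD.eventually (hd_nhds (by beta_reduce; rw [dualDistortion_zero, abs_zero]; exact hε))
  have hevr : ∀ᶠ μ in 𝓝 (0 : ℝ), |μ| < r :=
    (continuous_abs.tendsto 0).eventually (gt_mem_nhds (by rwa [abs_zero]))
  filter_upwards [nhdsWithin_le_nhds hevU, nhdsWithin_le_nhds hevD, nhdsWithin_le_nhds hevr,
    self_mem_nhdsWithin] with μ hμU hμD hμr hμ0
  by_contra! hlt
  have hμdom : (a₀, μ) ∈ E.dualDomain := fun y =>
    hst (hbox a₀ μ (by simpa using hr.le) hμr.le y)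
  have h0dom : (a₀, (0 : ℝ)) ∈ E.dualDomain := fun y => by simpa using ha₀
  set n₁ := E.dualUtility a₀ μ with hn₁
  set d₁ := E.dualDistortion a₀ μ with hd₁
  have hd₁0 : 0 ≤ d₁ := dualDistortion_nonneg ha₀ hμdom (le_of_lt hμ0)
  have hn₀ε : |n₀ - n₀| < ε := by simpa using hε
  have h0ε : |(0 : ℝ)| < ε := by simpa using hε
  have hmε : |(n₀ + n₁) / 2 - n₀| < ε := hbetween hμU ⟨by linarith, by linarith⟩
  have hdiff : E.chi n₁ 0 - E.chi n₀ 0 ≤ E.chi n₁ d₁ - E.chi n₀ d₁ := by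
    have hsub' : ∀ d ∈ Icc 0 d₁, |d| < ε := fun d hd => by
      rw [abs_of_nonneg hd.1]
      exact hd.2.trans_lt ((le_abs_self _).trans_lt hμD)
    have hdv : ∀ d ∈ Icc 0 d₁, HasDerivAt (fun d => E.chi n₁ d - E.chi n₀ d)
        (B n₁ d - B n₀ d) d := fun d hd =>
      (hder hμU (hsub' d hd)).fun_sub (hder hn₀ε (hsub' d hd))
    refine monotoneOn_of_deriv_nonneg (convex_Icc 0 d₁)
      (fun d hd => (hdv d hd).continuousAt.continuousWithinAt)
      (fun d hd => (hdv d (interior_subset hd)).differentiableAt.differentiableWithinAt)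
      (fun d hd => ?_) (left_mem_Icc.2 hd₁0) (right_mem_Icc.2 hd₁0) hd₁0
    have hd' := interior_subset hd
    rw [(hdv d hd').deriv]
    exact sub_nonneg.2 (hBmono hlt.le hμU (hsub' d hd') hd'.1)
  have h1 : E.chi n₁ d₁ + a₀ * (n₀ - n₁) ≤ E.chi n₀ d₁ := by
    have := dualCost_subgradient hμdom (hdom hn₀ε hμD)
    rw [← hchi hn₀ε hμD, ← chi_dual hμdom, hU _ _ hn₀ε hμD, hD _ _ hn₀ε hμD,
      ← hn₁, ← hd₁, sub_self, mul_zero, add_zero] at this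
    exact this
  have h2 : E.chi n₀ 0 + a₀ * ((n₀ + n₁) / 2 - n₀) ≤ E.chi ((n₀ + n₁) / 2) 0 := by
    have := dualCost_subgradient h0dom (hdom hmε h0ε)
    rw [← hchi hmε h0ε, ← chi_dual h0dom, hU _ _ hmε h0ε, hD _ _ hmε h0ε, dualUtility_zero,
      dualDistortion_zero] at this
    simpa using this
  have h3 := hsub hmε h0ε hμU h0ε
  -- The midpoint supplies the strict inequality: marginal cost there already exceeds `a₀`.
  have h4 : a₀ < A ((n₀ + n₁) / 2) 0 := by
    have hne : (a₀, (0 : ℝ)) ≠ (A ((n₀ + n₁) / 2) 0, B ((n₀ + n₁) / 2) 0) := by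
      intro e
      rw [Prod.mk.injEq] at e
      have h5 := hU _ _ hmε h0ε
      rw [← e.1, ← e.2, dualUtility_zero] at h5
      linarith
    have := dual_inner_pos h0dom (hdom hmε h0ε) hne
    rw [hU _ _ hmε h0ε, hD _ _ hmε h0ε, dualUtility_zero, dualDistortion_zero, sub_self, mul_zero,
      add_zero] at this
    have h5 : 0 < (n₀ + n₁) / 2 - E.kappa a₀ := by linarith
    exact sub_pos.1 (pos_of_mul_pos_left this h5.le)
  nlinarith

/-- `dualUtility a μ` is the mean of `kappa` under the gamble `a + μ * score`, so small multiples of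
the score are the required gambles. -/
theorem kappa_concaveOn (hχ : E.CostSupermodular) : ConcaveOn ℝ E.costRange E.kappa :=
  concaveOn_of_small_gambles E.p_high_pos (E.p_sum h) sum_p_score exists_score_neg
    costRange_convex kappa_continuousOn fun _ ha => dualUtility_le_of_supermodular hχ ha

/-! ### Comparative statics of the multipliers -/

/-- The score has mean zero, so `a` is the mean of the attained marginal costs. -/
theorem mem_costRange_of_dualDomain {a b : ℝ} (hab : (a, b) ∈ E.dualDomain) :
    a ∈ E.costRange := by
  have := costRange_convex.sum_mem (t := Finset.univ) (w := E.p h)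
    (z := fun y => a + b * E.score y) (fun y _ => (E.p_high_pos y).le) (E.p_sum h)
    (fun y _ => hab y)
  simpa only [smul_eq_mul, sum_p_affine] using this

theorem dualDomain_of_mem_Icc {a b b' : ℝ} (hab : (a, b) ∈ E.dualDomain) (hb' : 0 ≤ b')
    (hle : b' ≤ b) : (a, b') ∈ E.dualDomain := by
  intro y
  have ha := mem_costRange_of_dualDomain hab
  rcases hle.eq_or_lt with rfl | hlt
  · exact hab y
  have hbpos : 0 < b := hb'.trans_lt hlt
  have := costRange_convex ha (hab y) (a := 1 - b' / b) (b := b' / b)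
    (sub_nonneg.2 ((div_le_one hbpos).2 hle)) (by positivity) (by ring)
  have e : (1 - b' / b) • a + (b' / b) • (a + b * E.score y) = a + b' * E.score y := by
    simp only [smul_eq_mul]
    field_simp
    ring
  rwa [e] at this

theorem dualUtility_le_kappa (hκ : ConcaveOn ℝ E.costRange E.kappa) {a b : ℝ}
    (hab : (a, b) ∈ E.dualDomain) : E.dualUtility a b ≤ E.kappa a := by
  have := hκ.le_map_sum (t := Finset.univ) (w := E.p h) (p := fun y => a + b * E.score y)
    (fun y _ => (E.p_high_pos y).le) (E.p_sum h) (fun y _ => hab y)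
  simp only [smul_eq_mul, sum_p_affine] at this
  exact this

/-- With a concave `kappa`, high-type utility falls in the second multiplier. -/
theorem dualUtility_antitone (hκ : ConcaveOn ℝ E.costRange E.kappa) {a b b' : ℝ}
    (hab : (a, b) ∈ E.dualDomain) (hb' : 0 ≤ b') (hle : b' ≤ b) :
    E.dualUtility a b ≤ E.dualUtility a b' := by
  rcases hle.eq_or_lt with rfl | hlt
  · exact le_rfl
  have hbpos : 0 < b := hb'.trans_lt hlt
  have h0 := dualUtility_le_kappa hκ hab
  have ha := mem_costRange_of_dualDomain hab
  -- `dualUtility a` is concave in the second multiplier and, by Jensen, largest at zero.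
  have h1 : (1 - b' / b) * E.kappa a + (b' / b) * E.dualUtility a b ≤ E.dualUtility a b' := by
    have e : (1 - b' / b) * E.kappa a + (b' / b) * E.dualUtility a b =
        ∑ y, E.p h y * ((1 - b' / b) * E.kappa a + (b' / b) * E.kappa (a + b * E.score y)) := by
      simp only [mul_add, Finset.sum_add_distrib, ← Finset.sum_mul, E.p_sum, one_mul,
        dualUtility, Finset.mul_sum]
      congr 1
      exact Finset.sum_congr rfl fun y _ => by ring
    rw [e]
    refine Finset.sum_le_sum fun y _ => mul_le_mul_of_nonneg_left ?_ (E.p_high_pos y).le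
    have := hκ.2 ha (hab y) (sub_nonneg.2 ((div_le_one hbpos).2 hle))
      (show 0 ≤ b' / b by positivity) (by ring)
    have e : (1 - b' / b) • a + (b' / b) • (a + b * E.score y) = a + b' * E.score y := by
      simp only [smul_eq_mul]
      field_simp
      ring
    rwa [e] at this
  have h2 : 0 ≤ 1 - b' / b := sub_nonneg.2 ((div_le_one hbpos).2 hle)
  nlinarith

/-- With a concave `kappa`, raising the first multiplier lowers the distortion. -/
theorem dualDistortion_antitone (hκ : ConcaveOn ℝ E.costRange E.kappa) {a a' b : ℝ}
    (hab : (a, b) ∈ E.dualDomain) (hab' : (a', b) ∈ E.dualDomain) (hb : 0 ≤ b) (hle : a ≤ a') :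
    E.dualDistortion a' b ≤ E.dualDistortion a b := by
  rcases hle.eq_or_lt with rfl | hlt
  · exact le_rfl
  have ha := mem_costRange_of_dualDomain hab
  have ha' := mem_costRange_of_dualDomain hab'
  -- Decreasing differences: the two inner points are convex combinations of the outer points with
  -- exchanged weights.
  have key : ∀ {m : ℝ}, 0 < m → ∀ {s : ℝ}, s ∈ E.costRange → s + (a' - a) + m ∈ E.costRange →
      E.kappa (s + (a' - a) + m) - E.kappa (s + m) ≤ E.kappa (s + (a' - a)) - E.kappa s := by
    intro m hm s hs hs'
    set c := a' - a with hc
    have hcpos : 0 < c := sub_pos.2 hlt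
    have hcm : c + m ≠ 0 := by positivity
    have h1 := hκ.2 hs hs' (show 0 ≤ m / (c + m) by positivity)
      (show 0 ≤ c / (c + m) by positivity) (by field_simp; ring)
    have h2 := hκ.2 hs hs' (show 0 ≤ c / (c + m) by positivity)
      (show 0 ≤ m / (c + m) by positivity) (by field_simp)
    have e1 : (m / (c + m)) • s + (c / (c + m)) • (s + c + m) = s + c := by
      simp only [smul_eq_mul]; field_simp; ring
    have e2 : (c / (c + m)) • s + (m / (c + m)) • (s + c + m) = s + m := by
      simp only [smul_eq_mul]; field_simp; ring
    rw [e1] at h1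
    rw [e2] at h2
    simp only [smul_eq_mul] at h1 h2
    have e3 : m / (c + m) * E.kappa s + c / (c + m) * E.kappa (s + c + m) +
        (c / (c + m) * E.kappa s + m / (c + m) * E.kappa (s + c + m)) =
        E.kappa s + E.kappa (s + c + m) := by field_simp; ring
    linarith
  -- Subtracting the increment of `kappa` at score zero is free because the score has mean zero.
  -- Each centred increment then has the sign opposite to the score, or vanishes.
  have h1 : E.dualDistortion a' b - E.dualDistortion a b =
      ∑ y, E.p h y * (E.score y * ((E.kappa (a' + b * E.score y) - E.kappa (a + b * E.score y)) -
        (E.kappa a' - E.kappa a))) := by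
    have : ∀ y, E.p h y * (E.score y * ((E.kappa (a' + b * E.score y) -
        E.kappa (a + b * E.score y)) - (E.kappa a' - E.kappa a))) =
        E.p h y * (E.score y * E.kappa (a' + b * E.score y)) -
        E.p h y * (E.score y * E.kappa (a + b * E.score y)) -
        (E.p h y * E.score y) * (E.kappa a' - E.kappa a) := fun y => by ring
    simp only [this, Finset.sum_sub_distrib, ← Finset.sum_mul, sum_p_score, dualDistortion]
    ring
  refine sub_nonpos.1 ?_
  rw [h1]
  refine Finset.sum_nonpos fun y _ =>
    mul_nonpos_of_nonneg_of_nonpos (E.p_high_pos y).le ?_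
  rcases hb.eq_or_lt with rfl | hb
  · simp
  rcases lt_trichotomy (E.score y) 0 with hx | hx | hx
  · refine mul_nonpos_of_nonpos_of_nonneg hx.le ?_
    have hm : 0 < -(b * E.score y) := neg_pos.2 (mul_neg_of_pos_of_neg hb hx)
    have h2 := key hm (hab y) (by
      have : a + b * E.score y + (a' - a) + -(b * E.score y) = a' := by ring
      rwa [this])
    have e1 : a + b * E.score y + (a' - a) + -(b * E.score y) = a' := by ring
    have e2 : a + b * E.score y + -(b * E.score y) = a := by ring
    have e3 : a + b * E.score y + (a' - a) = a' + b * E.score y := by ring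
    rw [e1, e2, e3] at h2
    linarith
  · simp [hx]
  · refine mul_nonpos_of_nonneg_of_nonpos hx.le ?_
    have e1 : a + (a' - a) + b * E.score y = a' + b * E.score y := by ring
    have e3 : a + (a' - a) = a' := by ring
    have h2 := key (mul_pos hb hx) ha (by rw [e1]; exact hab' y)
    rw [e1, e3] at h2
    linarith

/-- The move is split at `(a, b')`. For either quantity one leg is weakly monotone by concavity and
the other strictly by monotonicity of the gradient map. -/
theorem dualUtility_lt_and_dualDistortion_lt (hκ : ConcaveOn ℝ E.costRange E.kappa)
    {a b a' b' : ℝ} (hab : (a, b) ∈ E.dualDomain) (hab' : (a', b') ∈ E.dualDomain)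
    (hb' : 0 ≤ b') (ha : a < a') (hb : b' < b) :
    E.dualUtility a b < E.dualUtility a' b' ∧ E.dualDistortion a' b' < E.dualDistortion a b := by
  have hmid := dualDomain_of_mem_Icc hab hb' hb.le
  constructor
  · refine (dualUtility_antitone hκ hab hb' hb.le).trans_lt ?_
    have := dual_inner_pos hmid hab' (by simp [ha.ne])
    rw [sub_self, zero_mul, add_zero] at this
    exact sub_pos.1 (pos_of_mul_pos_right this (sub_pos.2 ha).le)
  · refine (dualDistortion_antitone hκ hmid hab' hb' ha.le).trans_lt ?_
    have := dual_inner_pos hmid hab (by simp [hb.ne])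
    rw [sub_self, zero_mul, zero_add] at this
    exact sub_pos.1 (pos_of_mul_pos_right this (sub_pos.2 hb).le)

end Model

namespace Model

variable {E : Model}

/-! ### Discounted sums along type histories -/

variable (E) in
/-- The present value of `n` unit payments. -/
def annuity : ℕ → ℝ
  | 0 => 0
  | n + 1 => 1 + E.δ * annuity n

theorem annuity_nonneg (n : ℕ) : 0 ≤ E.annuity n := by
  induction n with
  | zero => exact le_rfl
  | succ n ih =>
    have := mul_nonneg E.δ_pos.le ih
    simp only [annuity]
    linarith

theorem annuity_succ_pos (n : ℕ) : 0 < E.annuity (n + 1) := by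
  have := mul_nonneg E.δ_pos.le (annuity_nonneg (E := E) n)
  simp only [annuity]
  linarith

variable (E) in
/-- Expected discounted sum of the payoffs `f` of type histories over `n` periods. -/
def pathSum (f : List RiskType → RiskType → ℝ) : ℕ → List RiskType → RiskType → ℝ
  | 0, _, _ => 0
  | n + 1, L, θ => f L θ + E.δ * ∑ θ', E.trans θ θ' * pathSum f n (θ :: L) θ'

theorem expectedSum_eq_pathSum (f : List RiskType → RiskType → ℝ) (n : ℕ)
    (s : List (RiskType × E.Y)) (θ : RiskType) :
    E.expectedSum (fun s θ => f (s.map Prod.fst) θ) n s θ = E.pathSum f n (s.map Prod.fst) θ := by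
  induction n generalizing s θ with
  | zero => rfl
  | succ n ih =>
    simp only [expectedSum, pathSum, ih, List.map_cons, ← Finset.sum_mul, E.p_sum, one_mul]

theorem pathSum_mono {f g : List RiskType → RiskType → ℝ} (hfg : ∀ L θ, f L θ ≤ g L θ) (n : ℕ)
    (L : List RiskType) (θ : RiskType) : E.pathSum f n L θ ≤ E.pathSum g n L θ := by
  induction n generalizing L θ with
  | zero => exact le_rfl
  | succ n ih =>
    exact add_le_add (hfg L θ) (mul_le_mul_of_nonneg_left (Finset.sum_le_sum fun θ' _ =>
      mul_le_mul_of_nonneg_left (ih _ _) (E.trans_nonneg _ _)) E.δ_pos.le)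

theorem pathSum_add_mul (α β : ℝ) (f : List RiskType → RiskType → ℝ) (n : ℕ)
    (L : List RiskType) (θ : RiskType) :
    E.pathSum (fun L θ => α + β * f L θ) n L θ = α * E.annuity n + β * E.pathSum f n L θ := by
  induction n generalizing L θ with
  | zero => simp [pathSum, annuity]
  | succ n ih =>
    have h1 := E.trans_sum θ
    simp only [pathSum, annuity, ih, sum_riskType] at h1 ⊢
    linear_combination α * E.δ * E.annuity n * h1

theorem pathSum_sub (f g : List RiskType → RiskType → ℝ) (n : ℕ) (L : List RiskType)
    (θ : RiskType) :
    E.pathSum (fun L θ => f L θ - g L θ) n L θ = E.pathSum f n L θ - E.pathSum g n L θ := by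
  induction n generalizing L θ with
  | zero => simp [pathSum]
  | succ n ih =>
    simp only [pathSum, ih, sum_riskType]
    ring

/-- A discounted expectation is the annuity times a convex combination of flows. This gives the
constant utility equivalent to a continuation; nonemptiness matters only for `n = 0`. -/
theorem exists_pathSum_eq {I : Set ℝ} (hI : Convex ℝ I) (hne : I.Nonempty)
    {f : List RiskType → RiskType → ℝ}
    (hf : ∀ L θ, f L θ ∈ I) (n : ℕ) (L : List RiskType) (θ : RiskType) :
    ∃ w ∈ I, E.annuity n * w = E.pathSum f n L θ := by
  induction n generalizing L θ with
  | zero =>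
    obtain ⟨w, hw⟩ := hne
    exact ⟨w, hw, by simp [annuity, pathSum]⟩
  | succ n ih =>
    choose w hw hwe using fun θ' => ih (θ :: L) θ'
    have hA := annuity_succ_pos (E := E) n
    have hm : ∑ θ', E.trans θ θ' * w θ' ∈ I := by
      have := hI.sum_mem (t := Finset.univ) (w := E.trans θ) (z := w)
        (fun θ' _ => E.trans_nonneg _ _) (E.trans_sum θ) (fun θ' _ => hw θ')
      simpa only [smul_eq_mul] using this
    have h2 := hI (hf L θ) hm (show 0 ≤ 1 / E.annuity (n + 1) by positivity)
      (show 0 ≤ E.δ * E.annuity n / E.annuity (n + 1) from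
        div_nonneg (mul_nonneg E.δ_pos.le (annuity_nonneg n)) hA.le)
      (by rw [← add_div]; exact div_self hA.ne')
    refine ⟨_, h2, ?_⟩
    simp only [smul_eq_mul, pathSum, sum_riskType, ← hwe]
    field_simp

/-! ### Values of mechanisms -/

variable (E) in
/-- Continuation value of truth-telling after the reports `L` with `n` periods to go. -/
def value (M : E.Mechanism) : ℕ → List RiskType → RiskType → ℝ :=
  E.pathSum fun L θ => E.flowUtility (M L θ) θ

variable (E) in
/-- Expected consumption of a type in a flow contract. -/
def flowCost (z : E.Contract) (θ : RiskType) : ℝ := ∑ y, E.p θ y * (z y : ℝ)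

variable (E) in
/-- Continuation cost under truth-telling after the reports `L` with `n` periods to go. -/
def costValue (M : E.Mechanism) : ℕ → List RiskType → RiskType → ℝ :=
  E.pathSum fun L θ => E.flowCost (M L θ) θ

variable (E) in
/-- Ex-ante expected discounted consumption under truth-telling. -/
def totalCost (M : E.Mechanism) : ℝ := ∑ θ, E.init θ * E.costValue M E.T [] θ

/-- Expected income does not depend on the mechanism, so maximal profit means minimal cost. -/
theorem profit_eq (M : E.Mechanism) :
    E.profit M = ∑ θ, E.init θ *
      E.pathSum (fun _ θ => ∑ y, E.p θ y * ((y : ℝ≥0) : ℝ)) E.T [] θ - E.totalCost M := by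
  have h1 : ∀ θ, E.expectedSum (fun s θ => E.flowProfit (M (s.map Prod.fst) θ) θ) E.T [] θ =
      E.pathSum (fun _ θ => ∑ y, E.p θ y * ((y : ℝ≥0) : ℝ)) E.T [] θ - E.costValue M E.T [] θ := by
    intro θ
    have := expectedSum_eq_pathSum (E := E) (fun L θ => E.flowProfit (M L θ) θ) E.T [] θ
    rw [this, List.map_nil, costValue, ← pathSum_sub]
    simp only [flowProfit, flowCost, mul_sub, Finset.sum_sub_distrib]
  simp only [profit, h1, totalCost, mul_sub, Finset.sum_sub_distrib]

theorem map_trueType_privateHistory (r : E.Strategy) (s : List (RiskType × E.Y)) :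
    (E.privateHistory r s).map (fun e => e.2.2) = s.map Prod.fst := by
  induction s with
  | nil => rfl
  | cons a s ih =>
    obtain ⟨θ, y⟩ := a
    simp only [privateHistory, List.map_cons, ih]

/-- The strategy that reports as a function of the history of true types. -/
def typeStrategy (ρ : List RiskType → RiskType → RiskType) : E.Strategy :=
  fun η θ => ρ (η.map fun e => e.2.2) θ

/-- The reports of a strategy that reports as a function of the history of true types. -/
def typeReports (ρ : List RiskType → RiskType → RiskType) : List RiskType → List RiskType
  | [] => []
  | θ :: L => ρ L θ :: typeReports ρ L

theorem reports_typeStrategy (ρ : List RiskType → RiskType → RiskType)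
    (s : List (RiskType × E.Y)) :
    E.reports (E.privateHistory (typeStrategy ρ) s) = typeReports ρ (s.map Prod.fst) := by
  induction s with
  | nil => rfl
  | cons a s ih =>
    obtain ⟨θ, y⟩ := a
    have h1 : E.reports (E.privateHistory (typeStrategy ρ) ((θ, y) :: s)) =
        typeStrategy ρ (E.privateHistory (typeStrategy ρ) s) θ ::
          E.reports (E.privateHistory (typeStrategy ρ) s) := rfl
    rw [h1, ih, typeStrategy, map_trueType_privateHistory]
    rfl

theorem typeValue_typeStrategy (M : E.Mechanism) (ρ : List RiskType → RiskType → RiskType)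
    (θ : RiskType) :
    E.typeValue M (typeStrategy ρ) θ =
      E.pathSum (fun L θ => E.flowUtility (M (typeReports ρ L) (ρ L θ)) θ) E.T [] θ := by
  have := expectedSum_eq_pathSum (E := E)
    (fun L θ => E.flowUtility (M (typeReports ρ L) (ρ L θ)) θ) E.T [] θ
  rw [List.map_nil] at this
  rw [← this, typeValue]
  simp only [reports_typeStrategy]
  simp only [typeStrategy, map_trueType_privateHistory]

theorem typeReports_id (L : List RiskType) : typeReports (fun _ θ => θ) L = L := by
  induction L with
  | nil => rfl
  | cons θ L ih => simp only [typeReports, ih]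

theorem typeValue_truthful (M : E.Mechanism) (θ : RiskType) :
    E.typeValue M E.truthful θ = E.value M E.T [] θ := by
  have := typeValue_typeStrategy M (fun _ θ => θ) θ
  simp only [typeReports_id] at this
  exact this

theorem length_reports (r : E.Strategy) (s : List (RiskType × E.Y)) :
    (E.reports (E.privateHistory r s)).length = s.length := by
  induction s with
  | nil => rfl
  | cons a s ih =>
    obtain ⟨θ, y⟩ := a
    simp only [reports, List.length_map, privateHistory, List.length_cons] at ih ⊢
    rw [ih]

/-- Without profitable one-shot deviations a mechanism is incentive compatible. -/
theorem incentiveCompatible_of_oneShot (M : E.Mechanism)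
    (hM : ∀ (L : List RiskType) (n : ℕ) (θ θ' : RiskType), L.length + n + 1 = E.T →
      E.flowUtility (M L θ') θ + E.δ * ∑ θ'', E.trans θ θ'' * E.value M n (θ' :: L) θ'' ≤
        E.value M (n + 1) L θ) : E.IncentiveCompatible M := by
  intro r
  -- The truthful continuation value depends only on past reports and the current type, since types
  -- are Markov. Backward induction therefore applies after untruthful histories as well.
  have key : ∀ (n : ℕ) (s : List (RiskType × E.Y)) (θ : RiskType), s.length + n = E.T →
      E.expectedSum (fun s θ => E.flowUtility
        (M (E.reports (E.privateHistory r s)) (r (E.privateHistory r s) θ)) θ) n s θ ≤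
      E.value M n (E.reports (E.privateHistory r s)) θ := by
    intro n
    induction n with
    | zero => exact fun _ _ _ => le_rfl
    | succ n ih =>
      intro s θ hs
      refine le_trans ?_ (hM (E.reports (E.privateHistory r s)) n θ
        (r (E.privateHistory r s) θ) (by rw [length_reports]; omega))
      refine add_le_add le_rfl (mul_le_mul_of_nonneg_left ?_ E.δ_pos.le)
      have h1 : ∀ y, ∑ θ', E.trans θ θ' * E.expectedSum (fun s θ => E.flowUtility
          (M (E.reports (E.privateHistory r s)) (r (E.privateHistory r s) θ)) θ) n
          ((θ, y) :: s) θ' ≤ ∑ θ', E.trans θ θ' * E.value M n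
          (r (E.privateHistory r s) θ :: E.reports (E.privateHistory r s)) θ' := fun y =>
        Finset.sum_le_sum fun θ' _ => mul_le_mul_of_nonneg_left
          (ih ((θ, y) :: s) θ' (by rw [List.length_cons]; omega)) (E.trans_nonneg _ _)
      refine (Finset.sum_le_sum fun y _ =>
        mul_le_mul_of_nonneg_left (h1 y) (E.p_nonneg θ y)).trans ?_
      rw [← Finset.sum_mul, E.p_sum, one_mul]
  simp only [strategyValue]
  refine Finset.sum_le_sum fun θ _ => mul_le_mul_of_nonneg_left ?_ (E.init_pos θ).le
  rw [typeValue_truthful]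
  exact key E.T [] θ (by simp)

theorem trans_h_h_pos : 0 < E.trans h h :=
  (E.trans_nonneg l h).trans_lt (E.persistent h l (by decide))

/-- Misreport exactly once: as the low type after `k` high types. -/
def deviateAt (k : ℕ) (L : List RiskType) (θ : RiskType) : RiskType :=
  if L = List.replicate k h ∧ θ = l then h else θ

theorem deviateAt_eq {k : ℕ} {L : List RiskType} (hL : l ∈ L ∨ L.length ≠ k) (θ : RiskType) :
    deviateAt k L θ = θ := by
  refine if_neg ?_
  rintro ⟨rfl, -⟩
  rcases hL with hL | hL
  · simp at hL
  · simp at hL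

theorem deviateAt_high (k : ℕ) (L : List RiskType) : deviateAt k L h = h :=
  if_neg fun hc => RiskType.noConfusion hc.2

theorem typeReports_deviateAt_replicate (k j : ℕ) :
    typeReports (deviateAt k) (List.replicate j h) = List.replicate j h := by
  induction j with
  | zero => rfl
  | succ j ih => rw [List.replicate_succ, typeReports, ih, deviateAt_high]

theorem pathSum_deviateAt_of_off (M : E.Mechanism) (k n : ℕ) (L : List RiskType) (θ : RiskType)
    (hL : l ∈ L ∨ k < L.length) :
    E.pathSum (fun L θ => E.flowUtility (M (typeReports (deviateAt k) L) (deviateAt k L θ)) θ)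
      n L θ = E.value M n (typeReports (deviateAt k) L) θ := by
  induction n generalizing L θ with
  | zero => rfl
  | succ n ih =>
    have h1 : deviateAt k L θ = θ := deviateAt_eq (hL.imp_right fun hlt => hlt.ne') θ
    have h2 : ∀ θ', E.pathSum (fun L θ => E.flowUtility
        (M (typeReports (deviateAt k) L) (deviateAt k L θ)) θ) n (θ :: L) θ' =
        E.value M n (θ :: typeReports (deviateAt k) L) θ' := by
      intro θ'
      rw [ih (θ :: L) θ' (hL.imp (List.mem_cons_of_mem θ)
        fun hlt => by rw [List.length_cons]; omega), typeReports, h1]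
    rw [pathSum, Finset.sum_congr rfl fun θ' _ => by rw [h2 θ'], h1]
    rfl

/-- The low type does not gain from reporting high after high reports only. -/
theorem low_ic_of_incentiveCompatible (hmix : 0 < E.trans h l) {M : E.Mechanism}
    (hM : E.IncentiveCompatible M) {k n : ℕ} (hk : k + n + 1 = E.T) :
    E.flowUtility (M (List.replicate k h) h) l +
      E.δ * ∑ θ, E.trans l θ * E.value M n (List.replicate (k + 1) h) θ ≤
        E.value M (n + 1) (List.replicate k h) l := by
  set f : List RiskType → RiskType → ℝ := fun L θ =>
    E.flowUtility (M (typeReports (deviateAt k) L) (deviateAt k L θ)) θ with hf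
  -- The interim gain from the deviation. Incentive compatibility is ex ante, so the task is to show
  -- that `g` enters the ex-ante payoff with positive weight.
  set g : ℝ := E.flowUtility (M (List.replicate k h) h) l +
      E.δ * ∑ θ, E.trans l θ * E.value M n (List.replicate (k + 1) h) θ -
        E.value M (n + 1) (List.replicate k h) l with hg
  suffices g ≤ 0 by linarith
  have hdev : deviateAt k (List.replicate k h) l = h := if_pos ⟨rfl, rfl⟩
  have hlow : E.pathSum f (n + 1) (List.replicate k h) l =
      E.value M (n + 1) (List.replicate k h) l + g := by
    have h1 : ∀ θ, E.pathSum f n (l :: List.replicate k h) θ =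
        E.value M n (List.replicate (k + 1) h) θ := by
      intro θ
      rw [hf, pathSum_deviateAt_of_off M k n _ θ (Or.inl (List.mem_cons_self ..)), typeReports,
        hdev, typeReports_deviateAt_replicate, List.replicate_succ]
    have h2 : f (List.replicate k h) l = E.flowUtility (M (List.replicate k h) h) l := by
      simp only [hf, hdev, typeReports_deviateAt_replicate]
    rw [pathSum, h2, Finset.sum_congr rfl fun θ _ => by rw [h1 θ]]
    ring
  have hhigh : E.pathSum f (n + 1) (List.replicate k h) h =
      E.value M (n + 1) (List.replicate k h) h := by
    have h1 : ∀ θ, E.pathSum f n (h :: List.replicate k h) θ =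
        E.value M n (h :: List.replicate k h) θ := by
      intro θ
      rw [hf, pathSum_deviateAt_of_off M k n _ θ
        (Or.inr (by rw [List.length_cons, List.length_replicate]; omega)),
        ← List.replicate_succ, typeReports_deviateAt_replicate]
    have h2 : f (List.replicate k h) h = E.flowUtility (M (List.replicate k h) h) h := by
      simp only [hf, deviateAt_high, typeReports_deviateAt_replicate]
    rw [pathSum, h2, Finset.sum_congr rfl fun θ _ => by rw [h1 θ]]
    rfl
  have hlow' : ∀ (j m : ℕ), j < k → E.pathSum f m (List.replicate j h) l =
      E.value M m (List.replicate j h) l := by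
    intro j m hj
    cases m with
    | zero => rfl
    | succ m =>
      have h0 : deviateAt k (List.replicate j h) l = l :=
        deviateAt_eq (Or.inr (by rw [List.length_replicate]; omega)) l
      have h1 : ∀ θ, E.pathSum f m (l :: List.replicate j h) θ =
          E.value M m (l :: List.replicate j h) θ := by
        intro θ
        rw [hf, pathSum_deviateAt_of_off M k m _ θ (Or.inl (List.mem_cons_self ..)), typeReports,
          h0, typeReports_deviateAt_replicate]
      have h2 : f (List.replicate j h) l = E.flowUtility (M (List.replicate j h) l) l := by
        simp only [hf, h0, typeReports_deviateAt_replicate]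
      rw [pathSum, h2, Finset.sum_congr rfl fun θ _ => by rw [h1 θ]]
      rfl
  -- Backwards along the high path the gain is weighted by `E.δ * E.trans h l` once, where `hmix` is
  -- needed, and by `E.δ * E.trans h h` in each earlier period.
  have hrec : ∀ (i j : ℕ), j + i + 1 = k → ∃ c : ℝ, 0 < c ∧
      E.pathSum f (i + 1 + (n + 1)) (List.replicate j h) h =
        E.value M (i + 1 + (n + 1)) (List.replicate j h) h + c * g := by
    intro i
    induction i with
    | zero =>
      intro j hj
      refine ⟨E.δ * E.trans h l, mul_pos E.δ_pos hmix, ?_⟩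
      have h2 : f (List.replicate j h) h = E.flowUtility (M (List.replicate j h) h) h := by
        simp only [hf, deviateAt_high, typeReports_deviateAt_replicate]
      have h3 : h :: List.replicate j h = List.replicate k h := by
        rw [← List.replicate_succ]; congr 1
      have e : 0 + 1 + (n + 1) = (n + 1) + 1 := by omega
      rw [e, pathSum, value, pathSum, h2, h3, sum_riskType, sum_riskType, hlow, hhigh]
      simp only [value]
      ring
    | succ i ih =>
      intro j hj
      obtain ⟨c, hc, hce⟩ := ih (j + 1) (by omega)
      refine ⟨E.δ * (E.trans h h * c), mul_pos E.δ_pos (mul_pos trans_h_h_pos hc), ?_⟩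
      have h2 : f (List.replicate j h) h = E.flowUtility (M (List.replicate j h) h) h := by
        simp only [hf, deviateAt_high, typeReports_deviateAt_replicate]
      have e : i + 1 + 1 + (n + 1) = (i + 1 + (n + 1)) + 1 := by omega
      rw [e, pathSum, value, pathSum, h2, ← List.replicate_succ, sum_riskType, sum_riskType, hce,
        hlow' (j + 1) _ (by omega)]
      simp only [value]
      ring
  have hic := hM (typeStrategy (deviateAt k))
  simp only [strategyValue, typeValue_typeStrategy, typeValue_truthful, sum_riskType] at hic
  rcases Nat.eq_zero_or_pos k with rfl | hkpos
  · have e : E.T = n + 1 := by omega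
    rw [List.replicate_zero] at hlow hhigh
    rw [e, hlow, hhigh] at hic
    have := E.init_pos l
    by_contra! hcon
    nlinarith [mul_pos this hcon]
  · obtain ⟨c, hc, hce⟩ := hrec (k - 1) 0 (by omega)
    have e : E.T = k - 1 + 1 + (n + 1) := by omega
    have h1 := hlow' 0 (k - 1 + 1 + (n + 1)) hkpos
    rw [List.replicate_zero] at hce h1
    rw [e, h1, hce] at hic
    by_contra! hcon
    nlinarith [mul_pos (E.init_pos h) (mul_pos hc hcon)]

end Model

namespace Model

variable {E : Model}

/-! ### Plans: mechanisms that insure fully from the first low report on -/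

/-- The number of high reports before the first low report, if there is one. -/
def firstLow : List RiskType → Option ℕ
  | [] => none
  | θ :: L => match firstLow L with
    | some k => some k
    | none => if θ = l then some L.length else none

theorem firstLow_cons_of_some {L : List RiskType} {k : ℕ} (hL : firstLow L = some k)
    (θ : RiskType) : firstLow (θ :: L) = some k := by
  simp only [firstLow, hL]

theorem firstLow_low {L : List RiskType} (hL : firstLow L = none) :
    firstLow (l :: L) = some L.length := by
  simp [firstLow, hL]

theorem firstLow_high {L : List RiskType} (hL : firstLow L = none) :
    firstLow (h :: L) = none := by
  simp [firstLow, hL]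

variable (E) in
/-- Discounted sum along the path of high types of the payoffs `a`, where the first low type in
period `k` brings the payoff `β k` from then on. -/
def highSum (a β : ℕ → ℝ) : ℕ → ℕ → ℝ
  | 0, _ => 0
  | n + 1, k => a k + E.δ * (E.trans h h * highSum a β n (k + 1) +
      E.trans h l * (E.annuity n * β (k + 1)))

theorem pathSum_of_some {f : List RiskType → RiskType → ℝ} {β : ℕ → ℝ}
    (hf : ∀ L θ k, firstLow (θ :: L) = some k → f L θ = β k) {L : List RiskType} {k : ℕ}
    (hL : firstLow L = some k) (n : ℕ) (θ : RiskType) :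
    E.pathSum f n L θ = E.annuity n * β k := by
  induction n generalizing L θ with
  | zero => simp [pathSum, annuity]
  | succ n ih =>
    have h1 := firstLow_cons_of_some hL θ
    simp only [pathSum, ih h1, hf L θ k h1, ← Finset.sum_mul, E.trans_sum, annuity]
    ring

theorem pathSum_low {f : List RiskType → RiskType → ℝ} {β : ℕ → ℝ}
    (hf : ∀ L θ k, firstLow (θ :: L) = some k → f L θ = β k) {L : List RiskType}
    (hL : firstLow L = none) (n : ℕ) :
    E.pathSum f n L l = E.annuity n * β L.length := by
  cases n with
  | zero => simp [pathSum, annuity]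
  | succ n =>
    have h1 := firstLow_low hL
    simp only [pathSum, pathSum_of_some hf h1, hf L l _ h1, ← Finset.sum_mul, E.trans_sum, annuity]
    ring

theorem pathSum_high {f : List RiskType → RiskType → ℝ} {a β : ℕ → ℝ}
    (hf : ∀ L θ k, firstLow (θ :: L) = some k → f L θ = β k)
    (hf' : ∀ L, firstLow L = none → f L h = a L.length) {L : List RiskType}
    (hL : firstLow L = none) (n : ℕ) :
    E.pathSum f n L h = E.highSum a β n L.length := by
  induction n generalizing L with
  | zero => rfl
  | succ n ih =>
    have h1 := firstLow_high hL
    rw [pathSum, sum_riskType, ih h1, pathSum_low hf h1, hf' L hL, highSum, List.length_cons]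
    ring

/-- The mechanism with high-path utilities `v` and constant utility `w k` after a first low report
that follows `k` high reports. -/
def plan (v : ℕ → E.Y → ℝ) (w : ℕ → ℝ) : E.Mechanism := fun L θ y =>
  (match firstLow (θ :: L) with
    | some k => E.cons (w k)
    | none => E.cons (v L.length y)).toNNReal

variable (E) in
/-- Expectation over incomes. -/
def mean (θ : RiskType) (f : E.Y → ℝ) : ℝ := ∑ y, E.p θ y * f y

theorem mean_const (θ : RiskType) (c : ℝ) : E.mean θ (fun _ => c) = c := by
  rw [mean, ← Finset.sum_mul, E.p_sum, one_mul]

variable {v : ℕ → E.Y → ℝ} {w : ℕ → ℝ}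

theorem coe_plan_of_some (hw : ∀ k, w k ∈ E.utilityRange) {L : List RiskType} {θ : RiskType}
    {k : ℕ} (hk : firstLow (θ :: L) = some k) (y : E.Y) :
    (plan v w L θ y : ℝ) = E.cons (w k) := by
  simp only [plan, hk]
  exact Real.coe_toNNReal _ (E.cons_nonneg (hw k))

theorem coe_plan_of_none (hv : ∀ k y, v k y ∈ E.utilityRange) {L : List RiskType} {θ : RiskType}
    (hk : firstLow (θ :: L) = none) (y : E.Y) :
    (plan v w L θ y : ℝ) = E.cons (v L.length y) := by
  simp only [plan, hk]
  exact Real.coe_toNNReal _ (E.cons_nonneg (hv _ y))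

theorem flowUtility_plan_of_some (hw : ∀ k, w k ∈ E.utilityRange) {L : List RiskType}
    {θ : RiskType} {k : ℕ} (hk : firstLow (θ :: L) = some k) (θ' : RiskType) :
    E.flowUtility (plan v w L θ) θ' = w k := by
  simp only [flowUtility, coe_plan_of_some hw hk, E.u_cons (hw k)]
  exact mean_const θ' (w k)

theorem flowUtility_plan_of_none (hv : ∀ k y, v k y ∈ E.utilityRange) {L : List RiskType}
    {θ : RiskType} (hk : firstLow (θ :: L) = none) (θ' : RiskType) :
    E.flowUtility (plan v w L θ) θ' = E.mean θ' (v L.length) := by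
  simp only [flowUtility, coe_plan_of_none hv hk, E.u_cons (hv _ _)]
  rfl

theorem flowCost_plan_of_some (hw : ∀ k, w k ∈ E.utilityRange) {L : List RiskType}
    {θ : RiskType} {k : ℕ} (hk : firstLow (θ :: L) = some k) (θ' : RiskType) :
    E.flowCost (plan v w L θ) θ' = E.cons (w k) := by
  simp only [flowCost, coe_plan_of_some hw hk]
  exact mean_const θ' _

theorem flowCost_plan_of_none (hv : ∀ k y, v k y ∈ E.utilityRange) {L : List RiskType}
    {θ : RiskType} (hk : firstLow (θ :: L) = none) (θ' : RiskType) :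
    E.flowCost (plan v w L θ) θ' = E.mean θ' (fun y => E.cons (v L.length y)) := by
  simp only [flowCost, coe_plan_of_none hv hk]
  rfl

variable (E) in
/-- Utility of a high type on the high path, with `n` periods to go after `k` high reports. -/
def highValue (v : ℕ → E.Y → ℝ) (w : ℕ → ℝ) : ℕ → ℕ → ℝ :=
  E.highSum (fun k => E.mean h (v k)) w

variable (E) in
/-- Cost of a high type on the high path, with `n` periods to go after `k` high reports. -/
def highCost (v : ℕ → E.Y → ℝ) (w : ℕ → ℝ) : ℕ → ℕ → ℝ :=
  E.highSum (fun k => E.mean h fun y => E.cons (v k y)) fun k => E.cons (w k)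

theorem value_plan_some (hw : ∀ k, w k ∈ E.utilityRange) {L : List RiskType}
    {k : ℕ} (hL : firstLow L = some k) (n : ℕ) (θ : RiskType) :
    E.value (plan v w) n L θ = E.annuity n * w k :=
  pathSum_of_some (fun _ θ _ hk => flowUtility_plan_of_some hw hk θ) hL n θ

theorem value_plan_low (hw : ∀ k, w k ∈ E.utilityRange) {L : List RiskType}
    (hL : firstLow L = none) (n : ℕ) :
    E.value (plan v w) n L l = E.annuity n * w L.length :=
  pathSum_low (fun _ θ _ hk => flowUtility_plan_of_some hw hk θ) hL n

theorem value_plan_high (hv : ∀ k y, v k y ∈ E.utilityRange) (hw : ∀ k, w k ∈ E.utilityRange)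
    {L : List RiskType} (hL : firstLow L = none) (n : ℕ) :
    E.value (plan v w) n L h = E.highValue v w n L.length :=
  pathSum_high (fun _ θ _ hk => flowUtility_plan_of_some hw hk θ)
    (fun _ hk => flowUtility_plan_of_none hv (firstLow_high hk) h) hL n

variable (E) in
/-- The total cost of a plan. -/
def planCost (v : ℕ → E.Y → ℝ) (w : ℕ → ℝ) : ℝ :=
  E.init h * E.highCost v w E.T 0 + E.init l * (E.annuity E.T * E.cons (w 0))

theorem totalCost_plan (hv : ∀ k y, v k y ∈ E.utilityRange) (hw : ∀ k, w k ∈ E.utilityRange) :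
    E.totalCost (plan v w) = E.planCost v w := by
  have h1 : E.costValue (plan v w) E.T [] l = E.annuity E.T * E.cons (w 0) :=
    pathSum_low (β := fun k => E.cons (w k))
      (fun _ θ _ hk => flowCost_plan_of_some hw hk θ) rfl E.T
  have h2 : E.costValue (plan v w) E.T [] h = E.highCost v w E.T 0 :=
    pathSum_high (fun _ θ _ hk => flowCost_plan_of_some hw hk θ)
      (fun _ hk => flowCost_plan_of_none hv (firstLow_high hk) h) rfl E.T
  rw [totalCost, sum_riskType, h1, h2, planCost, add_comm]

variable (E) in
/-- Plans with promised utilities `V` in which the low type does not imitate the high type. -/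
structure Admissible (V : RiskType → ℝ) (v : ℕ → E.Y → ℝ) (w : ℕ → ℝ) : Prop where
  mem_v : ∀ k y, v k y ∈ E.utilityRange
  mem_w : ∀ k, w k ∈ E.utilityRange
  low : E.annuity E.T * w 0 = V l
  high : E.highValue v w E.T 0 = V h
  ic : ∀ k n, k + n + 1 = E.T →
    E.mean l (v k) + E.δ * (E.trans l h * E.highValue v w n (k + 1) +
      E.trans l l * (E.annuity n * w (k + 1))) ≤ E.annuity (n + 1) * w k

/-- An admissible plan in which the high type is always promised at least as much as the low type
is a feasible mechanism. -/
theorem Admissible.feasible {V : RiskType → ℝ} (ha : E.Admissible V v w)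
    (hD : ∀ k n, k + n = E.T → E.annuity n * w k ≤ E.highValue v w n k) :
    E.Feasible V (plan v w) := by
  refine ⟨incentiveCompatible_of_oneShot _ fun L n θ θ' hn => ?_, ?_⟩
  · by_cases hθ : θ' = θ
    · subst hθ
      exact le_rfl
    rcases hL : firstLow L with _ | k
    · cases θ <;> cases θ'
      · exact absurd rfl hθ
      · rw [flowUtility_plan_of_none ha.mem_v (firstLow_high hL), sum_riskType,
          value_plan_low ha.mem_w (firstLow_high hL), value_plan_low ha.mem_w hL,
          value_plan_high ha.mem_v ha.mem_w (firstLow_high hL), List.length_cons]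
        have := ha.ic L.length n hn
        linarith
      -- A high type who reports low receives the constant utility for good, so `hD` is exactly this
      -- constraint.
      · rw [flowUtility_plan_of_some ha.mem_w (firstLow_low hL)]
        simp only [value_plan_some ha.mem_w (firstLow_low hL), ← Finset.sum_mul, E.trans_sum,
          value_plan_high ha.mem_v ha.mem_w hL]
        have := hD L.length (n + 1) (by omega)
        simp only [annuity] at this
        linarith
      · exact absurd rfl hθ
    · rw [flowUtility_plan_of_some ha.mem_w (firstLow_cons_of_some hL θ'),
        value_plan_some ha.mem_w hL]
      simp only [value_plan_some ha.mem_w (firstLow_cons_of_some hL θ'), ← Finset.sum_mul,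
        E.trans_sum, annuity]
      exact le_of_eq (by ring)
  · intro θ
    rw [typeValue_truthful]
    cases θ
    · rw [value_plan_low ha.mem_w rfl]
      exact ha.low
    · rw [value_plan_high ha.mem_v ha.mem_w rfl]
      exact ha.high

theorem totalCost_le_of_isOptimal {V : RiskType → ℝ} {M M' : E.Mechanism}
    (hM : E.IsOptimal V M) (hM' : E.Feasible V M') : E.totalCost M ≤ E.totalCost M' := by
  have := hM.2 M' hM'
  rw [profit_eq, profit_eq] at this
  linarith

/-! ### Linear algebra of `highSum` -/

theorem trans_h_sum : E.trans h l + E.trans h h = 1 := by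
  have := E.trans_sum h
  rwa [sum_riskType] at this

theorem trans_l_sum : E.trans l l + E.trans l h = 1 := by
  have := E.trans_sum l
  rwa [sum_riskType] at this

theorem highSum_add_mul (a β a' β' : ℕ → ℝ) (c : ℝ) (n k : ℕ) :
    E.highSum (fun j => a j + c * a' j) (fun j => β j + c * β' j) n k =
      E.highSum a β n k + c * E.highSum a' β' n k := by
  induction n generalizing k with
  | zero => simp [highSum]
  | succ n ih =>
    simp only [highSum, ih]
    ring

theorem highSum_const (c : ℝ) (n k : ℕ) :
    E.highSum (fun _ => c) (fun _ => c) n k = E.annuity n * c := by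
  induction n generalizing k with
  | zero => simp [highSum, annuity]
  | succ n ih =>
    simp only [highSum, ih, annuity]
    linear_combination c * E.δ * E.annuity n * trans_h_sum (E := E)

theorem highSum_congr {a β a' β' : ℕ → ℝ} {n k : ℕ} (ha : ∀ j, k ≤ j → j < k + n → a j = a' j)
    (hβ : ∀ j, k < j → j < k + n → β j = β' j) :
    E.highSum a β n k = E.highSum a' β' n k := by
  induction n generalizing k with
  | zero => rfl
  | succ n ih =>
    rw [highSum, highSum, ha k le_rfl (by omega),
      ih (fun j h1 h2 => ha j (by omega) (by omega)) (fun j h1 h2 => hβ j (by omega) (by omega))]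
    cases n with
    | zero => simp [annuity]
    | succ n => rw [hβ (k + 1) (by omega) (by omega)]

theorem highSum_mono {a β a' β' : ℕ → ℝ} (ha : ∀ j, a j ≤ a' j) (hβ : ∀ j, β j ≤ β' j)
    (n k : ℕ) : E.highSum a β n k ≤ E.highSum a' β' n k := by
  induction n generalizing k with
  | zero => exact le_rfl
  | succ n ih =>
    exact add_le_add (ha k) (mul_le_mul_of_nonneg_left (add_le_add
      (mul_le_mul_of_nonneg_left (ih (k + 1)) (E.trans_nonneg _ _))
      (mul_le_mul_of_nonneg_left (mul_le_mul_of_nonneg_left (hβ (k + 1)) (annuity_nonneg n))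
        (E.trans_nonneg _ _))) E.δ_pos.le)

variable (E) in
/-- Expected payoff in period `k` conditional on a high type in the period before. -/
def entrySum (a β : ℕ → ℝ) (n k : ℕ) : ℝ :=
  E.trans h h * E.highSum a β n k + E.trans h l * (E.annuity n * β k)

theorem highSum_succ (a β : ℕ → ℝ) (n k : ℕ) :
    E.highSum a β (n + 1) k = a k + E.δ * E.entrySum a β n (k + 1) := rfl

/-- Payoffs that differ only from period `k + i + 1` on. -/
theorem highSum_sub_of_agree {a β a' β' : ℕ → ℝ} {i k : ℕ} (n : ℕ)
    (ha : ∀ j, k ≤ j → j ≤ k + i → a j = a' j) (hβ : ∀ j, k < j → j ≤ k + i → β j = β' j) :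
    E.highSum a β (i + 1 + n) k - E.highSum a' β' (i + 1 + n) k =
      E.δ ^ (i + 1) * E.trans h h ^ i *
        (E.entrySum a β n (k + i + 1) - E.entrySum a' β' n (k + i + 1)) := by
  induction i generalizing k with
  | zero =>
    have e : 0 + 1 + n = n + 1 := by omega
    rw [e, highSum_succ, highSum_succ, ha k le_rfl le_rfl]
    simp only [add_zero, zero_add, pow_one, pow_zero]
    ring
  | succ i ih =>
    have e : i + 1 + 1 + n = (i + 1 + n) + 1 := by omega
    have e2 : k + 1 + i + 1 = k + (i + 1) + 1 := by omega
    have h1 := ih (k := k + 1) (fun j h1 h2 => ha j (by omega) (by omega))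
      (fun j h1 h2 => hβ j (by omega) (by omega))
    rw [e2] at h1
    rw [e, highSum, highSum, ha k le_rfl (by omega), hβ (k + 1) (by omega) (by omega)]
    rw [pow_succ, pow_succ (E.trans h h)]
    linear_combination E.δ * E.trans h h * h1

theorem exists_highSum_eq {I : Set ℝ} (hI : Convex ℝ I) {a β : ℕ → ℝ} (ha : ∀ j, a j ∈ I)
    (hβ : ∀ j, β j ∈ I) (n k : ℕ) : ∃ c ∈ I, E.annuity n * c = E.highSum a β n k := by
  induction n generalizing k with
  | zero => exact ⟨a 0, ha 0, by simp [annuity, highSum]⟩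
  | succ n ih =>
    obtain ⟨c, hc, hce⟩ := ih (k + 1)
    have hA := annuity_succ_pos (E := E) n
    have hm := hI hc (hβ (k + 1)) (E.trans_nonneg h h) (E.trans_nonneg h l)
      (by rw [add_comm]; exact trans_h_sum)
    have h2 := hI (ha k) hm (show 0 ≤ 1 / E.annuity (n + 1) by positivity)
      (show 0 ≤ E.δ * E.annuity n / E.annuity (n + 1) from
        div_nonneg (mul_nonneg E.δ_pos.le (annuity_nonneg n)) hA.le)
      (by rw [← add_div]; exact div_self hA.ne')
    refine ⟨_, h2, ?_⟩
    simp only [smul_eq_mul, highSum, ← hce]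
    field_simp

theorem mean_mem {I : Set ℝ} (hI : Convex ℝ I) {f : E.Y → ℝ} (hf : ∀ y, f y ∈ I)
    (θ : RiskType) : E.mean θ f ∈ I := by
  have := hI.sum_mem (t := Finset.univ) (w := E.p θ) (z := f)
    (fun y _ => E.p_nonneg θ y) (E.p_sum θ) (fun y _ => hf y)
  simp only [smul_eq_mul] at this
  exact this

theorem mean_mono {f g : E.Y → ℝ} (hfg : ∀ y, f y ≤ g y) (θ : RiskType) :
    E.mean θ f ≤ E.mean θ g :=
  Finset.sum_le_sum fun y _ => mul_le_mul_of_nonneg_left (hfg y) (E.p_nonneg θ y)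

theorem mean_add_mul (f g : E.Y → ℝ) (c : ℝ) (θ : RiskType) :
    E.mean θ (fun y => f y + c * g y) = E.mean θ f + c * E.mean θ g := by
  simp only [mean, mul_add, Finset.sum_add_distrib, Finset.mul_sum]
  congr 1
  exact Finset.sum_congr rfl fun y _ => by ring

theorem mean_affine (α β : ℝ) (f : E.Y → ℝ) (θ : RiskType) :
    E.mean θ (fun y => α + β * f y) = α + β * E.mean θ f := by
  have := mean_add_mul (fun _ => α) f β θ
  rwa [mean_const] at this

end Model

namespace Model

variable {E : Model} {v : ℕ → E.Y → ℝ} {w : ℕ → ℝ} {V : RiskType → ℝ}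

/-! ### Cost of full insurance -/

/-- Jensen: the tangent to the cost of utility at `w₀` bounds every flow cost from below. If `cons
w₀ = 0`, nonnegativity of consumption is enough. -/
theorem annuity_mul_cons_le_costValue (M : E.Mechanism) {n : ℕ} {L : List RiskType} {θ : RiskType}
    {w₀ : ℝ} (hw₀ : w₀ ∈ E.utilityRange) (hval : E.annuity n * w₀ = E.value M n L θ) :
    E.annuity n * E.cons w₀ ≤ E.costValue M n L θ := by
  rcases (E.cons_nonneg hw₀).eq_or_lt with h0 | hpos
  · have h1 := pathSum_mono (E := E) (f := fun _ _ => 0 + 0 * (0 : ℝ))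
      (g := fun L θ => E.flowCost (M L θ) θ) (fun L θ => by
        rw [mul_zero, add_zero]
        exact Finset.sum_nonneg fun y _ => mul_nonneg (E.p_nonneg θ y) (M L θ y).2) n L θ
    rw [pathSum_add_mul, zero_mul, zero_mul, add_zero] at h1
    rw [← h0, mul_zero]
    exact h1
  · set m := E.marginalCost (E.cons w₀) with hm
    have h1 := pathSum_mono (E := E)
      (f := fun L θ => (E.cons w₀ - m * w₀) + m * E.flowUtility (M L θ) θ)
      (g := fun L θ => E.flowCost (M L θ) θ) (fun L θ => by
        have h2 := mean_mono (E := E) (f := fun y => (E.cons w₀ - m * w₀) + m * E.u (M L θ y))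
          (g := fun y => (M L θ y : ℝ)) (fun y => by
            have := E.cost_tangent_le hpos (M L θ y).2
            rw [E.u_cons hw₀] at this
            have h3 : (E.cons w₀ - m * w₀) + m * E.u (M L θ y) =
              E.cons w₀ + m * (E.u (M L θ y) - w₀) := by ring
            rw [h3]
            exact this) θ
        rw [mean_affine] at h2
        exact h2) n L θ
    rw [pathSum_add_mul] at h1
    have h2 : E.pathSum (fun L θ => E.flowUtility (M L θ) θ) n L θ = E.annuity n * w₀ := hval.symm
    rw [h2] at h1
    refine le_trans (le_of_eq ?_) h1
    ring

/-- Cost is an affine function of value plus the gaps between cost and its tangent at `w₀`. This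
form gives both Jensen's inequality and its equality case. -/
theorem highCost_eq_tangent_add (v : ℕ → E.Y → ℝ) (w : ℕ → ℝ) (w₀ m : ℝ) (n k : ℕ) :
    E.highCost v w n k = E.annuity n * (E.cons w₀ - m * w₀) + m * E.highValue v w n k +
      E.highSum (fun j => E.mean h fun y => E.cons (v j y) - (E.cons w₀ + m * (v j y - w₀)))
        (fun j => E.cons (w j) - (E.cons w₀ + m * (w j - w₀))) n k := by
  have h1 : E.highCost v w n k = E.highSum
      (fun j => ((E.cons w₀ - m * w₀) + m * E.mean h (v j)) + 1 *
        E.mean h fun y => E.cons (v j y) - (E.cons w₀ + m * (v j y - w₀)))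
      (fun j => ((E.cons w₀ - m * w₀) + m * w j) + 1 *
        (E.cons (w j) - (E.cons w₀ + m * (w j - w₀)))) n k := by
    refine highSum_congr (fun j _ _ => ?_) (fun j _ _ => ?_)
    · rw [← mean_affine _ m (v j), ← mean_add_mul]
      exact congrArg _ (funext fun y => by ring)
    · ring
  rw [h1, highSum_add_mul, highSum_add_mul, highSum_const, one_mul]
  rfl

theorem highSum_nonneg {a β : ℕ → ℝ} (ha : ∀ j, 0 ≤ a j) (hβ : ∀ j, 0 ≤ β j) (n k : ℕ) :
    0 ≤ E.highSum a β n k := by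
  have := highSum_mono (E := E) ha hβ n k
  rwa [highSum_const, mul_zero] at this

theorem mean_nonneg {f : E.Y → ℝ} (hf : ∀ y, 0 ≤ f y) (θ : RiskType) : 0 ≤ E.mean θ f :=
  Finset.sum_nonneg fun y _ => mul_nonneg (E.p_nonneg θ y) (hf y)

variable (E) in
/-- Expected value at the beginning of a period conditional on a high type in the period before. -/
def entryValue (v : ℕ → E.Y → ℝ) (w : ℕ → ℝ) (n k : ℕ) : ℝ :=
  E.trans h h * E.highValue v w n k + E.trans h l * (E.annuity n * w k)

variable (E) in
/-- Expected cost at the beginning of a period conditional on a high type in the period before. -/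
def entryCost (v : ℕ → E.Y → ℝ) (w : ℕ → ℝ) (n k : ℕ) : ℝ :=
  E.trans h h * E.highCost v w n k + E.trans h l * (E.annuity n * E.cons (w k))

theorem entryCost_eq_tangent_add (v : ℕ → E.Y → ℝ) (w : ℕ → ℝ) {w₀ : ℝ} (m : ℝ) {n k : ℕ}
    (hval : E.annuity n * w₀ = E.entryValue v w n k) :
    E.entryCost v w n k = E.annuity n * E.cons w₀ + (E.trans h h *
      E.highSum (fun j => E.mean h fun y => E.cons (v j y) - (E.cons w₀ + m * (v j y - w₀)))
        (fun j => E.cons (w j) - (E.cons w₀ + m * (w j - w₀))) n k +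
      E.trans h l * (E.annuity n * (E.cons (w k) - (E.cons w₀ + m * (w k - w₀))))) := by
  rw [entryCost, highCost_eq_tangent_add v w w₀ m]
  rw [entryValue] at hval
  linear_combination (E.annuity n * (E.cons w₀ - m * w₀)) * trans_h_sum (E := E) - m * hval

theorem annuity_mul_cons_le_entryCost (hv : ∀ k y, v k y ∈ E.utilityRange)
    (hw : ∀ k, w k ∈ E.utilityRange) {w₀ : ℝ} (hw₀ : w₀ ∈ E.utilityRange) {n k : ℕ}
    (hval : E.annuity n * w₀ = E.entryValue v w n k) :
    E.annuity n * E.cons w₀ ≤ E.entryCost v w n k := by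
  obtain ⟨m, hm⟩ : ∃ m : ℝ, ∀ x ∈ E.utilityRange,
      0 ≤ E.cons x - (E.cons w₀ + m * (x - w₀)) := by
    rcases (E.cons_nonneg hw₀).eq_or_lt with h0 | hpos
    · refine ⟨0, fun x hx => ?_⟩
      rw [← h0, zero_mul, add_zero, sub_zero]
      exact E.cons_nonneg hx
    · exact ⟨_, fun x hx => sub_nonneg.2 (E.cons_tangent_le hw₀ hpos hx)⟩
  rw [entryCost_eq_tangent_add v w m hval]
  refine le_add_of_nonneg_right (add_nonneg (mul_nonneg (E.trans_nonneg _ _)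
    (highSum_nonneg (fun j => mean_nonneg (fun y => hm _ (hv j y)) h) (fun j => hm _ (hw j)) n k))
    (mul_nonneg (E.trans_nonneg _ _) (mul_nonneg (annuity_nonneg n) (hm _ (hw k)))))

/-- Equality in Jensen: both types have positive probability after a high type, so the gaps at date
`k` vanish, and by strict convexity they vanish only at `w₀`. -/
theorem eq_of_entryCost_le (hmix : 0 < E.trans h l) (hv : ∀ k y, v k y ∈ E.utilityRange)
    (hw : ∀ k, w k ∈ E.utilityRange) {w₀ : ℝ} (hw₀ : w₀ ∈ E.utilityRange)
    (hpos : 0 < E.cons w₀) {n k : ℕ}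
    (hval : E.annuity (n + 1) * w₀ = E.entryValue v w (n + 1) k)
    (hle : E.entryCost v w (n + 1) k ≤ E.annuity (n + 1) * E.cons w₀) :
    w k = w₀ ∧ ∀ y, v k y = w₀ := by
  set m := E.marginalCost (E.cons w₀)
  have hm : ∀ x ∈ E.utilityRange, 0 ≤ E.cons x - (E.cons w₀ + m * (x - w₀)) := fun x hx =>
    sub_nonneg.2 (E.cons_tangent_le hw₀ hpos hx)
  have hm' : ∀ x ∈ E.utilityRange, E.cons x - (E.cons w₀ + m * (x - w₀)) ≤ 0 → x = w₀ := by
    intro x hx hx0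
    by_contra hne
    have := E.cons_tangent_lt hw₀ hpos hx hne
    linarith
  rw [entryCost_eq_tangent_add v w m hval] at hle
  have h1 : ∀ i k, 0 ≤ E.highSum
      (fun j => E.mean h fun y => E.cons (v j y) - (E.cons w₀ + m * (v j y - w₀)))
      (fun j => E.cons (w j) - (E.cons w₀ + m * (w j - w₀))) i k :=
    highSum_nonneg (fun j => mean_nonneg (fun y => hm _ (hv j y)) h) (fun j => hm _ (hw j))
  have h2 := mul_nonneg (E.trans_nonneg h h) (h1 (n + 1) k)
  have hA := annuity_succ_pos (E := E) n
  have h3 := mul_nonneg (E.trans_nonneg h l) (mul_nonneg hA.le (hm _ (hw k)))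
  constructor
  · refine hm' _ (hw k) ?_
    have h4 : E.trans h l * (E.annuity (n + 1) * (E.cons (w k) - (E.cons w₀ + m * (w k - w₀)))) ≤ 0 :=
      by linarith
    by_contra! hcon
    have := mul_pos hmix (mul_pos hA hcon)
    linarith
  · intro y
    refine hm' _ (hv k y) ?_
    have h4 : E.highSum
      (fun j => E.mean h fun y => E.cons (v j y) - (E.cons w₀ + m * (v j y - w₀)))
      (fun j => E.cons (w j) - (E.cons w₀ + m * (w j - w₀))) (n + 1) k ≤ 0 := by
      by_contra! hcon
      have := mul_pos (trans_h_h_pos (E := E)) hcon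
      linarith
    rw [highSum] at h4
    have h5 := mul_nonneg E.δ_pos.le (add_nonneg
      (mul_nonneg (E.trans_nonneg h h) (h1 n (k + 1)))
      (mul_nonneg (E.trans_nonneg h l) (mul_nonneg (annuity_nonneg (E := E) n)
        (hm _ (hw (k + 1))))))
    have h6 : E.p h y * (E.cons (v k y) - (E.cons w₀ + m * (v k y - w₀))) ≤
        E.mean h fun y => E.cons (v k y) - (E.cons w₀ + m * (v k y - w₀)) :=
      Finset.single_le_sum
        (f := fun y => E.p h y * (E.cons (v k y) - (E.cons w₀ + m * (v k y - w₀))))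
        (fun y _ => mul_nonneg (E.p_nonneg h y) (hm _ (hv k y))) (Finset.mem_univ y)
    by_contra! hcon
    have := mul_pos (E.p_high_pos y) hcon
    linarith

/-! ### Reduction of a mechanism to a plan -/

/-- Contracts on the high path are kept, so utilities and distortions there do not change. Each
continuation after a first low report is replaced by its constant equivalent, which is no dearer. -/
theorem exists_reduction (hmix : 0 < E.trans h l) {M : E.Mechanism} (hM : E.Feasible V M)
    (hint : E.Interior M) :
    ∃ w : ℕ → ℝ, E.Admissible V (fun k y => E.u (M (List.replicate k h) h y)) w ∧
      (∀ k < E.T, E.u 0 < w k) ∧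
      E.planCost (fun k y => E.u (M (List.replicate k h) h y)) w ≤ E.totalCost M := by
  have hflow : ∀ L θ, E.flowUtility (M L θ) θ ∈ E.utilityRange := fun L θ =>
    mean_mem E.utilityRange_convex (fun y => E.u_mem_utilityRange (M L θ y).2) θ
  choose w hw hwe using fun k => exists_pathSum_eq (E := E) E.utilityRange_convex
    ⟨_, E.u_mem_utilityRange le_rfl⟩ hflow (E.T - k) (List.replicate k h) l
  have hwe' : ∀ k n, k + n = E.T → E.annuity n * w k = E.value M n (List.replicate k h) l := by
    intro k n hkn
    have : n = E.T - k := by omega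
    subst this
    exact hwe k
  set v : ℕ → E.Y → ℝ := fun k y => E.u (M (List.replicate k h) h y) with hv
  have hval : ∀ n k, k + n = E.T → E.highValue v w n k = E.value M n (List.replicate k h) h := by
    intro n
    induction n with
    | zero => exact fun _ _ => rfl
    | succ n ih =>
      intro k hk
      have h1 := ih (k + 1) (by omega)
      have h2 := hwe' (k + 1) n (by omega)
      rw [highValue] at h1 ⊢
      rw [highSum, h1, h2, value, pathSum, sum_riskType, ← List.replicate_succ]
      rw [add_comm (E.trans h l * _)]
      rfl
  have hcost : ∀ n k, k + n = E.T →
      E.highCost v w n k ≤ E.costValue M n (List.replicate k h) h := by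
    intro n
    induction n with
    | zero => exact fun _ _ => le_rfl
    | succ n ih =>
      intro k hk
      have h1 := ih (k + 1) (by omega)
      have h2 := annuity_mul_cons_le_costValue M (hw (k + 1)) (hwe' (k + 1) n (by omega))
      rw [highCost] at h1 ⊢
      rw [highSum, costValue, pathSum, sum_riskType, ← List.replicate_succ]
      refine add_le_add (le_of_eq ?_) (mul_le_mul_of_nonneg_left ?_ E.δ_pos.le)
      · simp only [hv, mean, flowCost, E.cons_u (NNReal.coe_nonneg _)]
      · rw [add_comm (E.trans h l * _)]
        exact add_le_add (mul_le_mul_of_nonneg_left h1 (E.trans_nonneg _ _))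
          (mul_le_mul_of_nonneg_left h2 (E.trans_nonneg _ _))
  refine ⟨w, ⟨fun k y => E.u_mem_utilityRange (NNReal.coe_nonneg _), hw, ?_, ?_, ?_⟩, ?_, ?_⟩
  · rw [hwe' 0 E.T (by omega), List.replicate_zero, ← typeValue_truthful]
    exact hM.2 l
  · rw [hval E.T 0 (by omega), List.replicate_zero, ← typeValue_truthful]
    exact hM.2 h
  · intro k n hk
    have := low_ic_of_incentiveCompatible hmix hM.1 hk
    rw [sum_riskType, ← hwe' (k + 1) n (by omega), ← hval n (k + 1) (by omega),
      ← hwe' k (n + 1) (by omega)] at this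
    have e : E.mean l (v k) = E.flowUtility (M (List.replicate k h) h) l := rfl
    rw [e]
    linarith
  -- Interiority lifts the flow utility at the first low report above `u 0`, and later flows are at
  -- least `u 0`.
  · intro k hk
    obtain ⟨n, hn⟩ : ∃ n, k + (n + 1) = E.T := ⟨E.T - k - 1, by omega⟩
    have h1 := hwe' k (n + 1) hn
    have hpos : ∀ y, E.u 0 < E.u (M (List.replicate k h) l y) := by
      intro y
      have h2 := hint (k + 1) ⟨by omega, by omega⟩ l y
      rw [Nat.add_sub_cancel] at h2
      exact E.u_strictMono (mem_Ici.2 le_rfl) (mem_Ici.2 (NNReal.coe_nonneg _))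
        (NNReal.coe_pos.2 h2)
    have h2 : E.u 0 < E.flowUtility (M (List.replicate k h) l) l := by
      obtain ⟨y, hy⟩ : ∃ y, 0 < E.p l y := by
        by_contra! hcon
        have := E.p_sum l
        have h3 : ∑ y, E.p l y ≤ 0 := Finset.sum_nonpos fun y _ => hcon y
        linarith
      have h3 : ∑ y, E.p l y * E.u 0 < ∑ y, E.p l y * E.u (M (List.replicate k h) l y) :=
        Finset.sum_lt_sum (fun y _ => mul_le_mul_of_nonneg_left (hpos y).le (E.p_nonneg l y))
          ⟨y, Finset.mem_univ y, mul_lt_mul_of_pos_left (hpos y) hy⟩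
      rwa [← Finset.sum_mul, E.p_sum, one_mul] at h3
    have h3 : ∀ θ, E.annuity n * E.u 0 ≤ E.value M n (l :: List.replicate k h) θ := by
      intro θ
      have h4 := pathSum_mono (E := E) (f := fun _ _ => E.u 0 + 0 * (0 : ℝ))
        (g := fun L θ => E.flowUtility (M L θ) θ) (fun L θ => by
          obtain ⟨c, hc, hce⟩ := hflow L θ
          rw [← hce, mul_zero, add_zero]
          exact E.u_strictMono.monotoneOn (mem_Ici.2 le_rfl) hc hc) n (l :: List.replicate k h) θ
      rw [pathSum_add_mul, zero_mul, add_zero, mul_comm] at h4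
      exact h4
    have h4 : E.annuity (n + 1) * E.u 0 < E.annuity (n + 1) * w k := by
      rw [h1, value, pathSum, annuity]
      have h5 : ∑ θ, E.trans l θ * (E.annuity n * E.u 0) ≤
          ∑ θ, E.trans l θ * E.value M n (l :: List.replicate k h) θ :=
        Finset.sum_le_sum fun θ _ => mul_le_mul_of_nonneg_left (h3 θ) (E.trans_nonneg _ _)
      rw [← Finset.sum_mul, E.trans_sum, one_mul] at h5
      have h6 := mul_le_mul_of_nonneg_left h5 E.δ_pos.le
      have e : (1 + E.δ * E.annuity n) * E.u 0 = E.u 0 + E.δ * (E.annuity n * E.u 0) := by ring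
      rw [e]
      exact add_lt_add_of_lt_of_le h2 h6
    exact lt_of_mul_lt_mul_left h4 (annuity_nonneg _)
  · rw [planCost, totalCost, sum_riskType, add_comm]
    have h1 := hcost E.T 0 (by omega)
    have h2 := annuity_mul_cons_le_costValue M (hw 0) (hwe' 0 E.T (by omega))
    rw [List.replicate_zero] at h1 h2
    exact add_le_add (mul_le_mul_of_nonneg_left h2 (E.init_pos l).le)
      (mul_le_mul_of_nonneg_left h1 (E.init_pos h).le)

/-! ### Pooling -/

/-- Replace a sequence by a constant after index `i`. -/
def truncate {α : Type*} (i : ℕ) (a : ℕ → α) (c : α) (j : ℕ) : α := if j ≤ i then a j else c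

theorem truncate_of_le {α : Type*} {i j : ℕ} (hj : j ≤ i) (a : ℕ → α) (c : α) :
    truncate i a c j = a j := if_pos hj

theorem truncate_of_lt {α : Type*} {i j : ℕ} (hj : i < j) (a : ℕ → α) (c : α) :
    truncate i a c j = c := if_neg (not_le.2 hj)

theorem truncate_mem {α : Type*} {i : ℕ} {a : ℕ → α} {c : α} {I : Set α} (ha : ∀ j, a j ∈ I)
    (hc : c ∈ I) (j : ℕ) : truncate i a c j ∈ I := by
  unfold truncate
  split_ifs
  · exact ha j
  · exact hc

theorem highValue_truncate_of_lt {i k : ℕ} (hk : i < k) (w₀ : ℝ) (n : ℕ) :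
    E.highValue (truncate i v fun _ => w₀) (truncate i w w₀) n k = E.annuity n * w₀ := by
  rw [← highSum_const (E := E) w₀ n k]
  refine highSum_congr (fun j hj _ => ?_) (fun j hj _ => truncate_of_lt (by omega) _ _)
  rw [truncate_of_lt (by omega), mean_const]

theorem highCost_truncate_of_lt {i k : ℕ} (hk : i < k) (w₀ : ℝ) (n : ℕ) :
    E.highCost (truncate i v fun _ => w₀) (truncate i w w₀) n k = E.annuity n * E.cons w₀ := by
  rw [← highSum_const (E := E) (E.cons w₀) n k]
  refine highSum_congr (fun j hj _ => ?_) (fun j hj _ => by rw [truncate_of_lt (by omega)])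
  rw [truncate_of_lt (by omega), mean_const]

theorem highValue_truncate_of_le {i j n : ℕ} (hj : j ≤ i) {w₀ : ℝ}
    (hval : E.annuity n * w₀ = E.entryValue v w n (i + 1)) {m : ℕ} (hm : j + m = i + 1 + n) :
    E.highValue (truncate i v fun _ => w₀) (truncate i w w₀) m j = E.highValue v w m j := by
  have h1 := highSum_sub_of_agree (E := E) (i := i - j) (k := j)
    (a := fun k => E.mean h (truncate i v (fun _ => w₀) k)) (β := truncate i w w₀)
    (a' := fun k => E.mean h (v k)) (β' := w) n
    (fun r _ hr => by rw [truncate_of_le (by omega)])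
    (fun r _ hr => truncate_of_le (by omega) _ _)
  have e1 : i - j + 1 + n = m := by omega
  have e2 : j + (i - j) + 1 = i + 1 := by omega
  rw [e1, e2] at h1
  have h2 : E.entrySum (fun k => E.mean h (truncate i v (fun _ => w₀) k)) (truncate i w w₀) n
      (i + 1) = E.entrySum (fun k => E.mean h (v k)) w n (i + 1) := by
    have h3 := highValue_truncate_of_lt (E := E) (v := v) (w := w) (Nat.lt_succ_self i) w₀ n
    rw [highValue] at h3
    rw [entrySum, h3, truncate_of_lt (Nat.lt_succ_self i)]
    rw [entryValue, highValue] at hval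
    rw [entrySum, ← hval]
    linear_combination E.annuity n * w₀ * trans_h_sum (E := E)
  rw [h2, sub_self, mul_zero] at h1
  exact sub_eq_zero.1 h1

theorem planCost_sub_truncate {i n : ℕ} (hT : i + 1 + n = E.T) (w₀ : ℝ) :
    E.planCost v w - E.planCost (truncate i v fun _ => w₀) (truncate i w w₀) =
      E.init h * (E.δ ^ (i + 1) * E.trans h h ^ i) *
        (E.entryCost v w n (i + 1) - E.annuity n * E.cons w₀) := by
  have h1 := highSum_sub_of_agree (E := E) (i := i) (k := 0)
    (a := fun k => E.mean h fun y => E.cons (v k y)) (β := fun k => E.cons (w k))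
    (a' := fun k => E.mean h fun y => E.cons (truncate i v (fun _ => w₀) k y))
    (β' := fun k => E.cons (truncate i w w₀ k)) n
    (fun r _ hr => by rw [truncate_of_le (by omega)])
    (fun r _ hr => by rw [truncate_of_le (by omega)])
  have h3 := highCost_truncate_of_lt (E := E) (v := v) (w := w) (Nat.lt_succ_self i) w₀ n
  have h4 : E.entrySum (fun k => E.mean h fun y => E.cons (truncate i v (fun _ => w₀) k y))
      (fun k => E.cons (truncate i w w₀ k)) n (i + 1) = E.annuity n * E.cons w₀ := by
    rw [highCost] at h3
    rw [entrySum, h3, truncate_of_lt (Nat.lt_succ_self i)]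
    linear_combination E.annuity n * E.cons w₀ * trans_h_sum (E := E)
  rw [zero_add, hT, h4] at h1
  have h5 : E.highCost v w E.T 0 -
      E.highCost (truncate i v fun _ => w₀) (truncate i w w₀) E.T 0 =
      E.δ ^ (i + 1) * E.trans h h ^ i *
        (E.entryCost v w n (i + 1) - E.annuity n * E.cons w₀) := h1
  rw [planCost, planCost, truncate_of_le (Nat.zero_le i)]
  linear_combination E.init h * h5

/-- Insuring everybody fully from a date on at which the high type is promised less than the low
type preserves admissibility. -/
theorem Admissible.pool (ha : E.Admissible V v w) {i n : ℕ} (hT : i + 1 + n = E.T) {w₀ : ℝ}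
    (hw₀ : w₀ ∈ E.utilityRange) (hval : E.annuity n * w₀ = E.entryValue v w n (i + 1))
    (hle : E.highValue v w n (i + 1) ≤ E.annuity n * w (i + 1)) :
    E.Admissible V (truncate i v fun _ => w₀) (truncate i w w₀) := by
  refine ⟨fun k y => ?_, truncate_mem ha.mem_w hw₀, ?_, ?_, ?_⟩
  · exact truncate_mem (I := {f : E.Y → ℝ | ∀ y, f y ∈ E.utilityRange}) ha.mem_v
      (fun _ => hw₀) k y
  · rw [truncate_of_le (Nat.zero_le i)]
    exact ha.low
  · rw [highValue_truncate_of_le (Nat.zero_le i) hval (by omega)]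
    exact ha.high
  · intro k m hk
    rcases lt_trichotomy k i with hlt | rfl | hlt
    · rw [truncate_of_le hlt.le, truncate_of_le hlt.le, truncate_of_le hlt,
        highValue_truncate_of_le hlt hval (by omega)]
      exact ha.ic k m hk
    -- At the last date before pooling the high state is the worse one, and by persistence an
    -- imitating low type expects it less often than a high type does. Pooling at the high type's
    -- average therefore does not raise the imitator's continuation.
    · have hm : m = n := by omega
      subst hm
      rw [truncate_of_le le_rfl, truncate_of_le le_rfl, truncate_of_lt (Nat.lt_succ_self k),
        highValue_truncate_of_lt (Nat.lt_succ_self k)]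
      refine le_trans (add_le_add le_rfl (mul_le_mul_of_nonneg_left ?_ E.δ_pos.le)) (ha.ic k m hk)
      rw [entryValue] at hval
      have h1 := trans_h_sum (E := E)
      have h2 := trans_l_sum (E := E)
      have h3 := E.persistent h l (by decide)
      have e1 : E.trans h l = 1 - E.trans h h := by linarith
      have e2 : E.trans l l = 1 - E.trans l h := by linarith
      rw [e1] at hval
      rw [e2]
      nlinarith
    · rw [truncate_of_lt hlt, truncate_of_lt hlt, truncate_of_lt (by omega),
        highValue_truncate_of_lt (by omega), mean_const, annuity]
      refine le_of_eq ?_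
      linear_combination E.δ * E.annuity m * w₀ * trans_l_sum (E := E)

theorem exists_entryValue_eq (hv : ∀ k y, v k y ∈ E.utilityRange)
    (hw : ∀ k, w k ∈ E.utilityRange) (n k : ℕ) :
    ∃ w₀ ∈ E.utilityRange, E.annuity n * w₀ = E.entryValue v w n k := by
  obtain ⟨c, hc, hce⟩ := exists_highSum_eq (E := E) E.utilityRange_convex
    (a := fun k => E.mean h (v k)) (fun k => mean_mem E.utilityRange_convex (hv k) h) hw n k
  refine ⟨_, E.utilityRange_convex hc (hw k) (E.trans_nonneg h h) (E.trans_nonneg h l)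
    (by rw [add_comm]; exact trans_h_sum), ?_⟩
  rw [entryValue, highValue, ← hce]
  simp only [smul_eq_mul]
  ring

/-- Pooling starts at the first date where the high type is promised less than the low type; `hV`
excludes the initial date. Promises before it keep their order and those after it are equal, so the
neglected constraints of the high type hold. -/
theorem Admissible.exists_feasible_le (ha : E.Admissible V v w) (hV : V l < V h) :
    ∃ M : E.Mechanism, E.Feasible V M ∧ E.totalCost M ≤ E.planCost v w := by
  classical
  by_cases hex : ∃ k n, k + n = E.T ∧ E.highValue v w n k < E.annuity n * w k
  · set k := Nat.find hex with hkdef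
    obtain ⟨n, hkn, hlt⟩ := Nat.find_spec hex
    have hmin : ∀ j < k, ∀ m, j + m = E.T → E.annuity m * w j ≤ E.highValue v w m j := by
      intro j hj m hm
      have := Nat.find_min hex hj
      push Not at this
      exact this m hm
    rw [← hkdef] at hkn hlt
    have hk0 : k ≠ 0 := by
      intro e
      rw [e, zero_add] at hkn
      rw [e, hkn, ha.low, ha.high] at hlt
      exact lt_asymm hlt hV
    obtain ⟨i, hi⟩ := Nat.exists_eq_succ_of_ne_zero hk0
    rw [Nat.succ_eq_add_one] at hi
    rw [hi] at hkn hlt hmin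
    obtain ⟨w₀, hw₀, hval⟩ := exists_entryValue_eq ha.mem_v ha.mem_w n (i + 1)
    have ha' := ha.pool hkn hw₀ hval hlt.le
    refine ⟨_, ha'.feasible fun j m hm => ?_, ?_⟩
    · rcases le_or_gt j i with hj | hj
      · rw [highValue_truncate_of_le hj hval (by omega), truncate_of_le hj]
        exact hmin j (by omega) m hm
      · rw [highValue_truncate_of_lt hj, truncate_of_lt hj]
    · rw [totalCost_plan ha'.mem_v ha'.mem_w]
      have h1 := planCost_sub_truncate (E := E) (v := v) (w := w) hkn w₀
      have h2 := annuity_mul_cons_le_entryCost ha.mem_v ha.mem_w hw₀ hval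
      have h3 : 0 ≤ E.init h * (E.δ ^ (i + 1) * E.trans h h ^ i) :=
        mul_nonneg (E.init_pos h).le (mul_nonneg (pow_nonneg E.δ_pos.le _)
          (pow_nonneg (E.trans_nonneg _ _) _))
      have h4 := mul_nonneg h3 (sub_nonneg.2 h2)
      linarith
  · push Not at hex
    exact ⟨_, ha.feasible hex, (totalCost_plan ha.mem_v ha.mem_w).le⟩

/-- In a cost-minimizing interior plan the high type is promised strictly more than the low type
or both are fully insured at the same level. -/
theorem Admissible.eq_of_highValue_le (hmix : 0 < E.trans h l) (ha : E.Admissible V v w)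
    (hmin : ∀ v' w', E.Admissible V v' w' → E.planCost v w ≤ E.planCost v' w') {i n : ℕ}
    (hT : i + 1 + (n + 1) = E.T) (hpos : E.u 0 < w (i + 1))
    (hle : E.highValue v w (n + 1) (i + 1) ≤ E.annuity (n + 1) * w (i + 1)) :
    E.highValue v w (n + 1) (i + 1) = E.annuity (n + 1) * w (i + 1) ∧
      ∀ y, v (i + 1) y = w (i + 1) := by
  obtain ⟨w₀, hw₀, hval⟩ := exists_entryValue_eq ha.mem_v ha.mem_w (n + 1) (i + 1)
  have hA := annuity_succ_pos (E := E) n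
  -- Pooling is admissible here, so minimality forces equality in Jensen.
  have h1 := hmin _ _ (ha.pool hT hw₀ hval hle)
  have h2 := planCost_sub_truncate (E := E) (v := v) (w := w) hT w₀
  have h3 : 0 < E.init h * (E.δ ^ (i + 1) * E.trans h h ^ i) :=
    mul_pos (E.init_pos h) (mul_pos (pow_pos E.δ_pos _) (pow_pos trans_h_h_pos _))
  have h4 : E.entryCost v w (n + 1) (i + 1) ≤ E.annuity (n + 1) * E.cons w₀ := by
    by_contra! hcon
    have := mul_pos h3 (sub_pos.2 hcon)
    linarith
  have hw₀pos : 0 < E.cons w₀ := by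
    rw [E.cons_pos_iff hw₀]
    obtain ⟨c, hc, hce⟩ := exists_highSum_eq (E := E) E.utilityRange_convex
      (a := fun k => E.mean h (v k)) (fun k => mean_mem E.utilityRange_convex (ha.mem_v k) h)
      ha.mem_w (n + 1) (i + 1)
    have hc0 : E.u 0 ≤ c := by
      obtain ⟨c', hc', rfl⟩ := hc
      exact E.u_strictMono.monotoneOn (mem_Ici.2 le_rfl) hc' hc'
    rw [entryValue, highValue, ← hce] at hval
    have h5 : w₀ = E.trans h h * c + E.trans h l * w (i + 1) := by
      refine mul_left_cancel₀ hA.ne' ?_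
      rw [hval]
      ring
    rw [h5]
    have h6 := mul_le_mul_of_nonneg_left hc0 (E.trans_nonneg h h)
    have h7 := mul_lt_mul_of_pos_left hpos hmix
    have h8 : E.trans h h * E.u 0 + E.trans h l * E.u 0 = E.u 0 := by
      rw [← add_mul, add_comm, trans_h_sum, one_mul]
    linarith
  obtain ⟨e1, e2⟩ := eq_of_entryCost_le hmix ha.mem_v ha.mem_w hw₀ hw₀pos hval h4
  refine ⟨?_, fun y => by rw [e2 y, e1]⟩
  rw [entryValue, ← e1] at hval
  refine mul_left_cancel₀ (trans_h_h_pos (E := E)).ne' ?_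
  have h5 : E.trans h h * (E.annuity (n + 1) * w (i + 1)) +
      E.trans h l * (E.annuity (n + 1) * w (i + 1)) = E.annuity (n + 1) * w (i + 1) := by
    rw [← add_mul, add_comm, trans_h_sum, one_mul]
  linarith

end Model

/-! ### First-order conditions of a cost-minimizing plan -/

theorem nonneg_of_hasDerivAt_of_forall_ge {φ : ℝ → ℝ} {D : ℝ} (hφ : HasDerivAt φ D 0)
    (h : ∀ᶠ ε in 𝓝[>] (0 : ℝ), φ 0 ≤ φ ε) : 0 ≤ D := by
  have h1 : Tendsto (slope φ 0) (𝓝[>] 0) (𝓝 D) :=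
    (hasDerivWithinAt_iff_tendsto_slope' (lt_irrefl _)).1 (hφ.hasDerivWithinAt (s := Ioi 0))
  refine ge_of_tendsto h1 ?_
  filter_upwards [h, self_mem_nhdsWithin] with ε hε hpos
  rw [slope_def_field]
  exact div_nonneg (sub_nonneg.2 hε) (by rw [sub_zero]; exact le_of_lt hpos)

namespace Model

variable {E : Model} {v : ℕ → E.Y → ℝ} {w : ℕ → ℝ} {V : RiskType → ℝ}

theorem hasDerivAt_highSum {A B : ℕ → ℝ → ℝ} {A' B' : ℕ → ℝ} {x : ℝ}
    (hA : ∀ j, HasDerivAt (A j) (A' j) x) (hB : ∀ j, HasDerivAt (B j) (B' j) x) (n k : ℕ) :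
    HasDerivAt (fun ε => E.highSum (fun j => A j ε) (fun j => B j ε) n k)
      (E.highSum A' B' n k) x := by
  induction n generalizing k with
  | zero => exact hasDerivAt_const x 0
  | succ n ih =>
    exact (hA k).fun_add ((((ih (k + 1)).const_mul _).fun_add
      (((hB (k + 1)).const_mul _).const_mul _)).const_mul _)

theorem hasDerivAt_mean {f : E.Y → ℝ → ℝ} {f' : E.Y → ℝ} {x : ℝ}
    (hf : ∀ y, HasDerivAt (f y) (f' y) x) (θ : RiskType) :
    HasDerivAt (fun ε => E.mean θ fun y => f y ε) (E.mean θ f') x :=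
  HasDerivAt.fun_sum fun y _ => (hf y).const_mul _

theorem hasDerivAt_cons_line {x d : ℝ} (h : (x ∈ E.utilityRange ∧ 0 < E.cons x) ∨ d = 0) :
    HasDerivAt (fun ε : ℝ => E.cons (x + ε * d)) (E.marginalCost (E.cons x) * d) 0 := by
  rcases h with ⟨hx, hpos⟩ | rfl
  · have h1 : HasDerivAt (fun ε : ℝ => x + ε * d) d 0 := by
      simpa using ((hasDerivAt_id (0 : ℝ)).mul_const d).const_add x
    have h2 : HasDerivAt E.cons (E.marginalCost (E.cons x)) (x + 0 * d) := by
      rw [zero_mul, add_zero]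
      exact E.hasDerivAt_cons hx hpos
    exact h2.comp 0 h1
  · simpa using hasDerivAt_const (0 : ℝ) (E.cons x)

theorem eventually_line_mem {x d : ℝ} (hx : x ∈ E.utilityRange) (h : 0 < E.cons x ∨ d = 0) :
    ∀ᶠ ε in 𝓝 (0 : ℝ), x + ε * d ∈ E.utilityRange := by
  rcases h with hpos | rfl
  · have h1 : ContinuousAt (fun ε : ℝ => x + ε * d) 0 := by fun_prop
    refine h1.eventually ?_
    beta_reduce
    rw [zero_mul, add_zero]
    exact E.utilityRange_mem_nhds hx hpos
  · simpa using hx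

variable (E) in
/-- All consumption levels on the high path and after a first low report are positive. -/
def InteriorPlan (v : ℕ → E.Y → ℝ) (w : ℕ → ℝ) : Prop :=
  ∀ k < E.T, (∀ y, 0 < E.cons (v k y)) ∧ 0 < E.cons (w k)

/-- First-order condition: no admissible direction lowers the cost of a cost-minimizing plan. -/
theorem Admissible.directional_cost_nonneg (ha : E.Admissible V v w)
    (hmin : ∀ v' w', E.Admissible V v' w' → E.planCost v w ≤ E.planCost v' w')
    (hint : E.InteriorPlan v w) {a : ℕ → E.Y → ℝ} {b : ℕ → ℝ}
    (haT : ∀ k, E.T ≤ k → ∀ y, a k y = 0) (hbT : ∀ k, E.T ≤ k → b k = 0) (hb0 : b 0 = 0)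
    (hhigh : E.highValue a b E.T 0 = 0)
    (hic : ∀ k n, k + n + 1 = E.T → E.mean l (a k) + E.δ * (E.trans l h *
      E.highValue a b n (k + 1) + E.trans l l * (E.annuity n * b (k + 1))) ≤
        E.annuity (n + 1) * b k) :
    0 ≤ E.highSum (fun k => E.mean h fun y => E.marginalCost (E.cons (v k y)) * a k y)
      (fun k => E.marginalCost (E.cons (w k)) * b k) E.T 0 := by
  set v' : ℝ → ℕ → E.Y → ℝ := fun ε k y => v k y + ε * a k y
  set w' : ℝ → ℕ → ℝ := fun ε k => w k + ε * b k
  have hval : ∀ ε n k, E.highValue (v' ε) (w' ε) n k =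
      E.highValue v w n k + ε * E.highValue a b n k := by
    intro ε n k
    simp only [highValue]
    rw [← highSum_add_mul]
    exact highSum_congr (fun j _ _ => mean_add_mul _ _ _ _) (fun _ _ _ => rfl)
  -- From `E.T` on consumption may be zero, but there the direction vanishes and the line stays in
  -- the utility range.
  have hvcase : ∀ k y, 0 < E.cons (v k y) ∨ a k y = 0 := fun k y =>
    (lt_or_ge k E.T).imp (fun hk => (hint k hk).1 y) (fun hk => haT k hk y)
  have hwcase : ∀ k, 0 < E.cons (w k) ∨ b k = 0 := fun k =>
    (lt_or_ge k E.T).imp (fun hk => (hint k hk).2) (fun hk => hbT k hk)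
  have hmemv : ∀ᶠ ε in 𝓝 (0 : ℝ), ∀ k ∈ Finset.range E.T, ∀ y, v' ε k y ∈ E.utilityRange :=
    (Filter.eventually_all_finset _).2 fun k _ => eventually_all.2 fun y =>
      eventually_line_mem (ha.mem_v k y) (hvcase k y)
  have hmemw : ∀ᶠ ε in 𝓝 (0 : ℝ), ∀ k ∈ Finset.range E.T, w' ε k ∈ E.utilityRange :=
    (Filter.eventually_all_finset _).2 fun k _ =>
      eventually_line_mem (ha.mem_w k) (hwcase k)
  have hadm : ∀ᶠ ε in 𝓝[>] (0 : ℝ), E.planCost v w ≤ E.planCost (v' ε) (w' ε) := by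
    filter_upwards [nhdsWithin_le_nhds hmemv, nhdsWithin_le_nhds hmemw, self_mem_nhdsWithin]
      with ε h1 h2 hpos
    have hε : 0 < ε := hpos
    refine hmin _ _ ⟨fun k y => ?_, fun k => ?_, ?_, ?_, fun k n hk => ?_⟩
    · rcases lt_or_ge k E.T with hkT | hkT
      · exact h1 k (Finset.mem_range.2 hkT) y
      · simp only [v', haT k hkT y, mul_zero, add_zero]
        exact ha.mem_v k y
    · rcases lt_or_ge k E.T with hkT | hkT
      · exact h2 k (Finset.mem_range.2 hkT)
      · simp only [w', hbT k hkT, mul_zero, add_zero]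
        exact ha.mem_w k
    · simp only [w', hb0, mul_zero, add_zero]
      exact ha.low
    · rw [hval, hhigh, mul_zero, add_zero]
      exact ha.high
    · have h3 := ha.ic k n hk
      have h4 := mul_le_mul_of_nonneg_left (hic k n hk) hε.le
      have h5 : E.mean l (v' ε k) = E.mean l (v k) + ε * E.mean l (a k) := mean_add_mul _ _ _ _
      rw [hval, h5]
      simp only [w']
      linarith
  have hder : HasDerivAt (fun ε => E.planCost (v' ε) (w' ε)) (E.init h *
      E.highSum (fun k => E.mean h fun y => E.marginalCost (E.cons (v k y)) * a k y)
      (fun k => E.marginalCost (E.cons (w k)) * b k) E.T 0 +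
      E.init l * (E.annuity E.T * (E.marginalCost (E.cons (w 0)) * b 0))) 0 := by
    have hv' : ∀ k, HasDerivAt (fun ε => E.mean h fun y => E.cons (v' ε k y))
        (E.mean h fun y => E.marginalCost (E.cons (v k y)) * a k y) 0 := fun k =>
      hasDerivAt_mean (fun y => hasDerivAt_cons_line
        ((hvcase k y).imp_left fun hpos => ⟨ha.mem_v k y, hpos⟩)) h
    have hw' : ∀ k, HasDerivAt (fun ε => E.cons (w' ε k))
        (E.marginalCost (E.cons (w k)) * b k) 0 := fun k =>
      hasDerivAt_cons_line ((hwcase k).imp_left fun hpos => ⟨ha.mem_w k, hpos⟩)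
    exact ((hasDerivAt_highSum hv' hw' E.T 0).const_mul _).fun_add
      (((hw' 0).const_mul _).const_mul _)
  have h0 : E.planCost (v' 0) (w' 0) = E.planCost v w := by
    have e1 : v' 0 = v := by funext k y; simp [v']
    have e2 : w' 0 = w := by funext k; simp [w']
    rw [e1, e2]
  have := nonneg_of_hasDerivAt_of_forall_ge hder (hadm.mono fun ε hε => by rw [h0]; exact hε)
  rw [hb0, mul_zero, mul_zero, mul_zero, add_zero] at this
  exact nonneg_of_mul_nonneg_right this (E.init_pos h)

section Support

variable {a β : ℕ → ℝ} {k : ℕ}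

theorem highSum_eq_zero_of_lt (ha : ∀ j, j ≠ k → j ≠ k + 1 → a j = 0)
    (hβ : ∀ j, j ≠ k + 1 → β j = 0) {j : ℕ} (hj : k + 1 < j) (n : ℕ) :
    E.highSum a β n j = 0 := by
  have := highSum_const (E := E) 0 n j
  rw [mul_zero] at this
  rw [← this]
  exact highSum_congr (fun i hi _ => ha i (by omega) (by omega)) (fun i hi _ => hβ i (by omega))

theorem highSum_support_snd (ha : ∀ j, j ≠ k → j ≠ k + 1 → a j = 0)
    (hβ : ∀ j, j ≠ k + 1 → β j = 0) (n : ℕ) :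
    E.highSum a β (n + 1) (k + 1) = a (k + 1) := by
  rw [highSum, highSum_eq_zero_of_lt ha hβ (by omega), hβ (k + 1 + 1) (by omega)]
  ring

theorem highSum_support_fst (ha : ∀ j, j ≠ k → j ≠ k + 1 → a j = 0)
    (hβ : ∀ j, j ≠ k + 1 → β j = 0) (n : ℕ) :
    E.highSum a β (n + 1 + 1) k = a k + E.δ * (E.trans h h * a (k + 1) +
      E.trans h l * (E.annuity (n + 1) * β (k + 1))) := by
  rw [highSum, highSum_support_snd ha hβ]

theorem highSum_support_of_le (ha : ∀ j, j ≠ k → j ≠ k + 1 → a j = 0)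
    (hβ : ∀ j, j ≠ k + 1 → β j = 0) (m : ℕ) {i j : ℕ} (hj : j + i = k) :
    E.highSum a β (i + m) j = (E.δ * E.trans h h) ^ i * E.highSum a β m k := by
  induction i generalizing j with
  | zero =>
    obtain rfl : j = k := by omega
    simp
  | succ i ih =>
    have e : i + 1 + m = (i + m) + 1 := by omega
    rw [e, highSum, ih (j := j + 1) (by omega), ha j (by omega) (by omega),
      hβ (j + 1) (by omega)]
    ring

end Support

/-- First-order condition for directions that change two consecutive contracts on the high path
and the utility after a low report between them. -/
theorem Admissible.local_cost_nonneg (ha : E.Admissible V v w)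
    (hmin : ∀ v' w', E.Admissible V v' w' → E.planCost v w ≤ E.planCost v' w')
    (hint : E.InteriorPlan v w) {k n : ℕ} (hT : k + (n + 1 + 1) = E.T) (f₀ f₁ : E.Y → ℝ) (γ : ℝ)
    (hhigh : E.mean h f₀ + E.δ * (E.trans h h * E.mean h f₁ + E.trans h l * γ) = 0)
    (hic₀ : E.mean l f₀ + E.δ * (E.trans l h * E.mean h f₁ + E.trans l l * γ) ≤ 0)
    (hic₁ : E.mean l f₁ ≤ γ) :
    0 ≤ (E.mean h fun y => E.marginalCost (E.cons (v k y)) * f₀ y) + E.δ * (E.trans h h *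
      (E.mean h fun y => E.marginalCost (E.cons (v (k + 1) y)) * f₁ y) +
      E.trans h l * (E.marginalCost (E.cons (w (k + 1))) * γ)) := by
  have hA := annuity_succ_pos (E := E) n
  set a : ℕ → E.Y → ℝ := fun j => if j = k then f₀ else if j = k + 1 then f₁ else 0 with haf
  -- `γ` is a present value, spread evenly over the `n + 1` remaining periods.
  set b : ℕ → ℝ := fun j => if j = k + 1 then γ / E.annuity (n + 1) else 0 with hbf
  have ha0 : a k = f₀ := by simp [haf]
  have ha1 : a (k + 1) = f₁ := by simp [haf]
  have haz : ∀ j, j ≠ k → j ≠ k + 1 → a j = 0 := fun j h1 h2 => by simp [haf, h1, h2]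
  have hb1 : E.annuity (n + 1) * b (k + 1) = γ := by
    simp only [hbf, if_true]
    field_simp
  have hbz : ∀ j, j ≠ k + 1 → b j = 0 := fun j h1 => by simp [hbf, h1]
  have hzero : ∀ θ, E.mean θ (0 : E.Y → ℝ) = 0 := fun θ => mean_const θ 0
  have hma : ∀ j, j ≠ k → j ≠ k + 1 → E.mean h (a j) = 0 := fun j h1 h2 => by
    rw [haz j h1 h2, hzero]
  have hvk : E.highValue a b (n + 1 + 1) k = 0 := by
    rw [highValue, highSum_support_fst hma hbz, ha0, ha1, hb1]
    exact hhigh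
  have hvle : ∀ i j, j + i = k → E.highValue a b (i + (n + 1 + 1)) j = 0 := by
    intro i j hj
    rw [highValue] at hvk ⊢
    rw [highSum_support_of_le hma hbz _ hj, hvk, mul_zero]
  have key := ha.directional_cost_nonneg hmin hint (a := a) (b := b)
    (fun j hj y => by rw [haz j (by omega) (by omega)]; rfl) (fun j hj => hbz j (by omega))
    (hbz 0 (by omega)) (by rw [← hT]; exact hvle k 0 (by omega)) (by
      intro j m hm
      rcases lt_trichotomy j k with hj | rfl | hj
      · obtain ⟨i, hi⟩ : ∃ i, j + 1 + i = k := ⟨k - j - 1, by omega⟩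
        have h1 := hvle i (j + 1) hi
        have e : i + (n + 1 + 1) = m := by omega
        rw [e] at h1
        rw [h1, hbz (j + 1) (by omega), hbz j (by omega), haz j (by omega) (by omega), hzero]
        simp
      · obtain rfl : m = n + 1 := by omega
        rw [highValue, highSum_support_snd hma hbz, hb1, ha0, ha1, hbz j (by omega), mul_zero]
        exact hic₀
      · rcases eq_or_ne j (k + 1) with rfl | hne
        · obtain rfl : m = n := by omega
          rw [highValue, highSum_eq_zero_of_lt hma hbz (by omega), hbz (k + 1 + 1) (by omega),
            hb1, ha1]
          simpa using hic₁
        · rw [highValue, highSum_eq_zero_of_lt hma hbz (by omega), hbz (j + 1) (by omega),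
            hbz j (by omega), haz j (by omega) hne, hzero]
          simp)
  have hca : ∀ j, j ≠ k → j ≠ k + 1 →
      (E.mean h fun y => E.marginalCost (E.cons (v j y)) * a j y) = 0 := fun j h1 h2 => by
    rw [haz j h1 h2]
    simp only [Pi.zero_apply, mul_zero]
    exact mean_const h 0
  have hcb : ∀ j, j ≠ k + 1 → E.marginalCost (E.cons (w j)) * b j = 0 := fun j h1 => by
    rw [hbz j h1, mul_zero]
  rw [← hT, highSum_support_of_le hca hcb (n + 1 + 1) (j := 0) (i := k) (by omega),
    highSum_support_fst hca hcb, ha0, ha1, mul_left_comm (E.annuity (n + 1)), hb1] at key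
  exact nonneg_of_mul_nonneg_right key (pow_pos (mul_pos E.δ_pos trans_h_h_pos) k)

/-! ### Multipliers -/

variable (E) in
/-- The multiplier of the high type's utility. -/
def utilityMultiplier (v : ℕ → E.Y → ℝ) (k : ℕ) : ℝ :=
  E.mean h fun y => E.marginalCost (E.cons (v k y))

variable (E) in
/-- The multiplier of the distortion. -/
def distortionMultiplier (v : ℕ → E.Y → ℝ) (k : ℕ) : ℝ :=
  (E.mean h fun y => E.marginalCost (E.cons (v k y)) * E.score y) / E.scoreVar

variable (E) in
/-- A change of a contract in utility units that raises high-type utility by `α` and the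
distortion by `β`. -/
def shift (α β : ℝ) (y : E.Y) : ℝ := α + β / E.scoreVar * E.score y

theorem mean_score : E.mean h E.score = 0 := sum_p_score

theorem mean_low (f : E.Y → ℝ) :
    E.mean l f = E.mean h f - E.mean h fun y => E.score y * f y := by
  simp only [mean, ← mul_assoc, p_mul_score, ← Finset.sum_sub_distrib]
  exact Finset.sum_congr rfl fun y _ => by ring

theorem mean_high_shift (α β : ℝ) : E.mean h (E.shift α β) = α := by
  have := mean_affine α (β / E.scoreVar) E.score h
  rw [mean_score, mul_zero, add_zero] at this
  exact this

theorem mean_low_shift (α β : ℝ) : E.mean l (E.shift α β) = α - β := by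
  rw [mean_low, mean_high_shift]
  have : (E.mean h fun y => E.score y * E.shift α β y) = β / E.scoreVar * E.scoreVar :=
    sum_p_score_affine α (β / E.scoreVar)
  rw [this, div_mul_cancel₀ _ scoreVar_pos.ne']

theorem mean_marginalCost_shift (v : ℕ → E.Y → ℝ) (k : ℕ) (α β : ℝ) :
    (E.mean h fun y => E.marginalCost (E.cons (v k y)) * E.shift α β y) =
      E.utilityMultiplier v k * α + E.distortionMultiplier v k * β := by
  simp only [mean, utilityMultiplier, distortionMultiplier, shift, Finset.sum_mul, Finset.sum_div,
    ← Finset.sum_add_distrib]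
  exact Finset.sum_congr rfl fun y _ => by ring

/-- First-order condition in terms of utilities and distortions. -/
theorem Admissible.multiplier_nonneg (ha : E.Admissible V v w)
    (hmin : ∀ v' w', E.Admissible V v' w' → E.planCost v w ≤ E.planCost v' w')
    (hint : E.InteriorPlan v w) {k n : ℕ} (hT : k + (n + 1 + 1) = E.T) (α₀ β₀ α₁ β₁ γ : ℝ)
    (hhigh : α₀ + E.δ * (E.trans h h * α₁ + E.trans h l * γ) = 0)
    (hic₀ : α₀ - β₀ + E.δ * (E.trans l h * α₁ + E.trans l l * γ) ≤ 0)
    (hic₁ : α₁ - β₁ ≤ γ) :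
    0 ≤ (E.utilityMultiplier v k * α₀ + E.distortionMultiplier v k * β₀) + E.δ * (E.trans h h *
      (E.utilityMultiplier v (k + 1) * α₁ + E.distortionMultiplier v (k + 1) * β₁) +
      E.trans h l * (E.marginalCost (E.cons (w (k + 1))) * γ)) := by
  have := ha.local_cost_nonneg hmin hint hT (E.shift α₀ β₀) (E.shift α₁ β₁) γ
    (by simpa only [mean_high_shift] using hhigh)
    (by simpa only [mean_high_shift, mean_low_shift] using hic₀)
    (by simpa only [mean_low_shift] using hic₁)
  simpa only [mean_marginalCost_shift] using this

/-- A larger distortion at fixed high-type utility only hurts the imitator, so this direction is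
admissible and cannot save cost. -/
theorem Admissible.distortionMultiplier_nonneg (ha : E.Admissible V v w)
    (hmin : ∀ v' w', E.Admissible V v' w' → E.planCost v w ≤ E.planCost v' w')
    (hint : E.InteriorPlan v w) {k n : ℕ} (hT : k + (n + 1 + 1) = E.T) :
    0 ≤ E.distortionMultiplier v k ∧ 0 ≤ E.distortionMultiplier v (k + 1) := by
  constructor
  · have := ha.multiplier_nonneg hmin hint hT 0 1 0 0 0 (by simp) (by simp) (by simp)
    simpa using this
  · have := ha.multiplier_nonneg hmin hint hT 0 0 0 1 0 (by simp) (by simp) (by simp)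
    simp only [mul_zero, zero_add, mul_one, add_zero] at this
    rw [← mul_assoc] at this
    exact nonneg_of_mul_nonneg_right this (mul_pos E.δ_pos trans_h_h_pos)

/-- The multiplier of utility is a martingale. -/
theorem Admissible.utilityMultiplier_eq (ha : E.Admissible V v w)
    (hmin : ∀ v' w', E.Admissible V v' w' → E.planCost v w ≤ E.planCost v' w')
    (hint : E.InteriorPlan v w) {k n : ℕ} (hT : k + (n + 1 + 1) = E.T) :
    E.utilityMultiplier v k = E.trans h h * E.utilityMultiplier v (k + 1) +
      E.trans h l * E.marginalCost (E.cons (w (k + 1))) := by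
  have e1 : E.trans h l = 1 - E.trans h h := by linarith [trans_h_sum (E := E)]
  have e2 : E.trans l l = 1 - E.trans l h := by linarith [trans_l_sum (E := E)]
  -- One more unit of utility for both types at the next date, against `E.δ` units at this one,
  -- leaves every constraint unchanged. Hence both signs are admissible.
  have h1 := ha.multiplier_nonneg hmin hint hT (-E.δ) 0 1 0 1 (by rw [e1]; ring)
    (by rw [e2]; exact le_of_eq (by ring)) (by norm_num)
  have h2 := ha.multiplier_nonneg hmin hint hT E.δ 0 (-1) 0 (-1) (by rw [e1]; ring)
    (by rw [e2]; exact le_of_eq (by ring)) (by norm_num)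
  refine mul_left_cancel₀ E.δ_pos.ne' ?_
  linarith

/-- The law of motion of the multiplier of the distortion. -/
theorem Admissible.distortionMultiplier_eq (ha : E.Admissible V v w)
    (hmin : ∀ v' w', E.Admissible V v' w' → E.planCost v w ≤ E.planCost v' w')
    (hint : E.InteriorPlan v w) {k n : ℕ} (hT : k + (n + 1 + 1) = E.T) :
    (E.trans h h - E.trans l h) * E.distortionMultiplier v k =
      E.trans h h * E.distortionMultiplier v (k + 1) +
      E.trans h l * (E.utilityMultiplier v k - E.marginalCost (E.cons (w (k + 1)))) := by
  have e1 : E.trans h l = 1 - E.trans h h := by linarith [trans_h_sum (E := E)]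
  have e2 : E.trans l l = 1 - E.trans l h := by linarith [trans_l_sum (E := E)]
  -- At the next date the low type loses one unit and the distortion rises by one, so that
  -- constraint is unchanged. The contract at `k` is adjusted to preserve the promise and the
  -- constraint there, so both signs are admissible.
  have h1 := ha.multiplier_nonneg hmin hint hT (E.δ * E.trans h l)
    (-(E.δ * (E.trans h h - E.trans l h))) 0 1 (-1) (by ring)
    (by rw [e1, e2]; exact le_of_eq (by ring)) (by norm_num)
  have h2 := ha.multiplier_nonneg hmin hint hT (-(E.δ * E.trans h l))
    (E.δ * (E.trans h h - E.trans l h)) 0 (-1) 1 (by ring)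
    (by rw [e1, e2]; exact le_of_eq (by ring)) (by norm_num)
  refine mul_left_cancel₀ E.δ_pos.ne' ?_
  linarith

/-- Marginal costs are affine in the score if perturbations that keep both types' utilities do
not lower the cost. -/
theorem marginalCost_eq_affine {k : ℕ} (hk : ∀ f : E.Y → ℝ, E.mean h f = 0 → E.mean l f = 0 →
    0 ≤ E.mean h fun y => E.marginalCost (E.cons (v k y)) * f y) (y : E.Y) :
    E.marginalCost (E.cons (v k y)) =
      E.utilityMultiplier v k + E.distortionMultiplier v k * E.score y := by
  set m : E.Y → ℝ := fun y => E.marginalCost (E.cons (v k y)) with hm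
  set a := E.utilityMultiplier v k with haa
  set b := E.distortionMultiplier v k with hbb
  -- Minus the residual of regressing marginal cost on a constant and the score. It preserves both
  -- types' utilities and changes cost by minus its second moment, hence vanishes.
  set f : E.Y → ℝ := fun y => (a + b * E.score y) - m y with hf
  have hσ := scoreVar_pos (E := E)
  have h1 : E.mean h f = 0 := by
    have e : E.mean h f = ∑ y, E.p h y * (a + b * E.score y) - E.mean h m := by
      simp only [mean, hf, mul_sub, Finset.sum_sub_distrib]
    rw [e, sum_p_affine]
    exact sub_self _
  have h2 : (E.mean h fun y => E.score y * f y) = 0 := by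
    have e : (E.mean h fun y => E.score y * f y) =
        ∑ y, E.p h y * (E.score y * (a + b * E.score y)) - E.mean h fun y => m y * E.score y := by
      simp only [mean, hf, ← Finset.sum_sub_distrib]
      exact Finset.sum_congr rfl fun y _ => by ring
    rw [e, sum_p_score_affine, hbb, distortionMultiplier, div_mul_cancel₀ _ hσ.ne']
    exact sub_self _
  have h3 := hk f h1 (by rw [mean_low, h1, h2, sub_zero])
  have h4 : (E.mean h fun y => m y * f y) = - E.mean h fun y => f y ^ 2 := by
    have e : (E.mean h fun y => m y * f y) = a * E.mean h f + b * (E.mean h fun y => E.score y * f y)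
        - E.mean h fun y => f y ^ 2 := by
      simp only [mean, Finset.mul_sum, ← Finset.sum_add_distrib, ← Finset.sum_sub_distrib]
      refine Finset.sum_congr rfl fun y _ => ?_
      have : m y = (a + b * E.score y) - f y := by simp only [hf]; ring
      rw [this]
      ring
    rw [e, h1, h2]
    ring
  have h5 : (E.mean h fun y => f y ^ 2) ≤ 0 := by
    have : (E.mean h fun y => m y * f y) = E.mean h fun y =>
      E.marginalCost (E.cons (v k y)) * f y := rfl
    linarith
  have h6 : E.p h y * f y ^ 2 ≤ E.mean h fun y => f y ^ 2 :=
    Finset.single_le_sum (f := fun y => E.p h y * f y ^ 2)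
      (fun y _ => mul_nonneg (E.p_nonneg h y) (sq_nonneg _)) (Finset.mem_univ y)
  have h7 : f y ^ 2 ≤ 0 := by
    by_contra! hcon
    have := mul_pos (E.p_high_pos y) hcon
    linarith
  have h8 : f y = 0 := pow_eq_zero_iff (two_ne_zero) |>.1 (le_antisymm h7 (sq_nonneg _))
  have h9 : f y = (a + b * E.score y) - m y := rfl
  have h10 : m y = a + b * E.score y := by linarith
  exact h10

theorem Admissible.marginalCost_eq (ha : E.Admissible V v w)
    (hmin : ∀ v' w', E.Admissible V v' w' → E.planCost v w ≤ E.planCost v' w')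
    (hint : E.InteriorPlan v w) {k n : ℕ} (hT : k + (n + 1 + 1) = E.T) (y : E.Y) :
    E.marginalCost (E.cons (v k y)) =
        E.utilityMultiplier v k + E.distortionMultiplier v k * E.score y ∧
      E.marginalCost (E.cons (v (k + 1) y)) =
        E.utilityMultiplier v (k + 1) + E.distortionMultiplier v (k + 1) * E.score y := by
  have hzero : ∀ θ, E.mean θ (fun _ : E.Y => (0 : ℝ)) = 0 := fun θ => mean_const θ 0
  constructor
  · refine marginalCost_eq_affine (fun f h1 h2 => ?_) y
    have := ha.local_cost_nonneg hmin hint hT f (fun _ => 0) 0 (by rw [h1, hzero]; ring)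
      (by rw [h2, hzero]; exact le_of_eq (by ring)) (by rw [hzero])
    simpa only [mul_zero, hzero, add_zero] using this
  · refine marginalCost_eq_affine (fun f h1 h2 => ?_) y
    have := ha.local_cost_nonneg hmin hint hT (fun _ => 0) f 0 (by rw [h1, hzero]; ring)
      (by rw [h1, hzero]; exact le_of_eq (by ring)) (by rw [h2])
    simp only [mul_zero, hzero, add_zero, zero_add] at this
    rw [← mul_assoc] at this
    exact nonneg_of_mul_nonneg_right this (mul_pos E.δ_pos trans_h_h_pos)

end Model

/-! ### Monotonicity along the high path -/

namespace Model

variable {E : Model} {v : ℕ → E.Y → ℝ} {w : ℕ → ℝ} {V : RiskType → ℝ}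

/-- The first-order conditions concern pairs of consecutive dates. The last date is covered as the
second of a pair, whence `2 ≤ E.T`. -/
theorem Admissible.mem_dualDomain (ha : E.Admissible V v w)
    (hmin : ∀ v' w', E.Admissible V v' w' → E.planCost v w ≤ E.planCost v' w')
    (hint : E.InteriorPlan v w) (hT : 2 ≤ E.T) {k : ℕ} (hk : k < E.T) :
    (E.utilityMultiplier v k, E.distortionMultiplier v k) ∈ E.dualDomain ∧
      (∀ y, v k y = E.kappa (E.utilityMultiplier v k + E.distortionMultiplier v k * E.score y)) ∧
      0 ≤ E.distortionMultiplier v k := by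
  have hmc : (∀ y, E.marginalCost (E.cons (v k y)) =
      E.utilityMultiplier v k + E.distortionMultiplier v k * E.score y) ∧
      0 ≤ E.distortionMultiplier v k := by
    rcases lt_or_ge (k + 1) E.T with hk1 | hk1
    · have e : k + ((E.T - k - 2) + 1 + 1) = E.T := by omega
      exact ⟨fun y => (ha.marginalCost_eq hmin hint e y).1,
        (ha.distortionMultiplier_nonneg hmin hint e).1⟩
    · obtain ⟨j, rfl⟩ : ∃ j, k = j + 1 := ⟨k - 1, by omega⟩
      have e : j + (0 + 1 + 1) = E.T := by omega
      exact ⟨fun y => (ha.marginalCost_eq hmin hint e y).2,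
        (ha.distortionMultiplier_nonneg hmin hint e).2⟩
  have hpos : ∀ y, 0 < E.cons (v k y) := (hint k hk).1
  refine ⟨fun y => ?_, fun y => ?_, hmc.2⟩
  · simp only [← hmc.1 y]
    exact marginalCost_mem (hpos y)
  · rw [← hmc.1 y, kappa_marginalCost (hpos y), E.u_cons (ha.mem_v k y)]

/-- In a cost-minimizing interior plan the high type is promised more than the low type. -/
theorem Admissible.annuity_mul_lt_highValue (hmix : 0 < E.trans h l) (hV : V l < V h)
    (ha : E.Admissible V v w)
    (hmin : ∀ v' w', E.Admissible V v' w' → E.planCost v w ≤ E.planCost v' w')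
    (hint : E.InteriorPlan v w) (hT : 2 ≤ E.T) {k n : ℕ} (hk : k + (n + 1) = E.T) :
    E.annuity (n + 1) * w k < E.highValue v w (n + 1) k := by
  induction k generalizing n with
  | zero =>
    rw [zero_add] at hk
    rw [hk, ha.low, ha.high]
    exact hV
  | succ k ih =>
    have hkT : k + (n + 1 + 1) = E.T := by omega
    have hprev := ih hkT
    -- Otherwise both types are insured at one level at `k + 1`, and the laws of motion give a zero
    -- distortion multiplier at `k`. The contract at `k` is then constant, and the low type's
    -- constraint contradicts `hprev`.
    by_contra! hle
    have hw : E.u 0 < w (k + 1) :=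
      (E.cons_pos_iff (ha.mem_w _)).1 (hint (k + 1) (by omega)).2
    obtain ⟨heq, hv⟩ := ha.eq_of_highValue_le hmix hmin hk hw hle
    have h1 : E.utilityMultiplier v (k + 1) = E.marginalCost (E.cons (w (k + 1))) := by
      simp only [utilityMultiplier, hv]
      exact mean_const h _
    have h2 : E.distortionMultiplier v (k + 1) = 0 := by
      simp only [distortionMultiplier, hv]
      have := mean_affine 0 (E.marginalCost (E.cons (w (k + 1)))) E.score h
      simp only [zero_add, mean_score, mul_zero] at this
      rw [this, zero_div]
    have h3 := ha.utilityMultiplier_eq hmin hint hkT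
    have h4 := ha.distortionMultiplier_eq hmin hint hkT
    have h5 : E.utilityMultiplier v k = E.marginalCost (E.cons (w (k + 1))) := by
      rw [h3, h1, ← add_mul, add_comm, trans_h_sum, one_mul]
    rw [h2, h5, sub_self, mul_zero, mul_zero, add_zero] at h4
    have h6 : E.distortionMultiplier v k = 0 :=
      (mul_eq_zero.1 h4).resolve_left (sub_pos.2 (E.persistent h l (by decide))).ne'
    obtain ⟨-, hvk, -⟩ := ha.mem_dualDomain hmin hint hT (k := k) (by omega)
    have h7 : v k = fun _ => E.kappa (E.utilityMultiplier v k) := by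
      funext y
      rw [hvk y, h6, zero_mul, add_zero]
    have h8 := ha.ic k (n + 1) (by omega)
    have h9 : E.highValue v w (n + 1 + 1) k = E.mean h (v k) + E.δ * (E.trans h h *
        E.highValue v w (n + 1) (k + 1) + E.trans h l * (E.annuity (n + 1) * w (k + 1))) := rfl
    rw [heq, h7, mean_const] at h8 h9
    rw [← add_mul, add_comm (E.trans l h), trans_l_sum] at h8
    rw [← add_mul, add_comm (E.trans h h), trans_h_sum] at h9
    linarith

/-- Jensen's inequality along the high path: the high type is promised at most the utility of the
constant consumption with marginal cost `utilityMultiplier`. -/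
theorem Admissible.highValue_le (hκ : ConcaveOn ℝ E.costRange E.kappa)
    (ha : E.Admissible V v w)
    (hmin : ∀ v' w', E.Admissible V v' w' → E.planCost v w ≤ E.planCost v' w')
    (hint : E.InteriorPlan v w) (hT : 2 ≤ E.T) {k n : ℕ} (hk : k + (n + 1) = E.T) :
    E.highValue v w (n + 1) k ≤ E.annuity (n + 1) * E.kappa (E.utilityMultiplier v k) := by
  have hmean : ∀ j < E.T, E.mean h (v j) ≤ E.kappa (E.utilityMultiplier v j) := by
    intro j hj
    obtain ⟨hdom, hvj, -⟩ := ha.mem_dualDomain hmin hint hT hj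
    have e : E.mean h (v j) =
        E.dualUtility (E.utilityMultiplier v j) (E.distortionMultiplier v j) := by
      simp only [mean, dualUtility, hvj]
    rw [e]
    exact dualUtility_le_kappa hκ hdom
  induction n generalizing k with
  | zero =>
    have := hmean k (by omega)
    simp only [highValue, highSum, annuity] at this ⊢
    linarith
  | succ n ih =>
    have h1 := ih (k := k + 1) (by omega)
    have h2 := hmean k (by omega)
    have hw := (hint (k + 1) (by omega)).2
    have hdom := (ha.mem_dualDomain hmin hint hT (k := k + 1) (by omega)).1
    -- Since the multiplier at `k` is an average, concavity puts its `kappa` above the average of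
    -- the next `kappa` and `w (k + 1)`.
    have h3 := hκ.2 (mem_costRange_of_dualDomain hdom) (marginalCost_mem hw)
      (E.trans_nonneg h h) (E.trans_nonneg h l) (by rw [add_comm]; exact trans_h_sum)
    simp only [smul_eq_mul] at h3
    rw [← ha.utilityMultiplier_eq hmin hint hk, kappa_marginalCost hw,
      E.u_cons (ha.mem_w _)] at h3
    have h4 : E.highValue v w (n + 1 + 1) k = E.mean h (v k) + E.δ * (E.trans h h *
        E.highValue v w (n + 1) (k + 1) + E.trans h l * (E.annuity (n + 1) * w (k + 1))) := rfl
    have h5 := mul_le_mul_of_nonneg_left h1 (E.trans_nonneg h h)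
    have h6 := mul_le_mul_of_nonneg_left h3 (annuity_nonneg (E := E) (n + 1))
    have h7 : E.trans h h * E.highValue v w (n + 1) (k + 1) +
        E.trans h l * (E.annuity (n + 1) * w (k + 1)) ≤
        E.annuity (n + 1) * E.kappa (E.utilityMultiplier v k) := by linarith
    have h8 := mul_le_mul_of_nonneg_left h7 E.δ_pos.le
    have h9 : E.annuity (n + 1 + 1) = 1 + E.δ * E.annuity (n + 1) := rfl
    rw [h4, h9]
    linarith

/-- Along the high path of a cost-minimizing interior plan, utility rises and the distortion
falls. -/
theorem Admissible.step (hκ : ConcaveOn ℝ E.costRange E.kappa) (hmix : 0 < E.trans h l)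
    (hV : V l < V h) (ha : E.Admissible V v w)
    (hmin : ∀ v' w', E.Admissible V v' w' → E.planCost v w ≤ E.planCost v' w')
    (hint : E.InteriorPlan v w) {k n : ℕ} (hk : k + (n + 1 + 1) = E.T) :
    E.mean h (v k) < E.mean h (v (k + 1)) ∧
      E.mean h (v (k + 1)) - E.mean l (v (k + 1)) < E.mean h (v k) - E.mean l (v k) := by
  have hT : 2 ≤ E.T := by omega
  have hk1 : k + 1 + (n + 1) = E.T := by omega
  obtain ⟨hdom, hvk, -⟩ := ha.mem_dualDomain hmin hint hT (k := k) (by omega)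
  obtain ⟨hdom', hvk', hμ'⟩ := ha.mem_dualDomain hmin hint hT (k := k + 1) (by omega)
  have hw := (hint (k + 1) (by omega)).2
  -- The low promise lies strictly below the high promise, which is at most that of the constant
  -- `kappa` of the multiplier. So the marginal cost after a low report is below the multiplier at
  -- `k + 1`, and the one at `k`, an average of the two, lies strictly between.
  have h1 := (ha.annuity_mul_lt_highValue hmix hV hmin hint hT hk1).trans_le
    (ha.highValue_le hκ hmin hint hT hk1)
  have h2 := lt_of_mul_lt_mul_left h1 (annuity_nonneg _)
  rw [← E.u_cons (ha.mem_w (k + 1)), ← kappa_marginalCost hw] at h2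
  have h3 := (kappa_strictMonoOn.lt_iff_lt (marginalCost_mem hw)
    (mem_costRange_of_dualDomain hdom')).1 h2
  have h4 := ha.utilityMultiplier_eq hmin hint hk
  have h5 := ha.distortionMultiplier_eq hmin hint hk
  have h6 := trans_h_sum (E := E)
  have h7 := trans_h_h_pos (E := E)
  have e1 : E.trans h l = 1 - E.trans h h := by linarith
  have hlt : E.utilityMultiplier v k < E.utilityMultiplier v (k + 1) := by
    have := mul_pos hmix (sub_pos.2 h3)
    rw [e1] at h4 this
    linarith
  have hgap : E.marginalCost (E.cons (w (k + 1))) < E.utilityMultiplier v k := by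
    have := mul_pos h7 (sub_pos.2 h3)
    rw [e1] at h4
    linarith
  have hρ : 0 < E.trans h h - E.trans l h := sub_pos.2 (E.persistent h l (by decide))
  -- The next multiplier has weight `E.trans h h`, at least `E.trans h h - E.trans l h`, and the gap
  -- term is positive.
  have hlt' : E.distortionMultiplier v (k + 1) < E.distortionMultiplier v k := by
    have h8 := mul_pos hmix (sub_pos.2 hgap)
    have h9 := mul_nonneg (E.trans_nonneg l h) hμ'
    refine lt_of_mul_lt_mul_left ?_ hρ.le
    linarith
  have hU : ∀ j, (∀ y, v j y = E.kappa (E.utilityMultiplier v j +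
      E.distortionMultiplier v j * E.score y)) → E.mean h (v j) =
      E.dualUtility (E.utilityMultiplier v j) (E.distortionMultiplier v j) := by
    intro j hj
    simp only [mean, dualUtility, hj]
  have hD : ∀ j, (∀ y, v j y = E.kappa (E.utilityMultiplier v j +
      E.distortionMultiplier v j * E.score y)) → E.mean h (v j) - E.mean l (v j) =
      E.dualDistortion (E.utilityMultiplier v j) (E.distortionMultiplier v j) := by
    intro j hj
    rw [mean_low, sub_sub_cancel]
    simp only [mean, dualDistortion, hj]
  rw [hD k hvk, hD (k + 1) hvk', hU k hvk, hU (k + 1) hvk']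
  exact dualUtility_lt_and_dualDistortion_lt hκ hdom hdom' hμ' hlt hlt'

end Model

end DynamicInsurance

end

theorem mainTheorem2 (E : DynamicInsurance.Model)
    (hχ : E.CostSupermodular)
    (hmix : 0 < E.trans DynamicInsurance.RiskType.h DynamicInsurance.RiskType.l)
    (V : DynamicInsurance.RiskType → ℝ)
    (hV : V DynamicInsurance.RiskType.l < V DynamicInsurance.RiskType.h)
    (M : E.Mechanism) (hopt : E.IsOptimal V M) (hint : E.Interior M) :
    StrictMonoOn (E.highUtility M) (Set.Icc 1 E.T) ∧
      StrictAntiOn (E.distortion M) (Set.Icc 1 E.T) := by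
  obtain ⟨w, ha, hw, hcost⟩ := DynamicInsurance.Model.exists_reduction hmix hopt.1 hint
  set v : ℕ → E.Y → ℝ := fun k y =>
    E.u (M (List.replicate k DynamicInsurance.RiskType.h) DynamicInsurance.RiskType.h y) with hv
  -- The reduced plan costs at most `M`, which costs at most any feasible mechanism, and some such
  -- mechanism costs at most the given admissible plan.
  have hmin : ∀ v' w', E.Admissible V v' w' → E.planCost v w ≤ E.planCost v' w' := by
    intro v' w' ha'
    obtain ⟨M', hM', hle⟩ := ha'.exists_feasible_le hV
    exact hcost.trans ((DynamicInsurance.Model.totalCost_le_of_isOptimal hopt hM').trans hle)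
  have hplan : E.InteriorPlan v w := by
    intro k hk
    refine ⟨fun y => ?_, (E.cons_pos_iff (ha.mem_w k)).2 (hw k hk)⟩
    rw [hv, E.cons_u (NNReal.coe_nonneg _), NNReal.coe_pos]
    have := hint (k + 1) ⟨by omega, by omega⟩ DynamicInsurance.RiskType.h y
    rwa [Nat.add_sub_cancel] at this
  have hstep : ∀ t ∈ Set.Icc 1 E.T, t + 1 ∈ Set.Icc 1 E.T →
      E.highUtility M t < E.highUtility M (t + 1) ∧
        E.distortion M (t + 1) < E.distortion M t := by
    intro t ht ht'
    obtain ⟨k, rfl⟩ : ∃ k, t = k + 1 := ⟨t - 1, by have := ht.1; omega⟩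
    -- Plans index dates by the number `k = t - 1` of past reports.
    have e : k + ((E.T - k - 2) + 1 + 1) = E.T := by have := ht'.2; omega
    exact ha.step (DynamicInsurance.Model.kappa_concaveOn hχ) hmix hV hmin hplan e
  exact ⟨strictMonoOn_of_lt_succ Set.ordConnected_Icc fun t _ ht ht' => (hstep t ht ht').1,
    strictAntiOn_of_succ_lt Set.ordConnected_Icc fun t _ ht ht' => (hstep t ht ht').2⟩
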